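/- **Theorem (Stone duality for ample inverse semigroupoids).** *Ample inverse semigroupoids.* A graphed semigroupoid $\mathcal S$ consists of a set of vertices $\mathcal S^{(0)}$, a set of arrows (also denoted $\mathcal S$), source and range maps $\mathbf s,\mathbf r\colon\mathcal S\to\mathcal S^{(0)}$ with $\mathcal S^{(0)}=\mathbf s(\mathcal S)\cup\mathbf r(\mathcal S)$, and an associative product $ab$, defined exactly when $\mathbf s(a)=\mathbf r(b)$, with $\mathbf s(ab)=\mathbf s(b)$ and $\mathbf r(ab)=\mathbf r(a)$. It is an inverse semigroupoid if every arrow $a$ has a unique inverse $a^*$, i.e. $aa^*$ and $a^*a$ are defined, $aa^*a=a$ and $a^*aa^*=a^*$. It is topological if arrows and vertices carry topologies for which source, range, product and inversion are continuous, and ample if moreover $\mathbf s$ is a local homeomorphism and $\mathcal S^{(0)}$ is locally compact, Hausdorff and zero-dimensional (has a basis of clopen sets). A bisection is a set of arrows on which $\mathbf s$ and $\mathbf r$ are injective; $\mathbf{KB}(\mathcal S)$ is the set of compact-open bisections, with the product $AB=\{ab: a\in A,\ b\in B,\ ab\text{ defined}\}$. Let $\mathbf{Amp}_\star$ be the category of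 ample inverse semigroupoids whose morphisms are the homomorphisms $\phi\colon\mathcal S\to\mathcal T$ (if $ab$ is defined, then so is $\phi(a)\phi(b)$, and it equals $\phi(ab)$) that are continuous, proper (preimages of compact sets are compact), star-injective ($\mathbf s(a)=\mathbf s(b)$ and $\phi(a)=\phi(b)$ imply $a=b$) and star-surjective (if $\mathbf s(t)=\mathbf s(\phi(a))$, there is $b$ with $\mathbf s(b)=\mathbf s(a)$ and $\phi(b)=t$). *$\Sigma$-ordered inverse semigroups.* In an inverse semigroup, $a\le b$ means $a=ba^*a$, and $E(S)$ is the set of idempotents. A $\Sigma$-ordered inverse semigroup is an inverse semigroup $S$ with zero together with a partial order $\subseteq$ (joins and meets for $\subseteq$ are written $\cup$, $\cap$) such that: $a\subseteq b$ implies $a\le b$, $ax\subseteq bx$ and $ya\subseteq yb$ for all $x,y\in S$; $0\subseteq a$ for all $a$; if $a_1,a_2\subseteq c$ then $a_1\cup a_2$ exists; if $c_1\cup c_2$ exists then $a(c_1\cup c_2)=ac_1\cup ac_2$ for all $a$; if $e\subseteq f$ in $E(S)$ there is $c\in E(S)$ with $e\cup c=f$ and $e\cap c=0$; if $a^*b=ab^*=0$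 then $a\cup b$ exists; and if $t\le a$ there is $z$ with $t\le z\subseteq a$ such that $tx=0\iff zx=0$ for all $x\in S$. For $t\le a$ the interpolator $a|t$ is the unique $p$ with $t\le p\subseteq a$, $tx=0\iff px=0$ and $xt=0\iff xp=0$ for all $x\in S$. Let $\Sigma\text{-}\mathbf{Ord}$ be the category of $\Sigma$-ordered inverse semigroups whose morphisms are the semigroup homomorphisms $\theta\colon S\to T$ such that: $\theta(0)=0$; $a\subseteq b$ implies $\theta(a)\subseteq\theta(b)$; if $a\cup b$ exists, then $\theta(a)\cup\theta(b)$ exists and equals $\theta(a\cup b)$; if $t\subseteq\theta(a),\theta(b)$, there is $c\subseteq a,b$ with $t\subseteq\theta(c)$; every $t\in T$ is a join $t=\bigcup_{i=1}^n t_i$ with $t_i\subseteq\theta(s_i)$ for some $s_i\in S$; and $\theta(b|a)=\theta(b)|\theta(a)$ whenever $a\le b$. *Germs.* For a $\Sigma$-ordered inverse semigroup $S$, let $\Omega(E(S))$ be the space of ultrafilters (maximal proper filters) of $(E(S),\le)$, with the topology generated by the sets $X[e]=\{\mathfrak F: e\in\mathfrak F\}$, $e\in E(S)$. For $a\in S$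 and $\mathfrak F\in X[a^*a]$ put $\widehat\mu_a(\mathfrak F)=\{u\in E(S): u\ge aea^*\text{ for some }e\in\mathfrak F\text{ with }e\le a^*a\}$ (the action on the spectrum dual to the Munn action). On $\{(a,\mathfrak F): a^*a\in\mathfrak F\}\subseteq S\times\Omega(E(S))$, $S$ being discrete, let $(a,\mathfrak F)\sim(b,\mathfrak F)$ if there is $z\subseteq a,b$ with $z^*z\in\mathfrak F$, and let $[a,\mathfrak F]$ be the class (germ) of $(a,\mathfrak F)$. **Claim.** The categories $\mathbf{Amp}_\star$ and $\Sigma\text{-}\mathbf{Ord}$ are dually equivalent: there is an equivalence $\mathbf{Amp}_\star^{\mathrm{op}}\simeq\Sigma\text{-}\mathbf{Ord}$ given (up to canonical isomorphism) by the following functors. * $\mathbb K\colon\mathbf{Amp}_\star^{\mathrm{op}}\to\Sigma\text{-}\mathbf{Ord}$, $\mathbb K(\mathcal S)=(\mathbf{KB}(\mathcal S),\subseteq)$ with the product of sets and set inclusion, and $\mathbb K(\phi)(A)=\phi^{-1}(A)$. * $\mathbb P\colon\Sigma\text{-}\mathbf{Ord}^{\mathrm{op}}\to\mathbf{Amp}_\star$,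 where $\mathbb P(S,\subseteq)$ has vertex space $\Omega(E(S))$ and as arrows the germs $[a,\mathfrak F]$, with the quotient topology, source $\mathfrak F$, range $\widehat\mu_a(\mathfrak F)$ and product $[a,\widehat\mu_b(\mathfrak F)]\,[b,\mathfrak F]=[ab,\mathfrak F]$. For a morphism $\theta\colon S\to T$, the homomorphism $\mathbb P(\theta)\colon\mathbb P(T)\to\mathbb P(S)$ sends $[t,\mathfrak F]$ to $[s,\mathfrak G]$, where $\mathfrak G=\{e\in E(S): ef\ne0\text{ for all }f\in E(S)\text{ with }\theta(f)\in\mathfrak F\}$ and $s\in S$ is any element with $[\theta(s),\mathfrak F]=[t,\mathfrak F]$ (such $s$ exists, and the result does not depend on its choice). -/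

import Mathlib

open CategoryTheory Opposite

universe u

/-! ### Inverse semigroupoids -/

/-- A graphed semigroupoid: a graph with a partial associative product `a b`, defined exactly when
the source of `a` is the range of `b`. Every vertex is the source or the range of some arrow. -/
structure GraphedSemigroupoid : Type (u + 1) where
  Vert : Type u
  Arr : Type u
  src : Arr → Vert
  rng : Arr → Vert
  mul : (a b : Arr) → src a = rng b → Arr
  src_mul : ∀ (a b : Arr) (h : src a = rng b), src (mul a b h) = src b
  rng_mul : ∀ (a b : Arr) (h : src a = rng b), rng (mul a b h) = rng a
  mul_assoc : ∀ (a b c : Arr) (h : src a = rng b) (k : src b = rng c),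
    mul (mul a b h) c ((src_mul a b h).trans k) = mul a (mul b c k) (h.trans (rng_mul b c k).symm)
  vert_eq : ∀ v : Vert, (∃ a, src a = v) ∨ (∃ a, rng a = v)

namespace GraphedSemigroupoid

/-- `b` is an inverse of `a`: `ab` and `ba` are defined, `aba = a` and `bab = b`. -/
def IsInverse (S : GraphedSemigroupoid.{u}) (a b : S.Arr) : Prop :=
  ∃ (h : S.src a = S.rng b) (k : S.src b = S.rng a),
    S.mul (S.mul a b h) a ((S.src_mul a b h).trans k) = a ∧
    S.mul (S.mul b a k) b ((S.src_mul b a k).trans h) = b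

/-- The product of two sets of arrows: all the products that are defined. -/
def setMul (S : GraphedSemigroupoid.{u}) (A B : Set S.Arr) : Set S.Arr :=
  {c | ∃ a ∈ A, ∃ b ∈ B, ∃ h : S.src a = S.rng b, S.mul a b h = c}

/-- A bisection: a set of arrows on which source and range are injective. -/
def IsBisection (S : GraphedSemigroupoid.{u}) (A : Set S.Arr) : Prop :=
  Set.InjOn S.src A ∧ Set.InjOn S.rng A

end GraphedSemigroupoid

/-- An inverse semigroupoid: every arrow has exactly one inverse. -/
structure InverseSemigroupoid : Type (u + 1) extends GraphedSemigroupoid.{u} where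
  existsUnique_inverse : ∀ a : Arr, ∃! b : Arr, toGraphedSemigroupoid.IsInverse a b

/-- The inverse `a*` of an arrow. -/
noncomputable def InverseSemigroupoid.star (S : InverseSemigroupoid.{u}) (a : S.Arr) : S.Arr :=
  (S.existsUnique_inverse a).choose

/-- A topological inverse semigroupoid: arrows and vertices carry topologies such that source,
range, product and inversion are continuous. -/
structure TopInverseSemigroupoid : Type (u + 1) extends InverseSemigroupoid.{u} where
  [topVert : TopologicalSpace Vert]
  [topArr : TopologicalSpace Arr]
  continuous_src : Continuous src
  continuous_rng : Continuous rng
  continuous_mul : Continuous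
    (fun p : {p : Arr × Arr // src p.1 = rng p.2} => mul p.1.1 p.1.2 p.2)
  continuous_star : Continuous toInverseSemigroupoid.star

attribute [instance] TopInverseSemigroupoid.topVert TopInverseSemigroupoid.topArr

/-- An ample inverse semigroupoid: étale (the source map is a local homeomorphism), with locally
compact, Hausdorff, zero-dimensional vertex space. These are the objects of `Amp_⋆`. -/
structure AmpStar : Type (u + 1) extends TopInverseSemigroupoid.{u} where
  etale : IsLocalHomeomorph src
  locallyCompact : LocallyCompactSpace Vert
  hausdorff : T2Space Vert
  zeroDimensional : TopologicalSpace.IsTopologicalBasis {U : Set Vert | IsClopen U}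

namespace AmpStar

/-- A morphism of `Amp_⋆`: a continuous, proper, star-injective and star-surjective
homomorphism. Arrow spaces may be non-Hausdorff; proper means that preimages of compact sets are
compact. -/
@[ext]
structure Hom (S T : AmpStar.{u}) where
  toFun : S.Arr → T.Arr
  composable : ∀ a b : S.Arr, S.src a = S.rng b → T.src (toFun a) = T.rng (toFun b)
  map_mul : ∀ (a b : S.Arr) (h : S.src a = S.rng b),
    toFun (S.mul a b h) = T.mul (toFun a) (toFun b) (composable a b h)
  continuous : Continuous toFun
  proper : ∀ C : Set T.Arr, IsCompact C → IsCompact (toFun ⁻¹' C)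
  starInjective : ∀ a b : S.Arr, S.src a = S.src b → toFun a = toFun b → a = b
  starSurjective : ∀ (t : T.Arr) (a : S.Arr), T.src t = T.src (toFun a) →
    ∃ b : S.Arr, S.src b = S.src a ∧ toFun b = t

/-- A homomorphism sends arrows with the same source to arrows with the same source. -/
theorem Hom.src_eq {S T : AmpStar.{u}} (f : Hom S T) {a b : S.Arr} (h : S.src a = S.src b) :
    T.src (f.toFun a) = T.src (f.toFun b) := by
  obtain ⟨z, ⟨hz, -⟩, -⟩ := S.existsUnique_inverse a
  exact (f.composable a z hz).trans (f.composable b z (h.symm.trans hz)).symm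

/-- The identity homomorphism. -/
def Hom.id (S : AmpStar.{u}) : Hom S S where
  toFun := fun a => a
  composable := fun _ _ h => h
  map_mul := fun _ _ _ => rfl
  continuous := continuous_id
  proper := fun _ h => h
  starInjective := fun _ _ _ h => h
  starSurjective := fun t _ h => ⟨t, h, rfl⟩

/-- The composition of two homomorphisms. -/
def Hom.comp {S T U : AmpStar.{u}} (f : Hom S T) (g : Hom T U) : Hom S U where
  toFun := fun a => g.toFun (f.toFun a)
  composable := fun a b h => g.composable _ _ (f.composable a b h)
  map_mul := fun a b h => by rw [f.map_mul, g.map_mul]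
  continuous := g.continuous.comp f.continuous
  proper := fun C hC => f.proper _ (g.proper C hC)
  starInjective := fun a b h e => f.starInjective a b h (g.starInjective _ _ (f.src_eq h) e)
  starSurjective := fun t a h => by
    obtain ⟨b, hb, rfl⟩ := g.starSurjective t (f.toFun a) h
    obtain ⟨c, hc, rfl⟩ := f.starSurjective b a hb
    exact ⟨c, hc, rfl⟩

instance : Category.{u} AmpStar.{u} where
  Hom := Hom
  id := Hom.id
  comp := Hom.comp

/-- The set `KB(S)` of compact-open bisections. -/
def KB (S : AmpStar.{u}) : Type u :=
  {A : Set S.Arr // IsCompact A ∧ IsOpen A ∧ S.IsBisection A}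

end AmpStar

/-! ### Inverse semigroups -/

/-- An inverse semigroup: every element has exactly one inverse. -/
class IsInverseSemigroup (S : Type u) [Semigroup S] : Prop where
  existsUnique_inverse : ∀ a : S, ∃! b : S, a * b * a = a ∧ b * a * b = b

namespace InvSemigroup

variable {S : Type u} [Semigroup S] [IsInverseSemigroup S]

/-- The inverse `a*`. -/
noncomputable def sinv (a : S) : S :=
  (IsInverseSemigroup.existsUnique_inverse a).choose

/-- The canonical order: `a ≤ b` if and only if `a = b a* a`. -/
def NatLE (a b : S) : Prop := a = b * sinv a * a

theorem mul_sinv_mul (a : S) : a * sinv a * a = a :=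
  (IsInverseSemigroup.existsUnique_inverse a).choose_spec.1.1

theorem sinv_mul_sinv (a : S) : sinv a * a * sinv a = sinv a :=
  (IsInverseSemigroup.existsUnique_inverse a).choose_spec.1.2

theorem eq_sinv {a b : S} (h : a * b * a = a) (k : b * a * b = b) : b = sinv a :=
  (IsInverseSemigroup.existsUnique_inverse a).choose_spec.2 b ⟨h, k⟩

/-- A product of idempotents is idempotent. -/
theorem mul_idem {e f : S} (he : e * e = e) (hf : f * f = f) : e * f * (e * f) = e * f := by
  have h1 := mul_sinv_mul (e * f)
  have h2 := sinv_mul_sinv (e * f)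
  generalize hx : sinv (e * f) = x at h1 h2
  simp only [← mul_assoc] at h1 h2
  have a1 : e * f * (f * x * e) * (e * f) = e * f := by
    simp only [← mul_assoc]
    rw [mul_assoc e f f, hf, mul_assoc (e * f * x) e e, he, h1]
  have a2 : f * x * e * (e * f) * (f * x * e) = f * x * e := by
    simp only [← mul_assoc]
    rw [mul_assoc (f * x) e e, he, mul_assoc (f * x * e) f f, hf]
    simpa only [← mul_assoc] using congrArg (fun y => f * y * e) h2
  have hfx : f * x * e = x := (eq_sinv a1 a2).trans hx
  have hxx : x * x = x := by
    have : f * x * e * (f * x * e) = f * x * e := by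
      simpa only [← mul_assoc] using congrArg (fun y => f * y * e) h2
    rwa [hfx] at this
  have e1 : e * f = sinv x := eq_sinv (by simpa only [← mul_assoc] using h2)
    (by simpa only [← mul_assoc] using h1)
  have e2 : x = sinv x := eq_sinv (by rw [hxx, hxx]) (by rw [hxx, hxx])
  rw [e1, ← e2, hxx]

/-- Idempotents commute. -/
theorem idem_comm {e f : S} (he : e * e = e) (hf : f * f = f) : e * f = f * e := by
  have h1 := mul_idem he hf
  have h2 := mul_idem hf he
  have a1 : e * f * (f * e) * (e * f) = e * f := by
    simp only [← mul_assoc] at h1 ⊢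
    rw [mul_assoc e f f, hf, mul_assoc (e * f) e e, he, h1]
  have a2 : f * e * (e * f) * (f * e) = f * e := by
    simp only [← mul_assoc] at h2 ⊢
    rw [mul_assoc f e e, he, mul_assoc (f * e) f f, hf, h2]
  have e1 : e * f = sinv (e * f) := eq_sinv (by rw [h1, h1]) (by rw [h1, h1])
  rw [eq_sinv a1 a2, ← e1]

/-- If `t ≤ u` then `t = (t t*) u`. -/
theorem NatLE.eq_left {t u : S} (h : NatLE t u) : t * sinv t * u = t := by
  have ht : sinv t * t * (sinv t * t) = sinv t * t := by
    rw [← mul_assoc, sinv_mul_sinv]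
  have hu : sinv u * u * (sinv u * u) = sinv u * u := by
    rw [← mul_assoc, sinv_mul_sinv]
  have hc := idem_comm hu ht
  have hs : sinv t * t * sinv u = sinv t := by
    have h' : u * (sinv t * t) = t := by rw [← mul_assoc]; exact h.symm
    apply eq_sinv
    · calc t * (sinv t * t * sinv u) * t
          = t * (sinv t * t) * sinv u * (u * (sinv t * t)) := by rw [h']; simp only [mul_assoc]
        _ = t * ((sinv t * t) * (sinv u * u) * (sinv t * t)) := by simp only [mul_assoc]
        _ = t * ((sinv u * u) * (sinv t * t) * (sinv t * t)) := by rw [hc]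
        _ = t * ((sinv u * u) * (sinv t * t)) := by rw [mul_assoc (sinv u * u), ht]
        _ = t * ((sinv t * t) * (sinv u * u)) := by rw [hc]
        _ = u * (sinv t * t) * ((sinv t * t) * (sinv u * u)) := by rw [h']
        _ = u * (((sinv t * t) * (sinv t * t)) * (sinv u * u)) := by simp only [mul_assoc]
        _ = u * ((sinv u * u) * (sinv t * t)) := by rw [ht, hc]
        _ = u * sinv u * u * (sinv t * t) := by simp only [mul_assoc]
        _ = t := by rw [mul_sinv_mul, h']
    · calc sinv t * t * sinv u * t * (sinv t * t * sinv u)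
          = sinv t * t * sinv u * (u * (sinv t * t)) * (sinv t * t * sinv u) := by rw [h']
        _ = (sinv t * t) * ((sinv u * u) * (sinv t * t)) * (sinv t * t) * sinv u := by
            simp only [mul_assoc]
        _ = (sinv t * t) * (sinv u * u) * sinv u := by
            rw [hc, ← mul_assoc (sinv t * t) (sinv t * t), ht,
              mul_assoc (sinv t * t) (sinv u * u) (sinv t * t), hc,
              ← mul_assoc (sinv t * t) (sinv t * t), ht]
        _ = (sinv t * t) * (sinv u * u * sinv u) := by simp only [mul_assoc]
        _ = sinv t * t * sinv u := by rw [sinv_mul_sinv]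
  calc t * sinv t * u = t * (sinv t * t * sinv u) * u := by rw [hs]
    _ = t * ((sinv t * t) * (sinv u * u)) := by simp only [mul_assoc]
    _ = t * ((sinv u * u) * (sinv t * t)) := by rw [hc]
    _ = u * (sinv t * t) * ((sinv u * u) * (sinv t * t)) := by
        rw [← mul_assoc u, ← h]
    _ = u * ((sinv t * t) * ((sinv u * u) * (sinv t * t))) := by simp only [mul_assoc]
    _ = u * ((sinv u * u) * (sinv t * t)) := by rw [hc, ← mul_assoc (sinv t * t), ht]
    _ = u * sinv u * u * sinv t * t := by simp only [mul_assoc]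
    _ = t := by rw [mul_sinv_mul, ← h]

end InvSemigroup

open InvSemigroup

/-! ### Σ-ordered inverse semigroups -/

/-- `c` is the supremum of the set `F` for the relation `r`. -/
def IsSupOf {S : Type u} (r : S → S → Prop) (F : Set S) (c : S) : Prop :=
  (∀ x ∈ F, r x c) ∧ ∀ d, (∀ x ∈ F, r x d) → r c d

/-- `c` is the infimum of the set `F` for the relation `r`. -/
def IsInfOf {S : Type u} (r : S → S → Prop) (F : Set S) (c : S) : Prop :=
  (∀ x ∈ F, r c x) ∧ ∀ d, (∀ x ∈ F, r d x) → r d c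

/-- A Σ-ordered inverse semigroup; the order `⊆` is `sub`. These are the objects of `Σ-Ord`.
In `relCompl` the join and the meet may be taken in `S` or in the idempotents: all elements below
an idempotent are idempotent. -/
structure SigmaOrd : Type (u + 1) where
  Carrier : Type u
  [semigroupWithZero : SemigroupWithZero Carrier]
  [isInverse : IsInverseSemigroup Carrier]
  sub : Carrier → Carrier → Prop
  sub_refl : ∀ a, sub a a
  sub_trans : ∀ a b c, sub a b → sub b c → sub a c
  sub_antisymm : ∀ a b, sub a b → sub b a → a = b
  natLE_of_sub : ∀ a b, sub a b → NatLE a b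
  mul_right_sub : ∀ a b x, sub a b → sub (a * x) (b * x)
  mul_left_sub : ∀ a b y, sub a b → sub (y * a) (y * b)
  zero_sub : ∀ a, sub 0 a
  condJoin : ∀ a₁ a₂ c, sub a₁ c → sub a₂ c → ∃ j, IsSupOf sub {a₁, a₂} j
  distrib : ∀ a c₁ c₂ c, IsSupOf sub {c₁, c₂} c → IsSupOf sub {a * c₁, a * c₂} (a * c)
  relCompl : ∀ e f, e * e = e → f * f = f → sub e f →
    ∃ c, c * c = c ∧ IsSupOf sub {e, c} f ∧ IsInfOf sub {e, c} 0
  orthJoin : ∀ a b, sinv a * b = 0 → a * sinv b = 0 → ∃ j, IsSupOf sub {a, b} j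
  interpolation : ∀ t a, NatLE t a →
    ∃ z, NatLE t z ∧ sub z a ∧ ∀ x, t * x = 0 ↔ z * x = 0

attribute [instance] SigmaOrd.semigroupWithZero SigmaOrd.isInverse

namespace SigmaOrd

/-- `p` is the interpolator `a|t` of `t ≤ a`: the (unique) element with these properties. -/
def IsInterpolator (S : SigmaOrd.{u}) (t a p : S.Carrier) : Prop :=
  NatLE t p ∧ S.sub p a ∧ (∀ x, t * x = 0 ↔ p * x = 0) ∧ (∀ x, x * t = 0 ↔ x * p = 0)

/-- A morphism of Σ-ordered inverse semigroups. -/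
@[ext]
structure Hom (S T : SigmaOrd.{u}) where
  toFun : S.Carrier → T.Carrier
  map_mul : ∀ a b, toFun (a * b) = toFun a * toFun b
  map_zero : toFun 0 = 0
  mono : ∀ a b, S.sub a b → T.sub (toFun a) (toFun b)
  map_join : ∀ a b c, IsSupOf S.sub {a, b} c → IsSupOf T.sub {toFun a, toFun b} (toFun c)
  weakMeet : ∀ a b t, T.sub t (toFun a) → T.sub t (toFun b) →
    ∃ c, S.sub c a ∧ S.sub c b ∧ T.sub t (toFun c)
  proper : ∀ t, ∃ F : Set T.Carrier, F.Finite ∧ IsSupOf T.sub F t ∧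
    ∀ x ∈ F, ∃ s, T.sub x (toFun s)
  map_interpolator : ∀ a b p, NatLE a b → S.IsInterpolator a b p →
    T.IsInterpolator (toFun a) (toFun b) (toFun p)

theorem sup_unique (S : SigmaOrd.{u}) {F : Set S.Carrier} {a b : S.Carrier}
    (ha : IsSupOf S.sub F a) (hb : IsSupOf S.sub F b) : a = b :=
  S.sub_antisymm a b (ha.2 b hb.1) (hb.2 a ha.1)

/-- A map that preserves `0` and binary joins preserves finite joins. -/
theorem map_finite_sup {S T : SigmaOrd.{u}} (g : S.Carrier → T.Carrier)
    (h0 : ∀ d, T.sub (g 0) d)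
    (hj : ∀ a b c, IsSupOf S.sub {a, b} c → IsSupOf T.sub {g a, g b} (g c))
    {F : Set S.Carrier} (hF : F.Finite) {c : S.Carrier} (hc : IsSupOf S.sub F c) :
    IsSupOf T.sub (g '' F) (g c) := by
  suffices H : ∀ u : S.Carrier, (∀ x ∈ F, S.sub x u) →
      ∃ j, IsSupOf S.sub F j ∧ S.sub j u ∧ IsSupOf T.sub (g '' F) (g j) by
    obtain ⟨j, hj1, -, hj2⟩ := H c hc.1
    rwa [S.sup_unique hc hj1]
  clear hc
  induction F, hF using Set.Finite.induction_on with
  | empty =>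
    intro u _
    exact ⟨0, ⟨by simp, fun d _ => S.zero_sub d⟩, S.zero_sub u, by simp, fun d _ => h0 d⟩
  | @insert a F _ _ ih =>
    intro u hu
    obtain ⟨j, hj1, hj2, hj3⟩ := ih u (fun x hx => hu x (Set.mem_insert_of_mem _ hx))
    obtain ⟨k, hk⟩ := S.condJoin a j u (hu a (Set.mem_insert _ _)) hj2
    have hgk := hj a j k hk
    refine ⟨k, ⟨?_, ?_⟩, ?_, ?_, ?_⟩
    · rintro x (rfl | hx)
      · exact hk.1 _ (by simp)
      · exact S.sub_trans _ _ _ (hj1.1 x hx) (hk.1 _ (by simp))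
    · intro d hd
      refine hk.2 d ?_
      rintro x (rfl | rfl)
      · exact hd _ (Set.mem_insert _ _)
      · exact hj1.2 d (fun x hx => hd x (Set.mem_insert_of_mem _ hx))
    · refine hk.2 u ?_
      rintro x (rfl | rfl)
      · exact hu _ (Set.mem_insert _ _)
      · exact hj2
    · rintro _ ⟨x, rfl | hx, rfl⟩
      · exact hgk.1 _ (by simp)
      · exact T.sub_trans _ _ _ (hj3.1 _ ⟨x, hx, rfl⟩) (hgk.1 _ (by simp))
    · intro d hd
      refine hgk.2 d ?_
      rintro x (rfl | rfl)
      · exact hd _ ⟨a, Set.mem_insert _ _, rfl⟩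
      · refine hj3.2 d ?_
        rintro _ ⟨x, hx, rfl⟩
        exact hd _ ⟨x, Set.mem_insert_of_mem _ hx, rfl⟩

/-- The identity morphism. -/
def Hom.id (S : SigmaOrd.{u}) : Hom S S where
  toFun := fun a => a
  map_mul := fun _ _ => rfl
  map_zero := rfl
  mono := fun _ _ h => h
  map_join := fun _ _ _ h => h
  weakMeet := fun _ _ t h k => ⟨t, h, k, S.sub_refl t⟩
  proper := fun t => ⟨{t}, Set.finite_singleton t,
    ⟨by rintro _ rfl; exact S.sub_refl _, fun _ hd => hd t rfl⟩,
    fun x _ => ⟨x, S.sub_refl x⟩⟩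
  map_interpolator := fun _ _ _ _ h => h

theorem Hom.map_sinv {S T : SigmaOrd.{u}} (f : Hom S T) (a : S.Carrier) :
    f.toFun (sinv a) = sinv (f.toFun a) :=
  eq_sinv (by rw [← f.map_mul, ← f.map_mul, mul_sinv_mul])
    (by rw [← f.map_mul, ← f.map_mul, sinv_mul_sinv])

theorem Hom.map_natLE {S T : SigmaOrd.{u}} (f : Hom S T) {a b : S.Carrier} (h : NatLE a b) :
    NatLE (f.toFun a) (f.toFun b) := by
  unfold NatLE at h ⊢
  rw [← f.map_sinv, ← f.map_mul, ← f.map_mul, ← h]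

/-- The composition of two morphisms. -/
def Hom.comp {S T U : SigmaOrd.{u}} (f : Hom S T) (g : Hom T U) : Hom S U where
  toFun := fun a => g.toFun (f.toFun a)
  map_mul := fun a b => by rw [f.map_mul, g.map_mul]
  map_zero := by rw [f.map_zero, g.map_zero]
  mono := fun a b h => g.mono _ _ (f.mono a b h)
  map_join := fun a b c h => g.map_join _ _ _ (f.map_join a b c h)
  weakMeet := fun a b t h k => by
    obtain ⟨c, hc1, hc2, hc3⟩ := g.weakMeet _ _ t h k
    obtain ⟨d, hd1, hd2, hd3⟩ := f.weakMeet a b c hc1 hc2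
    exact ⟨d, hd1, hd2, U.sub_trans _ _ _ hc3 (g.mono _ _ hd3)⟩
  proper := fun t => by
    obtain ⟨F, hF, hFt, hFs⟩ := g.proper t
    have key : ∀ x ∈ F, ∃ G : Set U.Carrier, G.Finite ∧ IsSupOf U.sub G x ∧
        ∀ y ∈ G, ∃ s, U.sub y (g.toFun (f.toFun s)) := by
      intro x hx
      obtain ⟨b, hb⟩ := hFs x hx
      obtain ⟨H, hH, hHb, hHs⟩ := f.proper b
      have hxb := (U.natLE_of_sub _ _ hb).eq_left
      have hsup := map_finite_sup (S := T) (T := U) (fun y => x * sinv x * g.toFun y)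
        (fun d => by
          rw [g.map_zero, mul_zero]
          exact U.zero_sub d)
        (fun a c d h => U.distrib _ _ _ _ (g.map_join a c d h)) hH hHb
      refine ⟨_, hH.image _, by simpa only [hxb] using hsup, ?_⟩
      rintro _ ⟨y, hy, rfl⟩
      obtain ⟨s, hs⟩ := hHs y hy
      refine ⟨s, U.sub_trans _ _ _ ?_ (g.mono _ _ hs)⟩
      have hys := g.mono _ _ (hHb.1 y hy)
      have hsub : U.sub (x * sinv x * g.toFun y) x := by
        have := U.mul_left_sub _ _ (x * sinv x) hys
        rwa [hxb] at this
      -- an element `sub` a common upper bound and canonically below is `sub`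
      have h1 : U.sub (x * sinv x * g.toFun y) (g.toFun b) := U.sub_trans _ _ _ hsub hb
      have h2 := U.mul_right_sub _ _ (sinv (g.toFun y) * g.toFun y) h1
      have e1 : x * sinv x * g.toFun y * (sinv (g.toFun y) * g.toFun y)
          = x * sinv x * g.toFun y := by
        rw [mul_assoc (x * sinv x), ← mul_assoc (g.toFun y), mul_sinv_mul]
      have e2 : g.toFun b * (sinv (g.toFun y) * g.toFun y) = g.toFun y := by
        rw [← mul_assoc]
        exact (U.natLE_of_sub _ _ hys).symm
      rwa [e1, e2] at h2
    choose! G hG1 hG2 hG3 using key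
    refine ⟨⋃ x ∈ F, G x, hF.biUnion hG1, ⟨?_, ?_⟩, ?_⟩
    · intro y hy
      simp only [Set.mem_iUnion] at hy
      obtain ⟨x, hx, hy⟩ := hy
      exact U.sub_trans _ _ _ ((hG2 x hx).1 y hy) (hFt.1 x hx)
    · intro d hd
      refine hFt.2 d (fun x hx => (hG2 x hx).2 d (fun y hy => hd y ?_))
      simp only [Set.mem_iUnion]
      exact ⟨x, hx, hy⟩
    · intro y hy
      simp only [Set.mem_iUnion] at hy
      obtain ⟨x, hx, hy⟩ := hy
      exact hG3 x hx y hy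
  map_interpolator := fun a b p h k =>
    g.map_interpolator _ _ _ (f.map_natLE h) (f.map_interpolator a b p h k)

instance : Category.{u} SigmaOrd.{u} where
  Hom := Hom
  id := Hom.id
  comp := Hom.comp

/-! ### The spectrum and the germs of the Munn action -/

/-- The idempotents `E(S)`. -/
def idem (S : SigmaOrd.{u}) : Set S.Carrier := {e | e * e = e}

/-- Proper filters of the semilattice `E(S)`, with its canonical order. -/
structure IsProperFilter (S : SigmaOrd.{u}) (F : Set S.Carrier) : Prop where
  subset : F ⊆ S.idem
  nonempty : F.Nonempty
  mul_mem : ∀ e ∈ F, ∀ f ∈ F, e * f ∈ F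
  up_mem : ∀ e ∈ F, ∀ f ∈ S.idem, NatLE e f → f ∈ F
  ne_idem : F ≠ S.idem

/-- The spectrum `Ω(E(S))`: the ultrafilters, i.e. the maximal proper filters, of `E(S)`. -/
@[ext]
structure Spectrum (S : SigmaOrd.{u}) : Type u where
  carrier : Set S.Carrier
  isProperFilter : S.IsProperFilter carrier
  maximal : ∀ G : Set S.Carrier, S.IsProperFilter G → carrier ⊆ G → G = carrier

/-- The topology generated by the sets `X[e]` of the ultrafilters that contain `e`. -/
instance (S : SigmaOrd.{u}) : TopologicalSpace S.Spectrum :=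
  TopologicalSpace.generateFrom
    {X | ∃ e ∈ S.idem, X = {F : S.Spectrum | e ∈ F.carrier}}

/-- The dual Munn action of `a` on an ultrafilter `F` that contains `a* a`:
the upward closure in `E(S)` of all `a e a*` with `e ∈ F`, `e ≤ a* a`. -/
def munnHat (S : SigmaOrd.{u}) (a : S.Carrier) (F : Set S.Carrier) : Set S.Carrier :=
  {v | v ∈ S.idem ∧ ∃ e ∈ F, NatLE e (sinv a * a) ∧ NatLE (a * e * sinv a) v}

/-- The arrows `(a, F)` of the semidirect product of `S` and `Ω(E(S))` for the dual Munn action,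
whose domain at `a` is `X[a* a]`. -/
structure Semidirect (S : SigmaOrd.{u}) : Type u where
  elt : S.Carrier
  pt : S.Spectrum
  mem : sinv elt * elt ∈ pt.carrier

/-- The topology of the semidirect product: that of a subspace of `S × Ω(E(S))`, `S` discrete. -/
instance (S : SigmaOrd.{u}) : TopologicalSpace S.Semidirect :=
  TopologicalSpace.induced Semidirect.elt ⊥ ⊓ TopologicalSpace.induced Semidirect.pt inferInstance

/-- The order of the semidirect product that `⊆` induces. -/
def Semidirect.sub {S : SigmaOrd.{u}} (p q : S.Semidirect) : Prop :=
  p.pt = q.pt ∧ S.sub p.elt q.elt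

/-- The germ relation: having a common lower bound. It is an equivalence relation. -/
def germRel (S : SigmaOrd.{u}) (p q : S.Semidirect) : Prop :=
  ∃ z : S.Semidirect, z.sub p ∧ z.sub q

/-- The germs `[a, F]`, with the quotient topology. -/
def Germ (S : SigmaOrd.{u}) : Type u := Quot S.germRel

instance (S : SigmaOrd.{u}) : TopologicalSpace S.Germ :=
  TopologicalSpace.coinduced (Quot.mk S.germRel) inferInstance

/-- The germ `[a, F]`. -/
def Semidirect.germ {S : SigmaOrd.{u}} (p : S.Semidirect) : S.Germ := Quot.mk S.germRel p

/-- The map of spectra of a morphism `θ : S → T`: the set of all idempotents `e` of `S` with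
`e f ≠ 0` for all idempotents `f` of `S` with `θ f ∈ F`. -/
def specMap {S T : SigmaOrd.{u}} (θ : S ⟶ T) (F : Set T.Carrier) : Set S.Carrier :=
  {e | e ∈ S.idem ∧ ∀ f ∈ S.idem, Hom.toFun θ f ∈ F → e * f ≠ 0}

/-- `p = (s, G)` represents the image of the germ of `q = (t, F)` under the map induced by
`θ : S → T`: `G` is the image of `F` under the map of spectra and `[θ s, F] = [t, F]`. -/
def Represents {S T : SigmaOrd.{u}} (θ : S ⟶ T) (q : T.Semidirect) (p : S.Semidirect) : Prop :=
  p.pt.carrier = specMap θ q.pt.carrier ∧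
  ∃ q' : T.Semidirect, q'.elt = Hom.toFun θ p.elt ∧ q'.pt = q.pt ∧ q'.germ = q.germ

end SigmaOrd

/-! ### The two functors -/

/-- `K` is the functor of compact-open bisections: up to the bijections `κ`, the Σ-ordered inverse
semigroup `K(S)` is `KB(S)` with the product of sets and with inclusion, and `K` sends `φ` to
`A ↦ φ⁻¹(A)`. -/
def IsBisectionFunctor (K : AmpStar.{u}ᵒᵖ ⥤ SigmaOrd.{u}) : Prop :=
  ∃ κ : ∀ S : AmpStar.{u}, (K.obj (op S)).Carrier ≃ S.KB,
    (∀ (S : AmpStar.{u}) (x y : (K.obj (op S)).Carrier),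
      (κ S (x * y)).1 = S.setMul (κ S x).1 (κ S y).1) ∧
    (∀ (S : AmpStar.{u}) (x y : (K.obj (op S)).Carrier),
      (K.obj (op S)).sub x y ↔ (κ S x).1 ⊆ (κ S y).1) ∧
    (∀ (S T : AmpStar.{u}) (φ : S ⟶ T) (x : (K.obj (op T)).Carrier),
      (κ S (SigmaOrd.Hom.toFun (K.map φ.op) x)).1 = AmpStar.Hom.toFun φ ⁻¹' (κ T x).1)

/-- `P` is the functor of germs of the Munn action on the spectrum: up to homeomorphisms, the
vertices of `P(S)` are the points of `Ω(E(S))` and its arrows are the germs `[a, F]`, with source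
`F`, range the image of `F` under `a`, and product `[a, G][b, F] = [ab, F]` (when `G` is the image
of `F` under `b`). For `θ : S → T`, the homomorphism `P(θ) : P(T) → P(S)` sends `[t, F]` to
`[s, G]`, for any `s` with `[θ s, F] = [t, F]`, and `G` the image of `F` under the map of spectra. -/
def IsGermFunctor (P : SigmaOrd.{u}ᵒᵖ ⥤ AmpStar.{u}) : Prop :=
  ∃ (γ₀ : ∀ S : SigmaOrd.{u}, (P.obj (op S)).Vert ≃ₜ S.Spectrum)
    (γ : ∀ S : SigmaOrd.{u}, (P.obj (op S)).Arr ≃ₜ S.Germ),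
    (∀ (S : SigmaOrd.{u}) (p : S.Semidirect),
      γ₀ S ((P.obj (op S)).src ((γ S).symm p.germ)) = p.pt) ∧
    (∀ (S : SigmaOrd.{u}) (p : S.Semidirect),
      (γ₀ S ((P.obj (op S)).rng ((γ S).symm p.germ))).carrier =
        S.munnHat p.elt p.pt.carrier) ∧
    (∀ (S : SigmaOrd.{u}) (p q : S.Semidirect)
      (h : (P.obj (op S)).src ((γ S).symm p.germ) = (P.obj (op S)).rng ((γ S).symm q.germ)),
      ∃ r : S.Semidirect, r.elt = p.elt * q.elt ∧ r.pt = q.pt ∧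
        γ S ((P.obj (op S)).mul _ _ h) = r.germ) ∧
    (∀ (S T : SigmaOrd.{u}) (θ : S ⟶ T) (q : T.Semidirect),
      (∃ p : S.Semidirect, SigmaOrd.Represents θ q p) ∧
      ∀ p : S.Semidirect, SigmaOrd.Represents θ q p →
        γ S (AmpStar.Hom.toFun (P.map θ.op) ((γ T).symm q.germ)) = p.germ)

/-!
Everything is deduced from the contravariant functor `S ↦ KB(S)` of compact-open bisections.

It is fully faithful. An arrow is determined by the compact-open bisections containing it, so if
`θ : KB(T) → KB(S)` is `A ↦ φ⁻¹(A)`, then `φ(x)` is the arrow lying in exactly those `A` with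
`x ∈ θ(A)`. For an arbitrary morphism `θ` such an arrow exists: the family of these `A` is nonempty
because `θ` is proper, directed because `θ` preserves meets weakly, and prime because `θ` preserves
joins, and the bisections in it are compact. Star-surjectivity of `φ` is where interpolators enter.
If `t ∈ B` has the source of `φ(x)` and `x ∈ θ(A)`, then the interpolator of `AB*B ≤ A` is the part
of `A` with the source of `AB*B`, hence contains `φ(x)`; as `θ` preserves it, `θ(B)` contains an
arrow with the source of `x`, and `φ` maps that arrow to `t`.

It is essentially surjective. The germs `[a, 𝔉]` of an element `a` form a bisection of the
semigroupoid of germs, compact because `X[a*a]` is; ultrafilters being prime, joins correspond to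
unions. A compact-open bisection is a finite union of such sets, and these can be made disjoint by
relative complements, whereupon the elements are orthogonal and have a join.

The germ functor is the resulting quasi-inverse of `KB`: by duality, the preimage under `ℙ(θ)` of
the germs of `s` is the set of germs of `θ(s)`.
-/

/-! ### Suprema and infima of a relation -/

theorem isSupOf_pair {α : Type u} {r : α → α → Prop} {a b c : α} :
    IsSupOf r {a, b} c ↔ r a c ∧ r b c ∧ ∀ d, r a d → r b d → r c d := by
  simp only [IsSupOf, Set.forall_mem_insert, Set.mem_singleton_iff, forall_eq, and_assoc, and_imp]

theorem isInfOf_pair {α : Type u} {r : α → α → Prop} {a b c : α} :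
    IsInfOf r {a, b} c ↔ r c a ∧ r c b ∧ ∀ d, r d a → r d b → r d c := by
  simp only [IsInfOf, Set.forall_mem_insert, Set.mem_singleton_iff, forall_eq, and_assoc, and_imp]

theorem IsSupOf.insert {α : Type u} {r : α → α → Prop} [IsTrans α r] {F : Set α} {a b c : α}
    (hF : IsSupOf r F b) (hab : IsSupOf r {a, b} c) : IsSupOf r (insert a F) c := by
  obtain ⟨hac, hbc, hc⟩ := isSupOf_pair.1 hab
  refine ⟨Set.forall_mem_insert.2 ⟨hac, fun x hx => _root_.trans (hF.1 x hx) hbc⟩, fun d hd => ?_⟩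
  rw [Set.forall_mem_insert] at hd
  exact hc d hd.1 (hF.2 d hd.2)

theorem isSupOf_image_relIso {α β : Type u} {r : α → α → Prop} {s : β → β → Prop} (e : r ≃r s)
    {F : Set α} {c : α} : IsSupOf s (e '' F) (e c) ↔ IsSupOf r F c := by
  simp only [IsSupOf, Set.forall_mem_image, e.map_rel_iff]
  refine and_congr_right fun _ => e.surjective.forall.trans ?_
  simp only [e.map_rel_iff]

/-! ### Inverse semigroups -/

namespace InvSemigroup

section Semigroup

variable {S : Type u} [Semigroup S]

theorem inverse_unique_of_idem_comm (hc : ∀ e f : S, e * e = e → f * f = f → e * f = f * e)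
    {a b c : S} (hb : a * b * a = a) (hb' : b * a * b = b) (hc₁ : a * c * a = a)
    (hc₂ : c * a * c = c) : b = c := by
  have hba : b * a * (b * a) = b * a := by rw [← mul_assoc, hb']
  have hca : c * a * (c * a) = c * a := by rw [← mul_assoc, hc₂]
  have hab : a * b * (a * b) = a * b := by rw [← mul_assoc, hb]
  have hac : a * c * (a * c) = a * c := by rw [← mul_assoc, hc₁]
  calc b = b * a * b := hb'.symm
    _ = b * (a * c * a) * b := by rw [hc₁]
    _ = b * a * (c * a) * b := by simp only [mul_assoc]
    _ = c * a * (b * a) * b := by rw [hc _ _ hba hca]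
    _ = c * (a * b * (a * b)) := by simp only [mul_assoc]
    _ = c * (a * b) := by rw [hab]
    _ = c * a * c * (a * b) := by rw [hc₂]
    _ = c * (a * c * (a * b)) := by simp only [mul_assoc]
    _ = c * (a * b * (a * c)) := by rw [hc _ _ hac hab]
    _ = c * (a * b * a) * c := by simp only [mul_assoc]
    _ = c := by rw [hb, hc₂]

theorem isInverseSemigroup_of_idem_comm (hr : ∀ a : S, ∃ b, a * b * a = a ∧ b * a * b = b)
    (hc : ∀ e f : S, e * e = e → f * f = f → e * f = f * e) : IsInverseSemigroup S where
  existsUnique_inverse a := (hr a).imp fun _ hb =>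
    ⟨hb, fun _ hc' => inverse_unique_of_idem_comm hc hc'.1 hc'.2 hb.1 hb.2⟩

end Semigroup

variable {S : Type u} [Semigroup S] [IsInverseSemigroup S]

theorem mul_sinv_mul' (a : S) : a * (sinv a * a) = a := by
  rw [← mul_assoc, mul_sinv_mul]

theorem sinv_mul_sinv' (a : S) : sinv a * (a * sinv a) = sinv a := by
  rw [← mul_assoc, sinv_mul_sinv]

theorem sinv_sinv (a : S) : sinv (sinv a) = a :=
  (eq_sinv (sinv_mul_sinv a) (mul_sinv_mul a)).symm

theorem sinv_mul_idem (a : S) : sinv a * a * (sinv a * a) = sinv a * a := by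
  rw [← mul_assoc, sinv_mul_sinv]

theorem mul_sinv_idem (a : S) : a * sinv a * (a * sinv a) = a * sinv a := by
  rw [← mul_assoc, mul_sinv_mul]

theorem sinv_of_idem {e : S} (he : e * e = e) : sinv e = e :=
  (eq_sinv (by rw [he, he]) (by rw [he, he])).symm

theorem sinv_mul_of_idem {e : S} (he : e * e = e) : sinv e * e = e := by
  rw [sinv_of_idem he, he]

theorem sinv_mul (a b : S) : sinv (a * b) = sinv b * sinv a := by
  have hc := idem_comm (mul_sinv_idem b) (sinv_mul_idem a)
  refine (eq_sinv ?_ ?_).symm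
  · calc a * b * (sinv b * sinv a) * (a * b)
        = a * (b * sinv b * (sinv a * a)) * b := by simp only [mul_assoc]
      _ = a * sinv a * a * (b * sinv b * b) := by rw [hc]; simp only [mul_assoc]
      _ = a * b := by rw [mul_sinv_mul, mul_sinv_mul]
  · calc sinv b * sinv a * (a * b) * (sinv b * sinv a)
        = sinv b * (sinv a * a * (b * sinv b)) * sinv a := by simp only [mul_assoc]
      _ = sinv b * b * sinv b * (sinv a * a * sinv a) := by rw [← hc]; simp only [mul_assoc]
      _ = sinv b * sinv a := by rw [sinv_mul_sinv, sinv_mul_sinv]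

theorem conj_idem {g : S} (a : S) (hg : g * g = g) :
    sinv a * g * a * (sinv a * g * a) = sinv a * g * a := by
  calc sinv a * g * a * (sinv a * g * a) = sinv a * (g * (a * sinv a * g)) * a := by
        simp only [mul_assoc]
    _ = sinv a * (g * g) * (a * sinv a * a) := by
        rw [idem_comm (mul_sinv_idem a) hg]; simp only [mul_assoc]
    _ = sinv a * g * a := by rw [mul_sinv_mul, hg]

theorem conj_mul {g : S} (a h : S) (hg : g * g = g) :
    sinv a * g * a * (sinv a * h * a) = sinv a * (g * h) * a := by
  calc sinv a * g * a * (sinv a * h * a) = sinv a * (g * (a * sinv a)) * h * a := by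
        simp only [mul_assoc]
    _ = sinv a * a * sinv a * (g * h) * a := by
        rw [← idem_comm (mul_sinv_idem a) hg]; simp only [mul_assoc]
    _ = sinv a * (g * h) * a := by rw [sinv_mul_sinv]

theorem NatLE.eq_right {a b : S} (h : NatLE a b) : b * (sinv a * a) = a := by
  rw [← mul_assoc]; exact h.symm

theorem NatLE.sinv_eq {a b : S} (h : NatLE a b) : sinv a * a * sinv b = sinv a := by
  conv_rhs => rw [← h.eq_right, sinv_mul, sinv_of_idem (sinv_mul_idem a)]

theorem NatLE.mul_conj {t p e : S} (h : NatLE t p) (he : e * e = e) :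
    t * (sinv p * e * p) = e * t := by
  calc t * (sinv p * e * p) = t * sinv t * (p * sinv p * e) * p := by
        conv_lhs => rw [← h.eq_left]
        simp only [mul_assoc]
    _ = t * sinv t * e * (p * sinv p * p) := by
        rw [idem_comm (mul_sinv_idem p) he]; simp only [mul_assoc]
    _ = e * (t * sinv t * p) := by
        rw [InvSemigroup.mul_sinv_mul, idem_comm (mul_sinv_idem t) he, mul_assoc]
    _ = e * t := by rw [h.eq_left]

theorem mul_idem_sinv_mul (b : S) {e : S} (he : e * e = e) :
    sinv (b * e) * (b * e) = sinv b * b * e := by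
  rw [sinv_mul, sinv_of_idem he]
  calc e * sinv b * (b * e) = e * (sinv b * b * e) := by simp only [mul_assoc]
    _ = sinv b * b * e := by rw [idem_comm (sinv_mul_idem b) he, ← mul_assoc, he]

theorem natLE_refl (a : S) : NatLE a a := (mul_sinv_mul a).symm

theorem natLE_mul_idem (b : S) {e : S} (he : e * e = e) : NatLE (b * e) b := by
  unfold NatLE
  rw [mul_assoc, mul_idem_sinv_mul b he, ← mul_assoc, mul_sinv_mul']

theorem natLE_iff_of_idem {e f : S} (he : e * e = e) : NatLE e f ↔ f * e = e := by
  unfold NatLE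
  rw [mul_assoc, sinv_mul_of_idem he, eq_comm]

theorem idem_of_natLE {z e : S} (he : e * e = e) (h : NatLE z e) : z * z = z := by
  rw [← h.eq_right]
  exact mul_idem he (sinv_mul_idem z)

theorem NatLE.conj {z a : S} (h : NatLE z a) (g : S) :
    sinv z * g * z = sinv z * z * (sinv a * g * a) * (sinv z * z) := by
  calc sinv z * g * z = sinv z * z * sinv a * g * (a * (sinv z * z)) := by
        rw [h.sinv_eq, h.eq_right]
    _ = sinv z * z * (sinv a * g * a) * (sinv z * z) := by simp only [mul_assoc]

theorem NatLE.sinv_mul_self_mul {z a : S} (h : NatLE z a) :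
    sinv a * a * (sinv z * z) = sinv z * z := by
  calc sinv a * a * (sinv z * z) = sinv z * z * sinv a * a := by
        rw [idem_comm (sinv_mul_idem a) (sinv_mul_idem z)]; simp only [mul_assoc]
    _ = sinv z * (z * sinv z * a) := by rw [h.sinv_eq, ← mul_assoc, sinv_mul_sinv']
    _ = sinv z * z := by rw [h.eq_left]

theorem NatLE.sinv_mul_eq {z a : S} (h : NatLE z a) : sinv a * z = sinv z * z := by
  conv_lhs => rw [← h.eq_right]
  rw [← mul_assoc, h.sinv_mul_self_mul]

theorem idem_of_natLE_sq {z a : S} (h : NatLE z a) (h' : NatLE z (a * a)) : z * z = z := by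
  have haz : a * z = z := by
    conv_lhs => rw [← h.eq_right]
    rw [← mul_assoc, h'.eq_right]
  calc z * z = z * sinv z * (a * z) := by rw [← mul_assoc, h.eq_left]
    _ = z := by rw [haz, mul_sinv_mul]

theorem map_sinv {T : Type u} [Semigroup T] [IsInverseSemigroup T] (f : S →ₙ* T) (a : S) :
    f (sinv a) = sinv (f a) :=
  eq_sinv (by rw [← map_mul, ← map_mul, mul_sinv_mul])
    (by rw [← map_mul, ← map_mul, sinv_mul_sinv])

theorem NatLE.map {T : Type u} [Semigroup T] [IsInverseSemigroup T] (f : S →ₙ* T) {a b : S}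
    (h : NatLE a b) : NatLE (f a) (f b) := by
  rw [NatLE, ← map_sinv, ← map_mul, ← map_mul, ← h]

section Zero

variable {S : Type u} [SemigroupWithZero S] [IsInverseSemigroup S]

theorem sinv_mul_mul_eq_zero {a b : S} : sinv a * a * b = 0 ↔ a * b = 0 := by
  refine ⟨fun h => ?_, fun h => by rw [mul_assoc, h, mul_zero]⟩
  rw [← mul_sinv_mul' a, mul_assoc, h, mul_zero]

theorem sinv_mul_self_eq_zero {a : S} : sinv a * a = 0 ↔ a = 0 := by
  refine ⟨fun h => ?_, fun h => by rw [h, mul_zero]⟩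
  rw [← mul_sinv_mul' a, h, mul_zero]

end Zero

end InvSemigroup

/-! ### Σ-ordered inverse semigroups -/

namespace SigmaOrd

variable {S : SigmaOrd.{u}}

instance : IsTrans S.Carrier S.sub := ⟨S.sub_trans⟩

theorem zero_mem_idem (S : SigmaOrd.{u}) : (0 : S.Carrier) ∈ S.idem := mul_zero 0

theorem eq_zero_of_sub {a : S.Carrier} (h : S.sub a 0) : a = 0 :=
  S.sub_antisymm _ _ h (S.zero_sub a)

theorem sub_sinv_mul {a b : S.Carrier} (h : S.sub a b) : S.sub (sinv a * a) (sinv b * b) := by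
  have hba := S.mul_left_sub _ _ (sinv b) h
  rwa [(S.natLE_of_sub _ _ h).sinv_mul_eq] at hba

theorem sub_sinv {a b : S.Carrier} (h : S.sub a b) : S.sub (sinv a) (sinv b) := by
  have hab := S.mul_right_sub _ _ (sinv b) (sub_sinv_mul h)
  rwa [(S.natLE_of_sub _ _ h).sinv_eq, sinv_mul_sinv] at hab

/-- Inversion, as an automorphism of the order `⊆`. -/
noncomputable def sinvRelIso (S : SigmaOrd.{u}) : S.sub ≃r S.sub where
  toFun := sinv
  invFun := sinv
  left_inv := sinv_sinv
  right_inv := sinv_sinv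
  map_rel_iff' := ⟨fun h => by simpa only [Equiv.coe_fn_mk, sinv_sinv] using sub_sinv h, sub_sinv⟩

theorem mul_sinv_mul_sub {z w b : S.Carrier} (hz : S.sub z b) (hw : S.sub w b) :
    S.sub (z * (sinv w * w)) w := by
  have hzw := S.mul_right_sub _ _ (sinv w * w) hz
  rwa [(S.natLE_of_sub _ _ hw).eq_right] at hzw

theorem mul_sinv_mul_comm {z w b : S.Carrier} (hz : S.sub z b) (hw : S.sub w b) :
    z * (sinv w * w) = w * (sinv z * z) := by
  conv_lhs => rw [← (S.natLE_of_sub _ _ hz).eq_right]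
  conv_rhs => rw [← (S.natLE_of_sub _ _ hw).eq_right]
  rw [mul_assoc b, mul_assoc b, idem_comm (sinv_mul_idem z) (sinv_mul_idem w)]

theorem isInterpolator_of_right {t a p : S.Carrier} (htp : NatLE t p) (hp : S.sub p a)
    (hr : ∀ x, t * x = 0 ↔ p * x = 0) : S.IsInterpolator t a p := by
  refine ⟨htp, hp, hr, fun x => ?_⟩
  rw [← sinv_mul_mul_eq_zero, ← htp.mul_conj (sinv_mul_idem x), hr,
    (natLE_refl p).mul_conj (sinv_mul_idem x), sinv_mul_mul_eq_zero]

theorem distrib_right {c₁ c₂ c : S.Carrier} (a : S.Carrier) (h : IsSupOf S.sub {c₁, c₂} c) :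
    IsSupOf S.sub {c₁ * a, c₂ * a} (c * a) := by
  have image_pair : ∀ x y : S.Carrier, S.sinvRelIso '' {x, y} = {sinv x, sinv y} := fun x y => by
    rw [Set.image_pair]; rfl
  have hinv := (isSupOf_image_relIso S.sinvRelIso).2 h
  rw [image_pair] at hinv
  have hmul := (isSupOf_image_relIso S.sinvRelIso).2 (S.distrib (sinv a) _ _ _ hinv)
  rw [image_pair] at hmul
  simpa only [sinvRelIso, RelIso.coe_fn_mk, Equiv.coe_fn_mk, InvSemigroup.sinv_mul, sinv_sinv]
    using hmul

theorem exists_isSupOf_of_finite {F : Set S.Carrier} (hF : F.Finite) {b : S.Carrier}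
    (hb : ∀ x ∈ F, S.sub x b) : ∃ j, IsSupOf S.sub F j := by
  induction F, hF using Set.Finite.induction_on with
  | empty => exact ⟨0, by simp, fun d _ => S.zero_sub d⟩
  | @insert a F _ _ ih =>
    rw [Set.forall_mem_insert] at hb
    obtain ⟨j, hj⟩ := ih hb.2
    obtain ⟨k, hk⟩ := S.condJoin a j b hb.1 (hj.2 b hb.2)
    exact ⟨k, hj.insert hk⟩

theorem exists_orthogonal_compl {e f : S.Carrier} (he : e ∈ S.idem) (hf : f ∈ S.idem)
    (h : S.sub e f) : ∃ c ∈ S.idem, S.sub c f ∧ e * c = 0 ∧ IsSupOf S.sub {e, c} f := by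
  obtain ⟨c, hc, hsup, hinf⟩ := S.relCompl e f he hf h
  have hcf : S.sub c f := hsup.1 c (by simp)
  have hec_e := S.mul_left_sub _ _ e hcf
  have hec_c := S.mul_right_sub _ _ c h
  rw [idem_comm he hf, (natLE_iff_of_idem he).1 (S.natLE_of_sub _ _ h)] at hec_e
  rw [(natLE_iff_of_idem hc).1 (S.natLE_of_sub _ _ hcf)] at hec_c
  exact ⟨c, hc, hcf, eq_zero_of_sub ((isInfOf_pair.1 hinf).2.2 _ hec_e hec_c), hsup⟩

end SigmaOrd

/-! ### Semigroupoids -/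

namespace GraphedSemigroupoid

variable {S : GraphedSemigroupoid.{u}}

theorem mul_congr {a a' b b' : S.Arr} (ha : a = a') (hb : b = b') (h : S.src a = S.rng b)
    (h' : S.src a' = S.rng b') : S.mul a b h = S.mul a' b' h' := by
  subst ha hb; rfl

theorem IsBisection.mono {A B : Set S.Arr} (hB : S.IsBisection B) (h : A ⊆ B) :
    S.IsBisection A :=
  ⟨hB.1.mono h, hB.2.mono h⟩

theorem IsBisection.union {A B : Set S.Arr} (hA : S.IsBisection A) (hB : S.IsBisection B)
    (hs : ∀ a ∈ A, ∀ b ∈ B, S.src a ≠ S.src b) (hr : ∀ a ∈ A, ∀ b ∈ B, S.rng a ≠ S.rng b) :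
    S.IsBisection (A ∪ B) := by
  have hAB : Disjoint A B := Set.disjoint_left.2 fun x hx hx' => hs x hx x hx' rfl
  exact ⟨(Set.injOn_union hAB).2 ⟨hA.1, hB.1, hs⟩, (Set.injOn_union hAB).2 ⟨hA.2, hB.2, hr⟩⟩

theorem IsBisection.setMul {A B : Set S.Arr} (hA : S.IsBisection A) (hB : S.IsBisection B) :
    S.IsBisection (S.setMul A B) := by
  constructor
  · rintro _ ⟨a, ha, b, hb, h, rfl⟩ _ ⟨a', ha', b', hb', h', rfl⟩ e
    rw [S.src_mul, S.src_mul] at e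
    obtain rfl := hB.1 hb hb' e
    exact mul_congr (hA.1 ha ha' (h.trans h'.symm)) rfl _ _
  · rintro _ ⟨a, ha, b, hb, h, rfl⟩ _ ⟨a', ha', b', hb', h', rfl⟩ e
    rw [S.rng_mul, S.rng_mul] at e
    obtain rfl := hA.2 ha ha' e
    exact mul_congr rfl (hB.2 hb hb' (h.symm.trans h')) _ _

theorem setMul_assoc (A B C : Set S.Arr) :
    S.setMul (S.setMul A B) C = S.setMul A (S.setMul B C) := by
  ext x
  constructor
  · rintro ⟨_, ⟨a, ha, b, hb, h, rfl⟩, c, hc, k, rfl⟩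
    have k' : S.src b = S.rng c := (S.src_mul a b h).symm.trans k
    exact ⟨a, ha, _, ⟨b, hb, c, hc, k', rfl⟩, h.trans (S.rng_mul b c k').symm,
      (S.mul_assoc a b c h k').symm⟩
  · rintro ⟨a, ha, _, ⟨b, hb, c, hc, k, rfl⟩, h, rfl⟩
    have h' : S.src a = S.rng b := h.trans (S.rng_mul b c k)
    exact ⟨_, ⟨a, ha, b, hb, h', rfl⟩, c, hc, (S.src_mul a b h').trans k,
      S.mul_assoc a b c h' k⟩

theorem setMul_eq_image (A B : Set S.Arr) :
    S.setMul A B = (fun p : {p : S.Arr × S.Arr // S.src p.1 = S.rng p.2} =>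
      S.mul p.1.1 p.1.2 p.2) '' (Subtype.val ⁻¹' A ×ˢ B) := by
  ext c
  constructor
  · rintro ⟨a, ha, b, hb, h, rfl⟩
    exact ⟨⟨(a, b), h⟩, ⟨ha, hb⟩, rfl⟩
  · rintro ⟨⟨⟨a, b⟩, h⟩, ⟨ha, hb⟩, rfl⟩
    exact ⟨a, ha, b, hb, h, rfl⟩

theorem setMul_mono {A A' B B' : Set S.Arr} (hA : A ⊆ A') (hB : B ⊆ B') :
    S.setMul A B ⊆ S.setMul A' B' := by
  rintro _ ⟨a, ha, b, hb, h, rfl⟩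
  exact ⟨a, hA ha, b, hB hb, h, rfl⟩

theorem setMul_union (A B C : Set S.Arr) :
    S.setMul A (B ∪ C) = S.setMul A B ∪ S.setMul A C := by
  refine Set.Subset.antisymm ?_ (Set.union_subset (setMul_mono subset_rfl Set.subset_union_left)
    (setMul_mono subset_rfl Set.subset_union_right))
  rintro _ ⟨a, ha, b, hb | hb, h, rfl⟩
  · exact Or.inl ⟨a, ha, b, hb, h, rfl⟩
  · exact Or.inr ⟨a, ha, b, hb, h, rfl⟩

theorem setMul_eq_empty {A B : Set S.Arr} :
    S.setMul A B = ∅ ↔ ∀ a ∈ A, ∀ b ∈ B, S.src a ≠ S.rng b := by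
  rw [Set.eq_empty_iff_forall_notMem]
  constructor
  · intro H a ha b hb h
    exact H _ ⟨a, ha, b, hb, h, rfl⟩
  · rintro H _ ⟨a, ha, b, hb, h, rfl⟩
    exact H a ha b hb h

theorem IsBisection.mul_self_of_setMul_self {A : Set S.Arr} (hA : S.IsBisection A)
    (h : S.setMul A A = A) {a : S.Arr} (ha : a ∈ A) : ∃ k : S.src a = S.rng a, S.mul a a k = a := by
  obtain ⟨b, hb, c, hc, k, e⟩ := h.symm ▸ ha
  obtain rfl : c = a := hA.1 hc ha (by rw [← e, S.src_mul])
  obtain rfl : b = c := hA.2 hb ha (by rw [← e, S.rng_mul])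
  exact ⟨k, e⟩

/-- The semigroup of the arrows of a semigroupoid and a zero, the value of all products that are
not defined. It transfers the algebra of inverse semigroups to semigroupoids. -/
inductive AdjoinZero (S : GraphedSemigroupoid.{u}) : Type u
  | zero
  | arr (a : S.Arr)

namespace AdjoinZero

open Classical in
noncomputable instance : Mul S.AdjoinZero where
  mul
    | arr a, arr b => if h : S.src a = S.rng b then arr (S.mul a b h) else zero
    | _, _ => zero

instance : Zero S.AdjoinZero := ⟨zero⟩

theorem zero_mul' (x : S.AdjoinZero) : 0 * x = 0 := rfl

theorem mul_zero' (x : S.AdjoinZero) : x * 0 = 0 := by cases x <;> rfl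

theorem arr_mul_arr {a b : S.Arr} (h : S.src a = S.rng b) : arr a * arr b = arr (S.mul a b h) :=
  dif_pos h

theorem arr_mul_arr_of_ne {a b : S.Arr} (h : S.src a ≠ S.rng b) : arr a * arr b = 0 :=
  dif_neg h

theorem arr_ne_zero (a : S.Arr) : arr a ≠ 0 := fun h => by cases h

theorem arr_mul_arr_eq_arr {a b c : S.Arr} :
    arr a * arr b = arr c ↔ ∃ h : S.src a = S.rng b, S.mul a b h = c := by
  by_cases h : S.src a = S.rng b
  · simp only [arr_mul_arr h, arr.injEq, h, exists_true_left]
  · simp only [arr_mul_arr_of_ne h, (arr_ne_zero c).symm, h, IsEmpty.exists_iff]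

theorem arr_mul_assoc (a b c : S.Arr) : arr a * arr b * arr c = arr a * (arr b * arr c) := by
  by_cases h : S.src a = S.rng b <;> by_cases k : S.src b = S.rng c
  · rw [arr_mul_arr h, arr_mul_arr k, arr_mul_arr ((S.src_mul a b h).trans k),
      arr_mul_arr (h.trans (S.rng_mul b c k).symm), S.mul_assoc a b c h k]
  · rw [arr_mul_arr h, arr_mul_arr_of_ne k, arr_mul_arr_of_ne (by rwa [S.src_mul]), mul_zero']
  · rw [arr_mul_arr k, arr_mul_arr_of_ne h, arr_mul_arr_of_ne (by rwa [S.rng_mul]), zero_mul']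
  · rw [arr_mul_arr_of_ne h, arr_mul_arr_of_ne k, zero_mul', mul_zero']

noncomputable instance : SemigroupWithZero S.AdjoinZero where
  zero_mul := zero_mul'
  mul_zero := mul_zero'
  mul_assoc
    | zero, _, _ => rfl
    | arr a, zero, z => by
      change arr a * 0 * z = arr a * (0 * z)
      rw [mul_zero', zero_mul', mul_zero']
    | arr a, arr b, zero => by
      change arr a * arr b * 0 = arr a * (arr b * 0)
      rw [mul_zero', mul_zero', mul_zero']
    | arr a, arr b, arr c => arr_mul_assoc a b c

theorem isInverse_iff {a b : S.Arr} : S.IsInverse a b ↔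
    arr a * arr b * arr a = arr a ∧ arr b * arr a * arr b = arr b := by
  constructor
  · rintro ⟨h, k, hab, hba⟩
    rw [arr_mul_arr h, arr_mul_arr k]
    exact ⟨arr_mul_arr_eq_arr.2 ⟨_, hab⟩, arr_mul_arr_eq_arr.2 ⟨_, hba⟩⟩
  · rintro ⟨hab, hba⟩
    have composable : ∀ {a b : S.Arr}, arr a * arr b * arr a = arr a → S.src a = S.rng b :=
      fun {a b} h => by_contra fun hne =>
        arr_ne_zero a (by rw [← h, arr_mul_arr_of_ne hne, zero_mul])
    have h := composable hab
    have k := composable hba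
    rw [arr_mul_arr h, arr_mul_arr_eq_arr] at hab
    rw [arr_mul_arr k, arr_mul_arr_eq_arr] at hba
    exact ⟨h, k, hab.choose_spec, hba.choose_spec⟩

end AdjoinZero

open AdjoinZero

theorem existsUnique_inverse_of_idem_comm (hr : ∀ a : S.Arr, ∃ b, S.IsInverse a b)
    (hc : ∀ e f : S.Arr, (∃ h, S.mul e e h = e) → (∃ h, S.mul f f h = f) →
      ∀ (h : S.src e = S.rng f) (k : S.src f = S.rng e), S.mul e f h = S.mul f e k) (a : S.Arr) :
    ∃! b, S.IsInverse a b := by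
  have idem_comm : ∀ x y : S.AdjoinZero, x * x = x → y * y = y → x * y = y * x
    | .zero, y, _, _ => (mul_zero' y).symm
    | arr e, .zero, _, _ => mul_zero' (arr e)
    | arr e, arr f, he, hf => by
      rw [arr_mul_arr_eq_arr] at he hf
      by_cases h : S.src e = S.rng f
      · have k : S.src f = S.rng e := hf.1.trans (h.symm.trans he.1)
        rw [arr_mul_arr h, arr_mul_arr k, hc e f he hf h k]
      · have k : S.src f ≠ S.rng e := fun k => h (he.1.trans (k.symm.trans hf.1))
        rw [arr_mul_arr_of_ne h, arr_mul_arr_of_ne k]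
  obtain ⟨b, hb⟩ := hr a
  refine ⟨b, hb, fun c hac => ?_⟩
  rw [isInverse_iff] at hb hac
  exact arr.inj (inverse_unique_of_idem_comm idem_comm hac.1 hac.2 hb.1 hb.2)

end GraphedSemigroupoid

namespace InverseSemigroupoid

open GraphedSemigroupoid AdjoinZero

variable {S : InverseSemigroupoid.{u}}

theorem isInverse_star (a : S.Arr) : S.IsInverse a (S.star a) :=
  (S.existsUnique_inverse a).choose_spec.1

theorem eq_star {a b : S.Arr} (h : S.IsInverse a b) : b = S.star a :=
  (S.existsUnique_inverse a).choose_spec.2 b h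

theorem src_star (a : S.Arr) : S.src (S.star a) = S.rng a := (isInverse_star a).choose_spec.choose

theorem rng_star (a : S.Arr) : S.rng (S.star a) = S.src a := (isInverse_star a).choose.symm

instance : IsInverseSemigroup S.AdjoinZero where
  existsUnique_inverse
    | .zero => ⟨0, ⟨zero_mul _, zero_mul _⟩, fun b h => by
        rw [← h.2]; exact (mul_assoc b 0 b).trans (by rw [zero_mul, mul_zero])⟩
    | arr a => ⟨arr (S.star a), isInverse_iff.1 (isInverse_star a), fun
      | .zero, h => absurd (h.1.symm.trans (mul_assoc _ 0 _)) (by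
          rw [zero_mul, mul_zero]; exact arr_ne_zero a)
      | arr _, h => congrArg arr (eq_star (isInverse_iff.2 h))⟩

theorem sinv_arr (a : S.Arr) : sinv (arr a : S.AdjoinZero) = arr (S.star a) :=
  (eq_sinv (isInverse_iff.1 (isInverse_star a)).1 (isInverse_iff.1 (isInverse_star a)).2).symm

theorem star_star (a : S.Arr) : S.star (S.star a) = a := by
  rw [← arr.injEq, ← sinv_arr, ← sinv_arr, sinv_sinv]

theorem star_injective : Function.Injective S.star :=
  Function.Involutive.injective star_star

theorem isBisection_preimage_star {A : Set S.Arr} (hA : S.IsBisection A) :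
    S.IsBisection (S.star ⁻¹' A) :=
  ⟨fun _ ha _ hb h => star_injective (hA.2 ha hb (by rw [rng_star, rng_star, h])),
    fun _ ha _ hb h => star_injective (hA.1 ha hb (by rw [src_star, src_star, h]))⟩

theorem mul_star_mul (a : S.Arr) (h : S.src a = S.rng (S.star a))
    (k : S.src (S.mul a (S.star a) h) = S.rng a) : S.mul (S.mul a (S.star a) h) a k = a :=
  (isInverse_star a).choose_spec.choose_spec.1

theorem mul_comm_of_idem {e f : S.Arr} (he : ∃ h, S.mul e e h = e) (hf : ∃ h, S.mul f f h = f)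
    (h : S.src e = S.rng f) : ∃ k : S.src f = S.rng e, S.mul f e k = S.mul e f h := by
  rw [← arr_mul_arr_eq_arr] at he hf ⊢
  rw [← idem_comm he hf, arr_mul_arr h]

end InverseSemigroupoid

/-! ### Local homeomorphisms and compact-open sets -/

section Topology

open Topology TopologicalSpace Filter

variable {X Y Z : Type*} [TopologicalSpace X] [TopologicalSpace Y] [TopologicalSpace Z]

theorem exists_isCompact_isOpen_subset [LocallyCompactSpace X]
    (hX : IsTopologicalBasis {U : Set X | IsClopen U}) {x : X} {O : Set X} (hO : IsOpen O)
    (hx : x ∈ O) : ∃ V, IsCompact V ∧ IsOpen V ∧ x ∈ V ∧ V ⊆ O := by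
  obtain ⟨K, hK, hxK, hKO⟩ := exists_compact_subset hO hx
  obtain ⟨V, hV : IsClopen V, hxV, hVK⟩ := hX.exists_subset_of_mem_open hxK isOpen_interior
  have hVK' := hVK.trans interior_subset
  exact ⟨V, hK.of_isClosed_subset hV.isClosed hVK', hV.isOpen, hxV, hVK'.trans hKO⟩

theorem isCompact_inter_preimage_of_injOn {f : X → Y} (hf : Continuous f) (hf' : IsOpenMap f)
    {W : Set X} (hW : IsOpen W) (hi : Set.InjOn f W) {V : Set Y} (hV : IsCompact V)
    (hVW : V ⊆ f '' W) : IsCompact (W ∩ f ⁻¹' V) := by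
  have he : IsOpenEmbedding (W.domRestrict f) := .of_continuous_injective_isOpenMap
    hf.continuousOn.domRestrict hi.injective (hf'.comp hW.isOpenMap_subtype_val)
  rw [← Subtype.image_preimage_coe]
  exact (he.toIsInducing.isCompact_preimage' hV (by rwa [Set.range_domRestrict])).image
    continuous_subtype_val

theorem isOpenMap_snd_comp_val_of_isOpenMap {f : X → Z} {g : Y → Z} (hf : IsOpenMap f)
    (hg : Continuous g) : IsOpenMap fun p : {p : X × Y // f p.1 = g p.2} => p.1.2 := by
  refine isOpenMap_iff_nhds_le.2 fun ⟨⟨x, y⟩, h⟩ => le_map fun U hU => ?_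
  obtain ⟨O, hO, hOU⟩ := mem_nhds_subtype _ _ _ |>.1 hU
  obtain ⟨A, hA, B, hB, hAB⟩ := mem_nhds_prod_iff.1 hO
  have hfA : g ⁻¹' (f '' A) ∈ 𝓝 y :=
    hg.continuousAt.preimage_mem_nhds (h ▸ hf.image_mem_nhds hA)
  filter_upwards [hB, hfA] with y' hy' ⟨x', hx', h'⟩
  exact ⟨⟨(x', y'), h'⟩, hOU (hAB ⟨hx', hy'⟩), rfl⟩

theorem isOpenMap_of_comp_of_isLocallyInjective {f : Y → Z} {g : X → Y} (hf : IsLocallyInjective f)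
    (hf' : Continuous f) (hg : Continuous g) (hfg : IsOpenMap (f ∘ g)) : IsOpenMap g := by
  refine isOpenMap_iff_nhds_le.2 fun x => le_map fun U hU => ?_
  obtain ⟨W, hW, hxW, hi⟩ := hf (g x)
  have hU' : f ⁻¹' (f ∘ g '' (U ∩ g ⁻¹' W)) ∈ 𝓝 (g x) := hf'.continuousAt.preimage_mem_nhds
    (hfg.image_mem_nhds (inter_mem hU (hg.continuousAt.preimage_mem_nhds (hW.mem_nhds hxW))))
  filter_upwards [hW.mem_nhds hxW, hU'] with y hy ⟨x', ⟨hx'U, hx'W⟩, h⟩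
  exact ⟨x', hx'U, hi hx'W hy h⟩

/-- The limit of an ultrafilter in the preimage of `C` is found in some `f ⁻¹' A`; the injectivity
of `s` on `A` makes up for `Y` not being Hausdorff. -/
theorem isCompact_preimage_of_forall_exists_isOpen [T2Space Z] {f : X → Y} (hf : Continuous f)
    {s : Y → Z} (hs : Continuous s)
    (h : ∀ y, ∃ A, IsOpen A ∧ y ∈ A ∧ Set.InjOn s A ∧ IsCompact (f ⁻¹' A))
    {C : Set Y} (hC : IsCompact C) : IsCompact (f ⁻¹' C) := by
  rw [isCompact_iff_ultrafilter_le_nhds]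
  intro l hl
  obtain ⟨c, hc, hlc⟩ := isCompact_iff_ultrafilter_le_nhds.1 hC (l.map f)
    (map_le_iff_le_comap.2 (hl.trans_eq comap_principal.symm))
  obtain ⟨A, hA, hcA, hi, hfA⟩ := h c
  obtain ⟨x, hx, hlx⟩ := isCompact_iff_ultrafilter_le_nhds.1 hfA l
    (le_principal_iff.2 (hlc (hA.mem_nhds hcA)))
  have hsx : Tendsto (s ∘ f) l (𝓝 (s (f x))) := ((hs.comp hf).tendsto x).mono_left hlx
  have hsc : Tendsto (s ∘ f) l (𝓝 (s c)) := (hs.tendsto c).comp hlc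
  have hxc : f x = c := hi hx hcA (tendsto_nhds_unique hsx hsc)
  exact ⟨x, by rwa [Set.mem_preimage, hxc], hlx⟩

theorem eq_of_forall_mem_isTopologicalBasis [T2Space Z] {f : X → Z} {g : Y → Z}
    (hf : Continuous f) (hg : Continuous g) {𝒜 : Set (Set X)} {ℬ : Set (Set Y)}
    (h𝒜 : IsTopologicalBasis 𝒜) (hℬ : IsTopologicalBasis ℬ) {a : X} {b : Y}
    (h : ∀ A ∈ 𝒜, a ∈ A → ∀ B ∈ ℬ, b ∈ B → ∃ x ∈ A, ∃ y ∈ B, f x = g y) : f a = g b := by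
  by_contra hne
  obtain ⟨U, V, hU, hV, haU, hbV, hUV⟩ := t2_separation hne
  obtain ⟨A, hA, haA, hAU⟩ := h𝒜.exists_subset_of_mem_open haU (hU.preimage hf)
  obtain ⟨B, hB, hbB, hBV⟩ := hℬ.exists_subset_of_mem_open hbV (hV.preimage hg)
  obtain ⟨x, hx, y, hy, hxy⟩ := h A hA haA B hB hbB
  exact hUV.notMem_of_mem_left (hAU hx) (hxy ▸ hBV hy)

end Topology

/-! ### Compact-open bisections -/

namespace AmpStar

open GraphedSemigroupoid InverseSemigroupoid TopologicalSpace

variable {S : AmpStar.{u}}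

instance : LocallyCompactSpace S.Vert := S.locallyCompact

instance : T2Space S.Vert := S.hausdorff

theorem exists_isOpen_isBisection (a : S.Arr) : ∃ W, IsOpen W ∧ a ∈ W ∧ S.IsBisection W := by
  obtain ⟨W, hW, haW, hi⟩ := S.etale.isLocallyInjective a
  obtain ⟨W', hW', haW', hi'⟩ := S.etale.isLocallyInjective (S.star a)
  refine ⟨W ∩ S.star ⁻¹' W', hW.inter (hW'.preimage S.continuous_star), ⟨haW, haW'⟩,
    hi.mono Set.inter_subset_left, fun x hx y hy h => star_injective (hi' hx.2 hy.2 ?_)⟩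
  rw [src_star, src_star, h]

theorem isOpenMap_mul : IsOpenMap
    fun p : {p : S.Arr × S.Arr // S.src p.1 = S.rng p.2} => S.mul p.1.1 p.1.2 p.2 := by
  refine isOpenMap_of_comp_of_isLocallyInjective S.etale.isLocallyInjective S.continuous_src
    S.continuous_mul ?_
  convert S.etale.isOpenMap.comp
    (isOpenMap_snd_comp_val_of_isOpenMap S.etale.isOpenMap S.continuous_rng) using 1
  exact funext fun p => S.src_mul _ _ _

theorem isOpen_setMul {A B : Set S.Arr} (hA : IsOpen A) (hB : IsOpen B) :
    IsOpen (S.setMul A B) := by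
  rw [setMul_eq_image]
  exact isOpenMap_mul _ ((hA.prod hB).preimage continuous_subtype_val)

theorem isCompact_setMul {A B : Set S.Arr} (hA : IsCompact A) (hB : IsCompact B) :
    IsCompact (S.setMul A B) := by
  have hcl : IsClosed {p : S.Arr × S.Arr | S.src p.1 = S.rng p.2} :=
    isClosed_eq (S.continuous_src.comp continuous_fst) (S.continuous_rng.comp continuous_snd)
  rw [setMul_eq_image]
  exact (hcl.isClosedEmbedding_subtypeVal.isCompact_preimage (hA.prod hB)).image S.continuous_mul

namespace KB

@[ext]
theorem ext {A B : S.KB} (h : A.1 = B.1) : A = B := Subtype.ext h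

theorem isCompact (A : S.KB) : IsCompact A.1 := A.2.1

theorem isOpen (A : S.KB) : IsOpen A.1 := A.2.2.1

theorem isBisection (A : S.KB) : S.IsBisection A.1 := A.2.2.2

theorem src_inj (A : S.KB) {a b : S.Arr} (ha : a ∈ A.1) (hb : b ∈ A.1)
    (h : S.src a = S.src b) : a = b := A.isBisection.1 ha hb h

theorem rng_inj (A : S.KB) {a b : S.Arr} (ha : a ∈ A.1) (hb : b ∈ A.1)
    (h : S.rng a = S.rng b) : a = b := A.isBisection.2 ha hb h

theorem exists_mem_subset {a : S.Arr} {O : Set S.Arr} (hO : IsOpen O) (ha : a ∈ O) :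
    ∃ A : S.KB, a ∈ A.1 ∧ A.1 ⊆ O := by
  obtain ⟨W, hW, haW, hb⟩ := exists_isOpen_isBisection a
  have hOW := hO.inter hW
  have hb' := hb.mono (Set.inter_subset_right (s := O))
  obtain ⟨V, hV, hV', haV, hVW⟩ := exists_isCompact_isOpen_subset S.zeroDimensional
    (S.etale.isOpenMap _ hOW) (Set.mem_image_of_mem _ ⟨ha, haW⟩)
  exact ⟨⟨_, isCompact_inter_preimage_of_injOn S.continuous_src S.etale.isOpenMap hOW hb'.1 hV hVW,
    hOW.inter (hV'.preimage S.continuous_src), hb'.mono Set.inter_subset_left⟩,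
    ⟨⟨ha, haW⟩, haV⟩, fun x hx => hx.1.1⟩

theorem exists_mem (a : S.Arr) : ∃ A : S.KB, a ∈ A.1 :=
  (exists_mem_subset isOpen_univ (Set.mem_univ a)).imp fun _ h => h.1

theorem isTopologicalBasis : IsTopologicalBasis (Set.range fun A : S.KB => A.1) :=
  isTopologicalBasis_of_isOpen_of_nhds (Set.forall_mem_range.2 isOpen) fun _ _ ha hO =>
    (exists_mem_subset hO ha).elim fun A hA => ⟨A.1, ⟨A, rfl⟩, hA⟩

theorem eq_of_forall_mem {a b : S.Arr} (h : ∀ A : S.KB, a ∈ A.1 → b ∈ A.1) : a = b := by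
  have hsrc : S.src a = S.src b := by
    refine eq_of_forall_mem_isTopologicalBasis S.continuous_src S.continuous_src
      isTopologicalBasis isTopologicalBasis ?_
    rintro _ ⟨A, rfl⟩ ha _ ⟨B, rfl⟩ hb
    exact ⟨b, h A ha, b, hb, rfl⟩
  obtain ⟨A, hA⟩ := exists_mem a
  exact A.src_inj hA (h A hA) hsrc

theorem isClosed_src_image (A : S.KB) : IsClosed (S.src '' A.1) :=
  (A.isCompact.image S.continuous_src).isClosed

theorem isOpen_src_image (A : S.KB) : IsOpen (S.src '' A.1) := S.etale.isOpenMap _ A.isOpen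

/-- A compact-open subset of a compact-open bisection, as a compact-open bisection. -/
def ofSubset (A : S.KB) (B : Set S.Arr) (hc : IsCompact B) (ho : IsOpen B) (h : B ⊆ A.1) :
    S.KB := ⟨B, hc, ho, A.isBisection.mono h⟩

/-- The arrows of `A` whose source is the source of an arrow of `B`. For `B ≤ A` it is the
interpolator `A|B`. -/
def restrict (A B : S.KB) : S.KB :=
  A.ofSubset (A.1 ∩ S.src ⁻¹' (S.src '' B.1))
    (A.isCompact.inter_right (B.isClosed_src_image.preimage S.continuous_src))
    (A.isOpen.inter (B.isOpen_src_image.preimage S.continuous_src)) Set.inter_subset_left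

theorem isOpen_diff {A B : S.KB} (h : B.1 ⊆ A.1) : IsOpen (A.1 \ B.1) := by
  have hdiff : A.1 \ B.1 = A.1 ∩ S.src ⁻¹' (S.src '' B.1)ᶜ := by
    rw [Set.preimage_compl, ← Set.sdiff_eq]
    ext x
    refine and_congr_right fun hx => not_congr ⟨fun hxB => ⟨x, hxB, rfl⟩, ?_⟩
    rintro ⟨y, hy, e⟩
    exact A.src_inj (h hy) hx e ▸ hy
  rw [hdiff]
  exact A.isOpen.inter (B.isClosed_src_image.isOpen_compl.preimage S.continuous_src)

/-- The difference of two nested compact-open bisections. Arrow spaces may be non-Hausdorff, so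
that the difference of two arbitrary ones need not be open. -/
def diff (A B : S.KB) (h : B.1 ⊆ A.1) : S.KB :=
  A.ofSubset (A.1 \ B.1) (A.isCompact.diff B.isOpen) (isOpen_diff h) Set.sdiff_subset

instance : Mul S.KB where
  mul A B := ⟨S.setMul A.1 B.1, isCompact_setMul A.isCompact B.isCompact,
    isOpen_setMul A.isOpen B.isOpen, A.isBisection.setMul B.isBisection⟩

theorem mul_val (A B : S.KB) : (A * B).1 = S.setMul A.1 B.1 := rfl

instance : Zero S.KB where
  zero := ⟨∅, isCompact_empty, isOpen_empty, Set.injOn_empty _, Set.injOn_empty _⟩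

theorem eq_zero_iff {A : S.KB} : A = 0 ↔ A.1 = ∅ := ⟨fun h => h ▸ rfl, fun h => ext h⟩

theorem mul_eq_zero {A B : S.KB} : A * B = 0 ↔ ∀ a ∈ A.1, ∀ b ∈ B.1, S.src a ≠ S.rng b := by
  rw [eq_zero_iff, mul_val, setMul_eq_empty]

instance : SemigroupWithZero S.KB where
  mul_assoc A B C := ext (setMul_assoc A.1 B.1 C.1)
  zero_mul _ := mul_eq_zero.2 fun _ h => h.elim
  mul_zero _ := mul_eq_zero.2 fun _ _ _ h => h.elim

/-- The compact-open bisection of the inverses of the arrows of `A`. -/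
noncomputable def star (A : S.KB) : S.KB :=
  ⟨S.star ⁻¹' A.1,
    Set.image_eq_preimage_of_inverse star_star star_star ▸ A.isCompact.image S.continuous_star,
    A.isOpen.preimage S.continuous_star, isBisection_preimage_star A.isBisection⟩

theorem star_mem_star {A : S.KB} {a : S.Arr} : S.star a ∈ A.star.1 ↔ a ∈ A.1 := by
  change S.star (S.star a) ∈ A.1 ↔ a ∈ A.1
  rw [star_star]

theorem star_star (A : S.KB) : A.star.star = A := by
  ext a
  exact star_mem_star

theorem mem_mul_star_mul {A B : S.KB} {x : S.Arr} :
    x ∈ (A * B.star * B).1 ↔ ∃ a ∈ A.1, ∃ b ∈ B.1, ∃ (h : S.src a = S.rng (S.star b))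
      (k : S.src (S.mul a (S.star b) h) = S.rng b), S.mul (S.mul a (S.star b) h) b k = x := by
  constructor
  · rintro ⟨_, ⟨a, ha, c, hc, h, rfl⟩, b, hb, k, rfl⟩
    obtain ⟨c, rfl⟩ : ∃ c', S.star c' = c := ⟨_, InverseSemigroupoid.star_star c⟩
    obtain rfl : b = c := B.rng_inj hb (star_mem_star.1 hc) (by rw [← k, S.src_mul, src_star])
    exact ⟨a, ha, b, hb, h, k, rfl⟩
  · rintro ⟨a, ha, b, hb, h, k, rfl⟩
    exact ⟨_, ⟨a, ha, _, star_mem_star.2 hb, h, rfl⟩, b, hb, k, rfl⟩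

theorem mul_star_mul_of_subset {A B : S.KB} (h : A.1 ⊆ B.1) : B * A.star * A = A := by
  ext x
  rw [mem_mul_star_mul]
  constructor
  · rintro ⟨b, hb, a, ha, k, l, rfl⟩
    obtain rfl : b = a := B.src_inj hb (h ha) (k.trans (rng_star a))
    rwa [InverseSemigroupoid.mul_star_mul]
  · exact fun hx => ⟨x, h hx, x, hx, (rng_star x).symm, by rw [S.src_mul, src_star],
      InverseSemigroupoid.mul_star_mul x _ _⟩

theorem star_mul_mul_star (A : S.KB) : A.star * A * A.star = A.star := by
  simpa only [star_star] using mul_star_mul_of_subset (subset_refl A.star.1)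

theorem mul_self_iff {A : S.KB} :
    A * A = A ↔ ∀ a ∈ A.1, ∃ k : S.src a = S.rng a, S.mul a a k = a := by
  refine ⟨fun h a ha => A.isBisection.mul_self_of_setMul_self (congrArg Subtype.val h) ha,
    fun h => ext (Set.Subset.antisymm ?_ fun a ha => ?_)⟩
  · rintro _ ⟨a, ha, b, hb, k, rfl⟩
    obtain ⟨kb, e⟩ := h b hb
    obtain rfl : a = b := A.src_inj ha hb (k.trans kb.symm)
    rwa [e]
  · obtain ⟨k, e⟩ := h a ha
    exact ⟨a, ha, a, ha, k, e⟩

theorem mul_subset_mul_swap {E F : S.KB} (hE : E * E = E) (hF : F * F = F) :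
    (E * F).1 ⊆ (F * E).1 := by
  rintro _ ⟨e, he, f, hf, h, rfl⟩
  obtain ⟨k, hk⟩ := mul_comm_of_idem (mul_self_iff.1 hE e he) (mul_self_iff.1 hF f hf) h
  exact ⟨f, hf, e, he, k, hk⟩

instance : IsInverseSemigroup S.KB := isInverseSemigroup_of_idem_comm
  (fun A => ⟨A.star, mul_star_mul_of_subset subset_rfl, A.star_mul_mul_star⟩)
  fun _ _ hE hF => ext ((mul_subset_mul_swap hE hF).antisymm (mul_subset_mul_swap hF hE))

theorem sinv_eq (A : S.KB) : sinv A = A.star :=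
  (eq_sinv (mul_star_mul_of_subset subset_rfl) A.star_mul_mul_star).symm

theorem natLE_iff {A B : S.KB} : NatLE A B ↔ B * A.star * A = A := by
  rw [NatLE, sinv_eq, eq_comm]

theorem natLE_of_subset {A B : S.KB} (h : A.1 ⊆ B.1) : NatLE A B :=
  natLE_iff.2 (mul_star_mul_of_subset h)

theorem src_image_mul_star_mul (A B : S.KB) :
    S.src '' (A * B.star * B).1 = S.src '' A.1 ∩ S.src '' B.1 := by
  ext v
  constructor
  · rintro ⟨x, hx, rfl⟩
    obtain ⟨a, ha, b, hb, h, k, rfl⟩ := mem_mul_star_mul.1 hx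
    exact ⟨⟨a, ha, by rw [S.src_mul, h, rng_star]⟩, b, hb, (S.src_mul _ _ _).symm⟩
  · rintro ⟨⟨a, ha, rfl⟩, b, hb, e⟩
    have h : S.src a = S.rng (S.star b) := by rw [rng_star, e]
    have k : S.src (S.mul a (S.star b) h) = S.rng b := by rw [S.src_mul, src_star]
    exact ⟨_, mem_mul_star_mul.2 ⟨a, ha, b, hb, h, k, rfl⟩, by rw [S.src_mul, e]⟩

theorem src_image_subset_of_natLE {A B : S.KB} (h : NatLE A B) :
    S.src '' A.1 ⊆ S.src '' B.1 := by
  rw [← natLE_iff.1 h, src_image_mul_star_mul]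
  exact Set.inter_subset_left

theorem natLE_restrict {A B : S.KB} (h : NatLE A B) : NatLE A (B.restrict A) := by
  rw [natLE_iff] at h ⊢
  ext x
  conv_rhs => rw [← h]
  rw [mem_mul_star_mul, mem_mul_star_mul]
  constructor
  · rintro ⟨b, hb, a, ha, k, l, e⟩
    exact ⟨b, hb.1, a, ha, k, l, e⟩
  · rintro ⟨b, hb, a, ha, k, l, e⟩
    exact ⟨b, ⟨hb, a, ha, (k.trans (rng_star a)).symm⟩, a, ha, k, l, e⟩

theorem src_image_restrict {A B : S.KB} (h : NatLE A B) :
    S.src '' (B.restrict A).1 = S.src '' A.1 := by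
  change S.src '' (B.1 ∩ S.src ⁻¹' (S.src '' A.1)) = _
  rw [Set.image_inter_preimage, Set.inter_eq_right]
  exact src_image_subset_of_natLE h

theorem src_image_subset_iff {A B : S.KB} :
    S.src '' A.1 ⊆ S.src '' B.1 ↔ ∀ X : S.KB, B * X = 0 → A * X = 0 := by
  constructor
  · refine fun h X hX => mul_eq_zero.2 fun a ha x hx e => ?_
    obtain ⟨b, hb, e'⟩ := h ⟨a, ha, rfl⟩
    exact mul_eq_zero.1 hX b hb x hx (e'.trans e)
  · rintro h _ ⟨a, ha, rfl⟩
    by_contra hb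
    obtain ⟨X, haX, hX⟩ := exists_mem_subset (a := S.star a)
      (B.isClosed_src_image.isOpen_compl.preimage S.continuous_rng)
      (by rwa [Set.mem_preimage, rng_star])
    have hBX : B * X = 0 := mul_eq_zero.2 fun b hb x hx e => hX hx ⟨b, hb, e⟩
    exact mul_eq_zero.1 (h X hBX) a ha _ haX (rng_star a).symm

theorem src_image_eq_iff {A B : S.KB} :
    S.src '' A.1 = S.src '' B.1 ↔ ∀ X : S.KB, A * X = 0 ↔ B * X = 0 := by
  rw [Set.Subset.antisymm_iff, src_image_subset_iff, src_image_subset_iff, ← forall_and]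
  exact forall_congr' fun X => ⟨fun h => ⟨h.2, h.1⟩, fun h => ⟨h.2, h.1⟩⟩

theorem isSupOf_iff_of_finite {F : Set S.KB} (hF : F.Finite) {C : S.KB} :
    IsSupOf (fun A B : S.KB => A.1 ⊆ B.1) F C ↔ C.1 = ⋃ A ∈ F, A.1 := by
  constructor
  · intro h
    have hs : ⋃ A ∈ F, A.1 ⊆ C.1 := Set.iUnion₂_subset h.1
    exact (h.2 (C.ofSubset _ (hF.isCompact_biUnion fun A _ => A.isCompact)
      (isOpen_biUnion fun A _ => A.isOpen) hs) fun A hA => Set.subset_biUnion_of_mem hA).antisymm hs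
  · intro h
    exact ⟨fun A hA => (Set.subset_biUnion_of_mem hA).trans h.ge,
      fun D hD => h.le.trans (Set.iUnion₂_subset hD)⟩

theorem isSupOf_pair_iff {A B C : S.KB} :
    IsSupOf (fun A B : S.KB => A.1 ⊆ B.1) {A, B} C ↔ C.1 = A.1 ∪ B.1 := by
  rw [isSupOf_iff_of_finite (Set.toFinite _), Set.biUnion_pair]

theorem exists_isSupOf_pair {A B : S.KB} (h : S.IsBisection (A.1 ∪ B.1)) :
    ∃ C, IsSupOf (fun A B : S.KB => A.1 ⊆ B.1) {A, B} C :=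
  ⟨⟨A.1 ∪ B.1, A.isCompact.union B.isCompact, A.isOpen.union B.isOpen, h⟩, isSupOf_pair_iff.2 rfl⟩

theorem isBisection_union_of_orthogonal {A B : S.KB} (h : sinv A * B = 0) (k : A * sinv B = 0) :
    S.IsBisection (A.1 ∪ B.1) := by
  rw [sinv_eq, mul_eq_zero] at h k
  exact A.isBisection.union B.isBisection
    (fun a ha b hb e => k a ha _ (star_mem_star.2 hb) (by rw [rng_star, e]))
    (fun a ha b hb e => h _ (star_mem_star.2 ha) b hb (by rw [src_star, e]))

theorem orthogonal_of_isBisection_union {A B : S.KB} (h : S.IsBisection (A.1 ∪ B.1))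
    (hd : Disjoint A.1 B.1) : sinv A * B = 0 ∧ A * sinv B = 0 := by
  rw [sinv_eq, sinv_eq, mul_eq_zero, mul_eq_zero]
  have hne : ∀ a ∈ A.1, ∀ b ∈ B.1, a ≠ b := Set.disjoint_iff_forall_ne.1 hd
  constructor
  · refine fun a ha b hb e => hne _ ha b hb (h.2 (Or.inl ha) (Or.inr hb) ?_)
    rw [rng_star, e]
  · refine fun a ha b hb e => hne a ha _ hb (h.1 (Or.inl ha) (Or.inr hb) ?_)
    rw [src_star, e]

theorem isCompact_inter_of_isBisection_union {A B : S.KB} (h : S.IsBisection (A.1 ∪ B.1)) :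
    IsCompact (A.1 ∩ B.1) := by
  have hAB : A.1 ∩ B.1 = A.1 ∩ S.src ⁻¹' (S.src '' B.1) := by
    refine Set.ext fun a => and_congr_right fun ha => ⟨Set.mem_image_of_mem _, ?_⟩
    rintro ⟨b, hb, e⟩
    exact h.1 (Or.inr hb) (Or.inl ha) e ▸ hb
  exact hAB ▸ A.isCompact.inter_right (B.isClosed_src_image.preimage S.continuous_src)

theorem exists_finite_biUnion_superset {p : S.KB → Prop} {C : Set S.Arr} (hC : IsCompact C)
    (hp : ∀ c ∈ C, ∃ B : S.KB, c ∈ B.1 ∧ p B) :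
    ∃ F : Set S.KB, F.Finite ∧ C ⊆ ⋃ B ∈ F, B.1 ∧ ∀ B ∈ F, p B := by
  choose B hB hpB using fun c : C => hp c.1 c.2
  obtain ⟨t, ht⟩ := hC.elim_finite_subcover (fun c => (B c).1) (fun c => (B c).isOpen)
    fun c hc => Set.mem_iUnion.2 ⟨⟨c, hc⟩, hB _⟩
  refine ⟨B '' t, t.finite_toSet.image B, by rwa [Set.biUnion_image], ?_⟩
  rintro _ ⟨c, -, rfl⟩
  exact hpB c

theorem exists_finite_eq_biUnion {p : S.KB → Prop} (A : S.KB)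
    (hp : ∀ a ∈ A.1, ∃ B : S.KB, a ∈ B.1 ∧ B.1 ⊆ A.1 ∧ p B) :
    ∃ F : Set S.KB, F.Finite ∧ A.1 = ⋃ B ∈ F, B.1 ∧ ∀ B ∈ F, p B := by
  obtain ⟨F, hF, hAF, hFp⟩ := exists_finite_biUnion_superset A.isCompact hp
  exact ⟨F, hF, hAF.antisymm (Set.iUnion₂_subset fun B hB => (hFp B hB).1),
    fun B hB => (hFp B hB).2⟩

theorem exists_between {A : S.KB} {C O : Set S.Arr} (hC : IsCompact C) (hO : IsOpen O)
    (hCO : C ⊆ O) (hOA : O ⊆ A.1) : ∃ B : S.KB, C ⊆ B.1 ∧ B.1 ⊆ O := by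
  obtain ⟨F, hF, hCF, hFO⟩ := exists_finite_biUnion_superset hC
    fun c hc => exists_mem_subset hO (hCO hc)
  have hsub : ⋃ B ∈ F, B.1 ⊆ O := Set.iUnion₂_subset hFO
  exact ⟨A.ofSubset _ (hF.isCompact_biUnion fun B _ => B.isCompact)
    (isOpen_biUnion fun B _ => B.isOpen) (hsub.trans hOA), hCF, hsub⟩

end KB

/-- The Σ-ordered inverse semigroup `KB(S)`, with the product of sets and inclusion. -/
def bisections (S : AmpStar.{u}) : SigmaOrd.{u} where
  Carrier := S.KB
  sub A B := A.1 ⊆ B.1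
  sub_refl _ := subset_rfl
  sub_trans _ _ _ := Set.Subset.trans
  sub_antisymm _ _ h k := KB.ext (h.antisymm k)
  natLE_of_sub _ _ := KB.natLE_of_subset
  mul_right_sub _ _ _ h := setMul_mono h subset_rfl
  mul_left_sub _ _ _ h := setMul_mono subset_rfl h
  zero_sub _ := Set.empty_subset _
  condJoin A B C hA hB := KB.exists_isSupOf_pair (C.isBisection.mono (Set.union_subset hA hB))
  distrib A B C D h := by
    rw [KB.isSupOf_pair_iff] at h ⊢
    rw [KB.mul_val, KB.mul_val, KB.mul_val, h, setMul_union]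
  relCompl E F _ hF h := ⟨F.diff E h, KB.mul_self_iff.2 fun a ha => KB.mul_self_iff.1 hF a ha.1,
    KB.isSupOf_pair_iff.2 (Set.union_sdiff_cancel h).symm,
    isInfOf_pair.2 ⟨Set.empty_subset _, Set.empty_subset _, fun _ hE hD _ hx => (hD hx).2 (hE hx)⟩⟩
  orthJoin A B h k := KB.exists_isSupOf_pair (KB.isBisection_union_of_orthogonal h k)
  interpolation A B h := ⟨B.restrict A, KB.natLE_restrict h, Set.inter_subset_left,
    KB.src_image_eq_iff.1 (KB.src_image_restrict h).symm⟩

theorem isInterpolator_bisections_iff {A B P : S.KB} :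
    S.bisections.IsInterpolator A B P ↔
      NatLE A P ∧ P.1 ⊆ B.1 ∧ S.src '' A.1 = S.src '' P.1 :=
  ⟨fun h => ⟨h.1, h.2.1, KB.src_image_eq_iff.2 h.2.2.1⟩,
    fun h => SigmaOrd.isInterpolator_of_right (S := S.bisections) h.1 h.2.1
      (KB.src_image_eq_iff.1 h.2.2)⟩

end AmpStar

/-! ### Duality for morphisms -/

namespace AmpStar

open GraphedSemigroupoid InverseSemigroupoid

variable {S T : AmpStar.{u}}

namespace Hom

variable (φ : Hom S T)

theorem map_star (a : S.Arr) : φ.toFun (S.star a) = T.star (φ.toFun a) := by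
  obtain ⟨h, k, e₁, e₂⟩ := isInverse_star a
  refine eq_star ⟨φ.composable _ _ h, φ.composable _ _ k, ?_, ?_⟩
  · conv_rhs => rw [← e₁]
    rw [φ.map_mul, mul_congr (φ.map_mul _ _ _) rfl]
  · conv_rhs => rw [← e₂]
    rw [φ.map_mul, mul_congr (φ.map_mul _ _ _) rfl]

theorem rng_eq {a b : S.Arr} (h : S.rng a = S.rng b) :
    T.rng (φ.toFun a) = T.rng (φ.toFun b) := by
  have hstar : S.src (S.star a) = S.src (S.star b) := by rw [src_star, src_star, h]
  simpa only [φ.map_star, src_star] using φ.src_eq hstar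

theorem eq_of_rng_eq {a b : S.Arr} (h : S.rng a = S.rng b) (e : φ.toFun a = φ.toFun b) :
    a = b := star_injective (φ.starInjective _ _ (by rw [src_star, src_star, h])
      (by rw [φ.map_star, φ.map_star, e]))

/-- The preimage of a compact-open bisection, as a compact-open bisection. -/
def preimage (A : T.KB) : S.KB :=
  ⟨φ.toFun ⁻¹' A.1, φ.proper _ A.isCompact, A.isOpen.preimage φ.continuous,
    fun a ha b hb h => φ.starInjective a b h (A.src_inj ha hb (φ.src_eq h)),
    fun _ ha _ hb h => φ.eq_of_rng_eq h (A.rng_inj ha hb (φ.rng_eq h))⟩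

theorem preimage_mul (A B : T.KB) : φ.preimage (A * B) = φ.preimage A * φ.preimage B := by
  refine KB.ext (Set.Subset.antisymm ?_ ?_)
  · rintro x ⟨a, ha, b, hb, h, e⟩
    obtain ⟨y, hy, rfl⟩ := φ.starSurjective b x (by rw [← e, T.src_mul])
    obtain ⟨w, hw, rfl⟩ := φ.starSurjective a (S.star y) (by rw [φ.map_star, src_star, h])
    have hwy : S.src w = S.rng y := hw.trans (src_star y)
    refine ⟨w, ha, y, hb, hwy, φ.starInjective _ _ ((S.src_mul _ _ _).trans hy) ?_⟩
    rw [φ.map_mul, e]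
  · rintro _ ⟨a, ha, b, hb, h, rfl⟩
    exact ⟨_, ha, _, hb, φ.composable a b h, (φ.map_mul a b h).symm⟩

theorem src_mem_src_image_iff {a : S.Arr} {A : Set T.Arr} :
    T.src (φ.toFun a) ∈ T.src '' A ↔ S.src a ∈ S.src '' (φ.toFun ⁻¹' A) := by
  constructor
  · rintro ⟨b, hb, e⟩
    obtain ⟨y, hy, rfl⟩ := φ.starSurjective b a e
    exact ⟨y, hb, hy⟩
  · rintro ⟨b, hb, e⟩
    exact ⟨_, hb, φ.src_eq e⟩

theorem src_image_preimage_mono {A B : T.KB} (h : T.src '' A.1 ⊆ T.src '' B.1) :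
    S.src '' (φ.preimage A).1 ⊆ S.src '' (φ.preimage B).1 := by
  rintro _ ⟨a, ha, rfl⟩
  exact φ.src_mem_src_image_iff.1 (h ⟨_, ha, rfl⟩)

theorem exists_subset_preimage_inter {A B : T.KB} {D : S.KB} (hA : D.1 ⊆ (φ.preimage A).1)
    (hB : D.1 ⊆ (φ.preimage B).1) :
    ∃ C : T.KB, C.1 ⊆ A.1 ∧ C.1 ⊆ B.1 ∧ D.1 ⊆ (φ.preimage C).1 := by
  obtain ⟨C, hDC, hC⟩ := KB.exists_between (D.isCompact.image φ.continuous)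
    (A.isOpen.inter B.isOpen) (Set.image_subset_iff.2 fun x hx => ⟨hA hx, hB hx⟩)
    Set.inter_subset_left
  exact ⟨C, hC.trans Set.inter_subset_left, hC.trans Set.inter_subset_right,
    Set.image_subset_iff.1 hDC⟩

theorem exists_finite_eq_biUnion (D : S.KB) :
    ∃ F : Set S.KB, F.Finite ∧ D.1 = ⋃ B ∈ F, B.1 ∧ ∀ B ∈ F, ∃ A, B.1 ⊆ (φ.preimage A).1 := by
  refine KB.exists_finite_eq_biUnion D fun x hx => ?_
  obtain ⟨A, hA⟩ := KB.exists_mem (φ.toFun x)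
  obtain ⟨B, hB, hBO⟩ := KB.exists_mem_subset
    (D.isOpen.inter (A.isOpen.preimage φ.continuous)) ⟨hx, hA⟩
  exact ⟨B, hB, hBO.trans Set.inter_subset_left, A, hBO.trans Set.inter_subset_right⟩

/-- The morphism `A ↦ φ⁻¹(A)` from `KB(T)` to `KB(S)`. -/
def onBisections : SigmaOrd.Hom T.bisections S.bisections where
  toFun := φ.preimage
  map_mul := φ.preimage_mul
  map_zero := KB.ext rfl
  mono _ _ h := Set.preimage_mono h
  map_join A B C h := KB.isSupOf_pair_iff.2 <|
    (congrArg (φ.toFun ⁻¹' ·) (KB.isSupOf_pair_iff.1 h)).trans Set.preimage_union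
  weakMeet _ _ _ hA hB := φ.exists_subset_preimage_inter hA hB
  proper D := (φ.exists_finite_eq_biUnion D).imp fun _ h =>
    ⟨h.1, (KB.isSupOf_iff_of_finite h.1).2 h.2.1, h.2.2⟩
  map_interpolator A B P _ hP := by
    obtain ⟨hAP, hPB, hsrc⟩ := isInterpolator_bisections_iff.1 hP
    exact isInterpolator_bisections_iff.2
      ⟨hAP.map ⟨φ.preimage, φ.preimage_mul⟩, Set.preimage_mono hPB,
        (φ.src_image_preimage_mono hsrc.subset).antisymm (φ.src_image_preimage_mono hsrc.superset)⟩

theorem eq_of_preimage {φ ψ : Hom S T} (h : ∀ A, φ.preimage A = ψ.preimage A) : φ = ψ :=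
  Hom.ext (funext fun x => KB.eq_of_forall_mem fun A hA => by
    have hx : x ∈ (φ.preimage A).1 := hA
    rwa [h A] at hx)

end Hom

/-- The functor of compact-open bisections. -/
def bisectionFunctor : AmpStar.{u}ᵒᵖ ⥤ SigmaOrd.{u} where
  obj S := S.unop.bisections
  map φ := Hom.onBisections φ.unop

theorem isBisectionFunctor_bisectionFunctor : IsBisectionFunctor bisectionFunctor.{u} :=
  ⟨fun _ => Equiv.refl _, fun _ _ _ => rfl, fun _ _ _ => Iff.rfl, fun _ _ _ _ => rfl⟩

section Dual

variable (θ : SigmaOrd.Hom T.bisections S.bisections)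

/-- The morphism `θ`, as a map of compact-open bisections. -/
def bisectionMap (A : T.KB) : S.KB := θ.toFun A

theorem bisectionMap_mul (A B : T.KB) :
    bisectionMap θ (A * B) = bisectionMap θ A * bisectionMap θ B := θ.map_mul A B

theorem bisectionMap_mono {A B : T.KB} (h : A.1 ⊆ B.1) :
    (bisectionMap θ A).1 ⊆ (bisectionMap θ B).1 := θ.mono A B h

theorem bisectionMap_zero : bisectionMap θ 0 = 0 := θ.map_zero

theorem bisectionMap_biUnion {F : Set T.KB} (hF : F.Finite) {A : T.KB}
    (hA : A.1 = ⋃ B ∈ F, B.1) : (bisectionMap θ A).1 = ⋃ B ∈ F, (bisectionMap θ B).1 := by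
  have hsup := SigmaOrd.map_finite_sup (S := T.bisections) (T := S.bisections) θ.toFun
    (fun d => by rw [θ.map_zero]; exact SigmaOrd.zero_sub _ d) θ.map_join hF
    ((KB.isSupOf_iff_of_finite hF).2 hA)
  exact ((KB.isSupOf_iff_of_finite (hF.image _)).1 hsup).trans Set.biUnion_image

theorem exists_mem_bisectionMap (x : S.Arr) : ∃ A, x ∈ (bisectionMap θ A).1 := by
  obtain ⟨D, hD⟩ := KB.exists_mem x
  obtain ⟨F, hF, hsup, hFA⟩ := θ.proper D
  rw [(KB.isSupOf_iff_of_finite hF).1 hsup] at hD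
  obtain ⟨B, hB, hx⟩ := Set.mem_iUnion₂.1 hD
  obtain ⟨A, hA⟩ := hFA B hB
  exact ⟨A, hA hx⟩

theorem exists_mem_bisectionMap_inter {x : S.Arr} {A B : T.KB} (hA : x ∈ (bisectionMap θ A).1)
    (hB : x ∈ (bisectionMap θ B).1) :
    ∃ C : T.KB, C.1 ⊆ A.1 ∩ B.1 ∧ x ∈ (bisectionMap θ C).1 := by
  obtain ⟨D, hD, hDO⟩ := KB.exists_mem_subset
    ((bisectionMap θ A).isOpen.inter (bisectionMap θ B).isOpen) ⟨hA, hB⟩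
  obtain ⟨C, hCA, hCB, hDC⟩ := θ.weakMeet A B D (hDO.trans Set.inter_subset_left)
    (hDO.trans Set.inter_subset_right)
  exact ⟨C, Set.subset_inter hCA hCB, hDC hD⟩

theorem exists_mem_forall_mem_bisectionMap {x : S.Arr} {A : T.KB}
    (hA : x ∈ (bisectionMap θ A).1) :
    ∃ c ∈ A.1, ∀ B : T.KB, c ∈ B.1 → x ∈ (bisectionMap θ B).1 := by
  by_contra! hne
  obtain ⟨F, hF, hAF, hFx⟩ := KB.exists_finite_eq_biUnion A
    (p := fun B => x ∉ (bisectionMap θ B).1) fun c hc => by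
      obtain ⟨B, hcB, hx⟩ := hne c hc
      obtain ⟨C, hC, hCO⟩ := KB.exists_mem_subset (A.isOpen.inter B.isOpen) ⟨hc, hcB⟩
      exact ⟨C, hC, hCO.trans Set.inter_subset_left,
        fun h => hx (bisectionMap_mono θ (hCO.trans Set.inter_subset_right) h)⟩
  rw [bisectionMap_biUnion θ hF hAF] at hA
  obtain ⟨B, hB, hx⟩ := Set.mem_iUnion₂.1 hA
  exact hFx B hB hx

theorem bisectionMap_inter_eq_empty {A B : T.KB} (h : A.1 ∩ B.1 = ∅) :
    (bisectionMap θ A).1 ∩ (bisectionMap θ B).1 = ∅ := by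
  refine Set.eq_empty_of_forall_notMem fun x hx => ?_
  obtain ⟨C, hC, hxC⟩ := exists_mem_bisectionMap_inter θ hx.1 hx.2
  obtain rfl : C = 0 := KB.eq_zero_iff.2 (Set.subset_eq_empty hC h)
  rw [bisectionMap_zero] at hxC
  exact hxC

theorem exists_forall_mem_iff (x : S.Arr) :
    ∃ c : T.Arr, ∀ A, c ∈ A.1 ↔ x ∈ (bisectionMap θ A).1 := by
  obtain ⟨A₀, h₀⟩ := exists_mem_bisectionMap θ x
  obtain ⟨c, hc, hcA⟩ := exists_mem_forall_mem_bisectionMap θ h₀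
  refine ⟨c, fun A => ⟨hcA A, fun hx => ?_⟩⟩
  obtain ⟨C, hC, hxC⟩ := exists_mem_bisectionMap_inter θ hx h₀
  by_contra hcA'
  have hC₀ : C.1 ⊆ A₀.1 := hC.trans Set.inter_subset_right
  have hdiff : x ∈ (bisectionMap θ (A₀.diff C hC₀)).1 := hcA _ ⟨hc, fun h => hcA' (hC h).1⟩
  exact Set.eq_empty_iff_forall_notMem.1
    (bisectionMap_inter_eq_empty θ (Set.inter_sdiff_self C.1 A₀.1)) x ⟨hxC, hdiff⟩

/-- The map of arrows dual to `θ`: the image of `x` lies in the compact-open bisections `A` with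
`x ∈ θ(A)`. -/
noncomputable def dualFun (x : S.Arr) : T.Arr := (exists_forall_mem_iff θ x).choose

theorem dualFun_mem_iff {x : S.Arr} {A : T.KB} : dualFun θ x ∈ A.1 ↔ x ∈ (bisectionMap θ A).1 :=
  (exists_forall_mem_iff θ x).choose_spec A

theorem dualFun_preimage (A : T.KB) : dualFun θ ⁻¹' A.1 = (bisectionMap θ A).1 :=
  Set.ext fun _ => dualFun_mem_iff θ

theorem dualFun_composable (a b : S.Arr) (h : S.src a = S.rng b) :
    T.src (dualFun θ a) = T.rng (dualFun θ b) := by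
  refine eq_of_forall_mem_isTopologicalBasis T.continuous_src T.continuous_rng
    KB.isTopologicalBasis KB.isTopologicalBasis ?_
  rintro _ ⟨A, rfl⟩ hA _ ⟨B, rfl⟩ hB
  by_contra! hAB
  have hzero : bisectionMap θ A * bisectionMap θ B = 0 := by
    rw [← bisectionMap_mul, KB.mul_eq_zero.2 hAB, bisectionMap_zero]
  exact KB.mul_eq_zero.1 hzero a ((dualFun_mem_iff θ).1 hA) b ((dualFun_mem_iff θ).1 hB) h

theorem dualFun_mul_mem {a b : S.Arr} (h : S.src a = S.rng b) {A B : T.KB}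
    (hA : dualFun θ a ∈ A.1) (hB : dualFun θ b ∈ B.1) :
    dualFun θ (S.mul a b h) ∈ (A * B).1 := by
  rw [dualFun_mem_iff] at hA hB ⊢
  rw [bisectionMap_mul]
  exact ⟨a, hA, b, hB, h, rfl⟩

theorem src_dualFun_mul (a b : S.Arr) (h : S.src a = S.rng b) :
    T.src (dualFun θ (S.mul a b h)) = T.src (dualFun θ b) := by
  obtain ⟨A, hA⟩ := KB.exists_mem (dualFun θ a)
  refine eq_of_forall_mem_isTopologicalBasis T.continuous_src T.continuous_src
    KB.isTopologicalBasis KB.isTopologicalBasis ?_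
  rintro _ ⟨C, rfl⟩ hC _ ⟨B, rfl⟩ hB
  obtain ⟨x, -, y, hy, k, e⟩ := dualFun_mul_mem θ h hA hB
  exact ⟨_, hC, y, hy, by rw [← e, T.src_mul]⟩

theorem dualFun_mul (a b : S.Arr) (h : S.src a = S.rng b) :
    dualFun θ (S.mul a b h) =
      T.mul (dualFun θ a) (dualFun θ b) (dualFun_composable θ a b h) := by
  obtain ⟨A, hA⟩ := KB.exists_mem (dualFun θ a)
  obtain ⟨B, hB⟩ := KB.exists_mem (dualFun θ b)
  refine (A * B).src_inj (dualFun_mul_mem θ h hA hB) ⟨_, hA, _, hB, _, rfl⟩ ?_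
  rw [T.src_mul, src_dualFun_mul]

theorem continuous_dualFun : Continuous (dualFun θ) := by
  refine KB.isTopologicalBasis.continuous_iff.2 ?_
  rintro _ ⟨A, rfl⟩
  rw [dualFun_preimage]
  exact (bisectionMap θ A).isOpen

theorem isCompact_preimage_dualFun {C : Set T.Arr} (hC : IsCompact C) :
    IsCompact (dualFun θ ⁻¹' C) :=
  isCompact_preimage_of_forall_exists_isOpen (continuous_dualFun θ) T.continuous_src
    (fun y => (KB.exists_mem y).elim fun A hA => ⟨A.1, A.isOpen, hA, A.isBisection.1, by
      rw [dualFun_preimage]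
      exact (bisectionMap θ A).isCompact⟩) hC

theorem dualFun_starInjective {a b : S.Arr} (h : S.src a = S.src b)
    (e : dualFun θ a = dualFun θ b) : a = b := by
  obtain ⟨A, hA⟩ := KB.exists_mem (dualFun θ a)
  exact (bisectionMap θ A).src_inj ((dualFun_mem_iff θ).1 hA) ((dualFun_mem_iff θ).1 (e ▸ hA)) h

theorem src_image_bisectionMap_restrict {A B : T.KB} (h : NatLE B A) :
    S.src '' (bisectionMap θ (A.restrict B)).1 = S.src '' (bisectionMap θ B).1 := by
  have hP : T.bisections.IsInterpolator B A (A.restrict B) := isInterpolator_bisections_iff.2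
    ⟨KB.natLE_restrict h, Set.inter_subset_left, (KB.src_image_restrict h).symm⟩
  exact (isInterpolator_bisections_iff.1 (θ.map_interpolator _ _ _ h hP)).2.2.symm

theorem dualFun_starSurjective (t : T.Arr) (a : S.Arr) (h : T.src t = T.src (dualFun θ a)) :
    ∃ b : S.Arr, S.src b = S.src a ∧ dualFun θ b = t := by
  obtain ⟨A, hA⟩ := KB.exists_mem (dualFun θ a)
  obtain ⟨B, hB⟩ := KB.exists_mem t
  have hle : NatLE (A * B.star * B) A := by
    rw [← KB.sinv_eq, _root_.mul_assoc]
    exact natLE_mul_idem A (sinv_mul_idem B)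
  have ha : dualFun θ a ∈ (A.restrict (A * B.star * B)).1 := by
    refine ⟨hA, ?_⟩
    rw [Set.mem_preimage, KB.src_image_mul_star_mul]
    exact ⟨⟨_, hA, rfl⟩, t, hB, h⟩
  obtain ⟨y, hy, hya⟩ : S.src a ∈ S.src '' (bisectionMap θ (A * B.star * B)).1 :=
    src_image_bisectionMap_restrict θ hle ▸ ⟨a, (dualFun_mem_iff θ).1 ha, rfl⟩
  rw [bisectionMap_mul] at hy
  obtain ⟨x, -, b, hb, k, rfl⟩ := hy
  rw [S.src_mul] at hya
  refine ⟨b, hya, B.src_inj ((dualFun_mem_iff θ).2 hb) hB ?_⟩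
  rw [h, dualFun_composable θ b (S.star b) (rng_star b).symm,
    dualFun_composable θ a (S.star b) (by rw [rng_star, hya])]

/-- The homomorphism of semigroupoids dual to a morphism of Σ-ordered inverse semigroups. -/
noncomputable def dualHom : Hom S T where
  toFun := dualFun θ
  composable := dualFun_composable θ
  map_mul := dualFun_mul θ
  continuous := continuous_dualFun θ
  proper _ := isCompact_preimage_dualFun θ
  starInjective _ _ := dualFun_starInjective θ
  starSurjective := dualFun_starSurjective θ

theorem onBisections_dualHom : (dualHom θ).onBisections = θ :=
  SigmaOrd.Hom.ext (funext fun A => KB.ext (dualFun_preimage θ A))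

end Dual

/-- The inverse of `bisectionFunctor` on morphisms is `dualHom`. -/
noncomputable def fullyFaithfulBisectionFunctor : bisectionFunctor.{u}.FullyFaithful where
  preimage θ := Quiver.Hom.op (dualHom θ)
  map_preimage θ := onBisections_dualHom θ
  preimage_map φ := Quiver.Hom.unop_inj <| Hom.eq_of_preimage fun A =>
    congrFun (congrArg SigmaOrd.Hom.toFun (onBisections_dualHom (Hom.onBisections φ.unop))) A

end AmpStar

/-! ### The spectrum -/

namespace SigmaOrd

variable {S : SigmaOrd.{u}}

theorem mul_mem_idem {e f : S.Carrier} (he : e ∈ S.idem) (hf : f ∈ S.idem) : e * f ∈ S.idem :=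
  mul_idem he hf

theorem sinv_mul_mem_idem (a : S.Carrier) : sinv a * a ∈ S.idem := sinv_mul_idem a

namespace IsProperFilter

variable {F : Set S.Carrier}

theorem zero_notMem (hF : S.IsProperFilter F) : (0 : S.Carrier) ∉ F := fun h₀ =>
  hF.ne_idem (hF.subset.antisymm fun f hf =>
    hF.up_mem 0 h₀ f hf ((natLE_iff_of_idem S.zero_mem_idem).2 (mul_zero f)))

theorem of_zero_notMem (hsub : F ⊆ S.idem) (hne : F.Nonempty)
    (hmul : ∀ e ∈ F, ∀ f ∈ F, e * f ∈ F) (hup : ∀ e ∈ F, ∀ f ∈ S.idem, f * e = e → f ∈ F)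
    (h₀ : (0 : S.Carrier) ∉ F) : S.IsProperFilter F where
  subset := hsub
  nonempty := hne
  mul_mem := hmul
  up_mem e he f hf hle := hup e he f hf ((natLE_iff_of_idem (hsub he)).1 hle)
  ne_idem h := h₀ (h ▸ S.zero_mem_idem)

theorem sUnion {c : Set (Set S.Carrier)} (hc : ∀ F ∈ c, S.IsProperFilter F)
    (hchain : IsChain (· ⊆ ·) c) (hne : c.Nonempty) : S.IsProperFilter (⋃₀ c) := by
  refine of_zero_notMem (Set.sUnion_subset fun F hF => (hc F hF).subset) ?_ ?_ ?_ ?_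
  · obtain ⟨F, hF⟩ := hne
    exact (hc F hF).nonempty.mono (Set.subset_sUnion_of_mem hF)
  · rintro e ⟨F, hF, he⟩ f ⟨G, hG, hf⟩
    rcases hchain.total hF hG with h | h
    · exact ⟨G, hG, (hc G hG).mul_mem e (h he) f hf⟩
    · exact ⟨F, hF, (hc F hF).mul_mem e he f (h hf)⟩
  · rintro e ⟨F, hF, he⟩ f hf hfe
    exact ⟨F, hF, (hc F hF).up_mem e he f hf ((natLE_iff_of_idem ((hc F hF).subset he)).2 hfe)⟩
  · rintro ⟨F, hF, h₀⟩
    exact (hc F hF).zero_notMem h₀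

theorem maximal_of_forall_exists_mul_eq_zero
    (h : ∀ g ∈ S.idem, g ∉ F → ∃ f ∈ F, g * f = 0) {G : Set S.Carrier}
    (hG : S.IsProperFilter G) (hFG : F ⊆ G) : G = F := by
  refine Set.Subset.antisymm (fun g hg => ?_) hFG
  by_contra hgF
  obtain ⟨f, hf, hgf⟩ := h g (hG.subset hg) hgF
  exact hG.zero_notMem (hgf ▸ hG.mul_mem g hg f (hFG hf))

theorem exists_spectrum (hF : S.IsProperFilter F) : ∃ G : S.Spectrum, F ⊆ G.carrier := by
  obtain ⟨M, hFM, hM⟩ := zorn_subset_nonempty {G | S.IsProperFilter G}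
    (fun c hc hchain hne => ⟨⋃₀ c, sUnion hc hchain hne, fun _ => Set.subset_sUnion_of_mem⟩) F hF
  exact ⟨⟨M, hM.prop, fun G hG h => (hM.eq_of_subset hG h).symm⟩, hFM⟩

end IsProperFilter

/-- The upward closure in `E(S)` of a set of idempotents. -/
def upClosure (S : SigmaOrd.{u}) (B : Set S.Carrier) : Set S.Carrier :=
  {g | g ∈ S.idem ∧ ∃ b ∈ B, g * b = b}

theorem subset_upClosure {B : Set S.Carrier} (hB : B ⊆ S.idem) : B ⊆ S.upClosure B :=
  fun b hb => ⟨hB hb, b, hb, hB hb⟩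

theorem isProperFilter_upClosure {B : Set S.Carrier} (hB : B ⊆ S.idem) (hne : B.Nonempty)
    (hmul : ∀ b ∈ B, ∀ c ∈ B, b * c ∈ B) (h₀ : (0 : S.Carrier) ∉ B) :
    S.IsProperFilter (S.upClosure B) := by
  refine .of_zero_notMem (fun g hg => hg.1) (hne.mono (subset_upClosure hB)) ?_ ?_ ?_
  · rintro e ⟨he, b, hb, heb⟩ f ⟨hf, c, hc, hfc⟩
    refine ⟨mul_mem_idem he hf, b * c, hmul b hb c hc, ?_⟩
    calc e * f * (b * c) = e * (f * (c * b)) := by rw [mul_assoc, idem_comm (hB hb) (hB hc)]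
      _ = e * (c * b) := by rw [← mul_assoc f, hfc]
      _ = b * c := by rw [idem_comm (hB hc) (hB hb), ← mul_assoc, heb]
  · rintro e ⟨-, b, hb, heb⟩ f hf hfe
    exact ⟨hf, b, hb, by rw [← heb, ← mul_assoc, hfe]⟩
  · rintro ⟨-, b, hb, h⟩
    rw [zero_mul] at h
    exact h₀ (h ▸ hb)

theorem exists_spectrum {e : S.Carrier} (he : e ∈ S.idem) (h₀ : e ≠ 0) :
    ∃ F : S.Spectrum, e ∈ F.carrier := by
  have hB : {e} ⊆ S.idem := Set.singleton_subset_iff.2 he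
  obtain ⟨F, hF⟩ := (isProperFilter_upClosure hB (Set.singleton_nonempty e)
    (by rintro _ rfl _ rfl; exact he) h₀.symm).exists_spectrum
  exact ⟨F, hF (subset_upClosure hB rfl)⟩

namespace Spectrum

variable {F : S.Spectrum}

theorem idem_of_mem {e : S.Carrier} (h : e ∈ F.carrier) : e ∈ S.idem := F.isProperFilter.subset h

theorem zero_notMem (F : S.Spectrum) : (0 : S.Carrier) ∉ F.carrier := F.isProperFilter.zero_notMem

theorem mul_mem {e f : S.Carrier} (he : e ∈ F.carrier) (hf : f ∈ F.carrier) : e * f ∈ F.carrier :=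
  F.isProperFilter.mul_mem e he f hf

theorem mem_of_mul_eq {e f : S.Carrier} (he : e ∈ F.carrier) (hf : f ∈ S.idem)
    (h : f * e = e) : f ∈ F.carrier :=
  F.isProperFilter.up_mem e he f hf ((natLE_iff_of_idem (idem_of_mem he)).2 h)

theorem mul_mem_iff {e f : S.Carrier} (he : e ∈ S.idem) (hf : f ∈ S.idem) :
    e * f ∈ F.carrier ↔ e ∈ F.carrier ∧ f ∈ F.carrier := by
  refine ⟨fun h => ⟨mem_of_mul_eq h he ?_, mem_of_mul_eq h hf ?_⟩, fun h => mul_mem h.1 h.2⟩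
  · rw [← mul_assoc, he]
  · rw [idem_comm he hf, ← mul_assoc, hf]

theorem mem_iff {e : S.Carrier} (he : e ∈ S.idem) :
    e ∈ F.carrier ↔ ∀ f ∈ F.carrier, e * f ≠ 0 := by
  refine ⟨fun h f hf h₀ => F.zero_notMem (h₀ ▸ mul_mem h hf), fun h => ?_⟩
  have hB : (e * ·) '' F.carrier ⊆ S.idem :=
    Set.image_subset_iff.2 fun f hf => mul_mem_idem he (idem_of_mem hf)
  obtain ⟨f₀, hf₀⟩ := F.isProperFilter.nonempty
  have hG : S.IsProperFilter (S.upClosure ((e * ·) '' F.carrier)) := by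
    refine isProperFilter_upClosure hB ⟨_, f₀, hf₀, rfl⟩ ?_ (fun ⟨f, hf, h₀⟩ => h f hf h₀)
    rintro _ ⟨f, hf, rfl⟩ _ ⟨g, hg, rfl⟩
    refine ⟨f * g, mul_mem hf hg, ?_⟩
    calc e * (f * g) = e * e * f * g := by rw [he, mul_assoc]
      _ = e * (e * f) * g := by rw [mul_assoc e e f]
      _ = e * (f * e) * g := by rw [idem_comm he (idem_of_mem hf)]
      _ = e * f * (e * g) := by simp only [mul_assoc]
  have hFG : F.carrier ⊆ S.upClosure ((e * ·) '' F.carrier) := fun f hf =>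
    ⟨idem_of_mem hf, _, ⟨f, hf, rfl⟩, by
      change f * (e * f) = e * f
      rw [idem_comm he (idem_of_mem hf), ← mul_assoc, idem_of_mem hf]⟩
  rw [← F.maximal _ hG hFG]
  exact ⟨he, _, ⟨f₀, hf₀, rfl⟩, by rw [← mul_assoc, he]⟩

theorem exists_mul_eq_zero {e : S.Carrier} (he : e ∈ S.idem) (h : e ∉ F.carrier) :
    ∃ f ∈ F.carrier, e * f = 0 := by
  by_contra! hne
  exact h ((mem_iff he).2 hne)

theorem eq_of_subset {F G : S.Spectrum} (h : F.carrier ⊆ G.carrier) : F = G :=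
  Spectrum.ext (F.maximal _ G.isProperFilter h).symm

theorem mem_congr {e f : S.Carrier} (he : e ∈ S.idem) (hf : f ∈ S.idem)
    (h : ∀ x, e * x = 0 ↔ f * x = 0) : e ∈ F.carrier ↔ f ∈ F.carrier := by
  rw [mem_iff he, mem_iff hf]
  exact forall₂_congr fun x _ => not_congr (h x)

theorem exists_forall_mul_eq_zero {A : Set S.Carrier} (hA : A.Finite)
    (h : ∀ a ∈ A, sinv a * a ∉ F.carrier) : ∃ g ∈ F.carrier, ∀ a ∈ A, a * g = 0 := by
  induction A, hA using Set.Finite.induction_on with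
  | empty => exact F.isProperFilter.nonempty.imp fun g hg => ⟨hg, by simp⟩
  | @insert a A _ _ ih =>
    rw [Set.forall_mem_insert] at h
    obtain ⟨g, hg, hgA⟩ := ih h.2
    obtain ⟨f, hf, haf⟩ := exists_mul_eq_zero (sinv_mul_mem_idem a) h.1
    refine ⟨f * g, mul_mem hf hg, Set.forall_mem_insert.2 ⟨?_, fun x hx => ?_⟩⟩
    · rw [← mul_assoc, sinv_mul_mul_eq_zero.1 haf, zero_mul]
    · rw [idem_comm (idem_of_mem hf) (idem_of_mem hg), ← mul_assoc, hgA x hx, zero_mul]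

theorem exists_mem_of_isSupOf {A : Set S.Carrier} (hA : A.Finite) {j : S.Carrier}
    (hj : IsSupOf S.sub A j) (hF : sinv j * j ∈ F.carrier) :
    ∃ a ∈ A, sinv a * a ∈ F.carrier := by
  by_contra! hne
  obtain ⟨g, hg, hgA⟩ := exists_forall_mul_eq_zero hA hne
  have hsup := map_finite_sup (S := S) (T := S) (fun x => x * g)
    (fun d => by rw [zero_mul]; exact S.zero_sub d) (fun _ _ _ h => distrib_right g h) hA hj
  have hjg : j * g = 0 := eq_zero_of_sub <| hsup.2 0 <| by
    rintro _ ⟨a, ha, rfl⟩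
    exact hgA a ha ▸ S.sub_refl _
  have hmem := mul_mem hF hg
  rw [mul_assoc, hjg, mul_zero] at hmem
  exact F.zero_notMem hmem

theorem mem_or_mem_of_isSupOf {e c f : S.Carrier} (he : e ∈ S.idem) (hc : c ∈ S.idem)
    (hf : f ∈ S.idem) (h : IsSupOf S.sub {e, c} f) (hF : f ∈ F.carrier) :
    e ∈ F.carrier ∨ c ∈ F.carrier := by
  rw [← sinv_mul_of_idem hf] at hF
  rw [← sinv_mul_of_idem he, ← sinv_mul_of_idem hc]
  simpa only [Set.exists_mem_insert, Set.mem_singleton_iff, exists_eq_left] using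
    exists_mem_of_isSupOf (Set.toFinite _) h hF

end Spectrum

/-- The basic open set `X[e]` of the spectrum. -/
def basic (S : SigmaOrd.{u}) (e : S.Carrier) : Set S.Spectrum := {F | e ∈ F.carrier}

theorem isOpen_basic {e : S.Carrier} (he : e ∈ S.idem) : IsOpen (S.basic e) :=
  TopologicalSpace.isOpen_generateFrom_of_mem ⟨e, he, rfl⟩

theorem basic_zero : S.basic 0 = ∅ := Set.eq_empty_of_forall_notMem Spectrum.zero_notMem

theorem basic_mul {e f : S.Carrier} (he : e ∈ S.idem) (hf : f ∈ S.idem) :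
    S.basic (e * f) = S.basic e ∩ S.basic f := Set.ext fun _ => Spectrum.mul_mem_iff he hf

theorem basic_subset_basic {e f : S.Carrier} (hf : f ∈ S.idem) (h : f * e = e) :
    S.basic e ⊆ S.basic f := fun _ he => Spectrum.mem_of_mul_eq he hf h

theorem eq_zero_of_basic_eq_empty {e : S.Carrier} (he : e ∈ S.idem) (h : S.basic e = ∅) :
    e = 0 := by
  by_contra h₀
  obtain ⟨F, hF⟩ := exists_spectrum he h₀
  exact Set.eq_empty_iff_forall_notMem.1 h F hF

theorem isTopologicalBasis_basic (S : SigmaOrd.{u}) :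
    TopologicalSpace.IsTopologicalBasis {X | ∃ e ∈ S.idem, X = S.basic e} where
  exists_subset_inter := by
    rintro _ ⟨e, he, rfl⟩ _ ⟨f, hf, rfl⟩ F hF
    rw [← basic_mul he hf] at hF ⊢
    exact ⟨_, ⟨_, mul_mem_idem he hf, rfl⟩, hF, subset_rfl⟩
  sUnion_eq := Set.sUnion_eq_univ_iff.2 fun F => F.isProperFilter.nonempty.elim fun e he =>
    ⟨_, ⟨e, Spectrum.idem_of_mem he, rfl⟩, he⟩
  eq_generateFrom := rfl

theorem exists_basic_subset {F : S.Spectrum} {O : Set S.Spectrum} (hO : IsOpen O) (hF : F ∈ O) :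
    ∃ e ∈ F.carrier, S.basic e ⊆ O := by
  obtain ⟨_, ⟨e, -, rfl⟩, he, heO⟩ := S.isTopologicalBasis_basic.exists_subset_of_mem_open hF hO
  exact ⟨e, he, heO⟩

instance : T2Space S.Spectrum where
  t2 F G hne := by
    obtain ⟨e, heF, heG⟩ := Set.not_subset.1 fun h => hne (Spectrum.eq_of_subset h)
    have he := Spectrum.idem_of_mem heF
    obtain ⟨f, hf, hef⟩ := Spectrum.exists_mul_eq_zero he heG
    refine ⟨_, _, isOpen_basic he, isOpen_basic (Spectrum.idem_of_mem hf), heF, hf, ?_⟩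
    rw [Set.disjoint_iff_inter_eq_empty, ← basic_mul he (Spectrum.idem_of_mem hf), hef, basic_zero]

theorem exists_sub_basic_eq_inter {e f : S.Carrier} (he : e ∈ S.idem) (hf : f ∈ S.idem) :
    ∃ z ∈ S.idem, S.sub z f ∧ z * (f * e) = f * e ∧ S.basic z = S.basic f ∩ S.basic e := by
  have hfe := mul_mem_idem hf he
  obtain ⟨z, hle, hzf, hann⟩ := S.interpolation (f * e) f (natLE_mul_idem f he)
  have hz : z ∈ S.idem := idem_of_natLE hf (S.natLE_of_sub _ _ hzf)
  refine ⟨z, hz, hzf, (natLE_iff_of_idem hfe).1 hle, ?_⟩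
  rw [← basic_mul hf he]
  exact Set.ext fun F => (Spectrum.mem_congr hfe hz hann).symm

theorem exists_compl_basic {e f : S.Carrier} (he : e ∈ S.idem) (hf : f ∈ S.idem) :
    ∃ c ∈ S.idem, S.basic f \ S.basic e ⊆ S.basic c ∧ e * (f * c) = 0 := by
  obtain ⟨z, hz, hzf, hzfe, hzb⟩ := exists_sub_basic_eq_inter he hf
  obtain ⟨c, hc, -, hzc, hsup⟩ := exists_orthogonal_compl hz hf hzf
  refine ⟨c, hc, fun F hF => ?_, ?_⟩
  · refine (Spectrum.mem_or_mem_of_isSupOf hz hc hf hsup hF.1).resolve_left fun hzF => hF.2 ?_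
    exact (hzb.subset hzF).2
  · rw [← mul_assoc, idem_comm he hf, ← hzfe, idem_comm hz (mul_mem_idem hf he), mul_assoc, hzc,
      mul_zero]

/-- The limit in the spectrum of an ultrafilter of sets that contains some `X[e]`: the idempotents
`f` for which it contains `X[f]`. -/
def limit (U : Ultrafilter S.Spectrum) {e : S.Carrier} (he : e ∈ S.idem) (hU : S.basic e ∈ U) :
    S.Spectrum where
  carrier := {f | f ∈ S.idem ∧ S.basic f ∈ U}
  isProperFilter := by
    refine .of_zero_notMem (fun f hf => hf.1) ⟨e, he, hU⟩ ?_ ?_ ?_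
    · rintro f ⟨hf, hfU⟩ g ⟨hg, hgU⟩
      exact ⟨mul_mem_idem hf hg, basic_mul hf hg ▸ Filter.inter_mem hfU hgU⟩
    · rintro f ⟨-, hfU⟩ g hg hgf
      exact ⟨hg, Filter.mem_of_superset hfU (basic_subset_basic hg hgf)⟩
    · rintro ⟨-, h⟩
      exact U.empty_notMem (basic_zero ▸ h)
  maximal _ := IsProperFilter.maximal_of_forall_exists_mul_eq_zero fun g hg hgU => by
    obtain ⟨c, hc, hsub, hgc⟩ := exists_compl_basic hg he
    have hcompl : (S.basic g)ᶜ ∈ U :=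
      Ultrafilter.compl_mem_iff_notMem.2 fun h => hgU ⟨hg, h⟩
    have hcU : S.basic c ∈ U := Filter.mem_of_superset (Filter.inter_mem hU hcompl) hsub
    exact ⟨e * c, ⟨mul_mem_idem he hc, basic_mul he hc ▸ Filter.inter_mem hU hcU⟩, hgc⟩

theorem isCompact_basic {e : S.Carrier} (he : e ∈ S.idem) : IsCompact (S.basic e) := by
  rw [isCompact_iff_ultrafilter_le_nhds]
  intro U hU
  rw [Filter.le_principal_iff] at hU
  refine ⟨limit U he hU, ⟨he, hU⟩, S.isTopologicalBasis_basic.nhds_hasBasis.ge_iff.2 ?_⟩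
  rintro _ ⟨⟨f, -, rfl⟩, hf⟩
  exact hf.2

theorem isClopen_basic {e : S.Carrier} (he : e ∈ S.idem) : IsClopen (S.basic e) :=
  ⟨(isCompact_basic he).isClosed, isOpen_basic he⟩

theorem isTopologicalBasis_isClopen_spectrum (S : SigmaOrd.{u}) :
    TopologicalSpace.IsTopologicalBasis {U : Set S.Spectrum | IsClopen U} :=
  S.isTopologicalBasis_basic.of_isOpen_of_subset (fun _ h => h.isOpen) <| by
    rintro _ ⟨e, he, rfl⟩
    exact isClopen_basic he

instance : LocallyCompactSpace S.Spectrum :=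
  have : WeaklyLocallyCompactSpace S.Spectrum := ⟨fun F => by
    obtain ⟨e, he⟩ := F.isProperFilter.nonempty
    have hi := Spectrum.idem_of_mem he
    exact ⟨_, isCompact_basic hi, (isOpen_basic hi).mem_nhds he⟩⟩
  inferInstance

end SigmaOrd

/-! ### The action on the spectrum -/

namespace SigmaOrd

variable {S : SigmaOrd.{u}}

/-- The transport along `a` of a set `F` of idempotents: all `g` whose conjugate `a* g a` lies in
`F`. On an ultrafilter that contains `a* a` this is the dual Munn action (`munnHat_eq`). -/
def conjFilter (a : S.Carrier) (F : Set S.Carrier) : Set S.Carrier :=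
  {g | g ∈ S.idem ∧ sinv a * g * a ∈ F}

theorem conjFilter_mul (a b : S.Carrier) (F : Set S.Carrier) :
    conjFilter (a * b) F = conjFilter a (conjFilter b F) := by
  ext g
  have hconj : sinv (a * b) * g * (a * b) = sinv b * (sinv a * g * a) * b := by
    rw [InvSemigroup.sinv_mul]
    simp only [mul_assoc]
  simp only [conjFilter, Set.mem_ofPred_eq, hconj]
  exact ⟨fun h => ⟨h.1, conj_idem a h.1, h.2⟩, fun h => ⟨h.1, h.2.2⟩⟩

theorem mul_mul_sinv_mem_idem (a : S.Carrier) {e : S.Carrier} (he : e ∈ S.idem) :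
    a * e * sinv a ∈ S.idem := by
  have h := conj_idem (sinv a) he
  rwa [sinv_sinv] at h

theorem mul_mul_mul_sinv (a : S.Carrier) {f g : S.Carrier} (hg : g ∈ S.idem) :
    g * (a * f * sinv a) = a * (sinv a * g * a * f) * sinv a := by
  calc g * (a * f * sinv a) = g * (a * sinv a) * (a * f * sinv a) := by
        rw [mul_assoc g, ← mul_assoc (a * sinv a), ← mul_assoc (a * sinv a) a f, mul_sinv_mul]
    _ = a * sinv a * g * (a * f * sinv a) := by rw [idem_comm hg (mul_sinv_idem a)]
    _ = a * (sinv a * g * a * f) * sinv a := by simp only [mul_assoc]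

theorem munnHat_eq (a : S.Carrier) (F : S.Spectrum) :
    S.munnHat a F.carrier = conjFilter a F.carrier := by
  refine Set.Subset.antisymm ?_ ?_
  · rintro g ⟨hg, e, he, hea, heg⟩
    have hei := Spectrum.idem_of_mem he
    refine ⟨hg, Spectrum.mem_of_mul_eq he (conj_idem a hg) ?_⟩
    have hae : sinv a * a * e = e := (natLE_iff_of_idem hei).1 hea
    have hge : g * (a * e * sinv a) = a * e * sinv a :=
      (natLE_iff_of_idem (mul_mul_sinv_mem_idem a hei)).1 heg
    have hea' : e * (sinv a * a) = e := by rw [idem_comm hei (sinv_mul_mem_idem a), hae]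
    calc sinv a * g * a * e = sinv a * (g * (a * e * sinv a)) * a := by
          conv_lhs => rw [← hea']
          simp only [mul_assoc]
      _ = sinv a * a * (e * (sinv a * a)) := by rw [hge]; simp only [mul_assoc]
      _ = e := by rw [hea', hae]
  · rintro g ⟨hg, hF⟩
    refine ⟨hg, _, hF, (natLE_iff_of_idem (conj_idem a hg)).2 ?_,
      (natLE_iff_of_idem (mul_mul_sinv_mem_idem a (conj_idem a hg))).2 ?_⟩
    · rw [mul_assoc, mul_assoc (sinv a) g, ← mul_assoc a, ← mul_assoc (sinv a), sinv_mul_sinv']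
    · rw [mul_mul_mul_sinv a hg, conj_idem a hg]

/-- The image of an ultrafilter under the action of an element whose domain it contains. -/
def Spectrum.act (F : S.Spectrum) (a : S.Carrier) (h : sinv a * a ∈ F.carrier) : S.Spectrum where
  carrier := conjFilter a F.carrier
  isProperFilter := by
    refine .of_zero_notMem (fun g hg => hg.1) ⟨a * sinv a, mul_sinv_idem a, ?_⟩ ?_ ?_ ?_
    · rwa [sinv_mul_sinv']
    · rintro e ⟨he, he'⟩ f ⟨hf, hf'⟩
      exact ⟨mul_mem_idem he hf, conj_mul a f he ▸ mul_mem he' hf'⟩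
    · rintro e ⟨-, he'⟩ f hf hfe
      exact ⟨hf, mem_of_mul_eq he' (conj_idem a hf) (by rw [conj_mul a e hf, hfe])⟩
    · rintro ⟨-, h₀⟩
      rw [mul_zero, zero_mul] at h₀
      exact F.zero_notMem h₀
  maximal G := by
    refine IsProperFilter.maximal_of_forall_exists_mul_eq_zero fun g hg hgF => ?_
    obtain ⟨f, hf, hf₀⟩ := exists_mul_eq_zero (conj_idem a hg) fun h' => hgF ⟨hg, h'⟩
    refine ⟨a * f * sinv a, ⟨mul_mul_sinv_mem_idem a (idem_of_mem hf), ?_⟩, ?_⟩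
    · simpa only [mul_assoc] using mul_mem (mul_mem h hf) h
    · rw [mul_mul_mul_sinv a hg, hf₀, mul_zero, zero_mul]

theorem conjFilter_of_natLE {z a : S.Carrier} (h : NatLE z a) {F : S.Spectrum}
    (hz : sinv z * z ∈ F.carrier) : conjFilter z F.carrier = conjFilter a F.carrier := by
  ext g
  refine and_congr_right fun hg => ?_
  have hi := conj_idem a hg
  rw [h.conj, Spectrum.mul_mem_iff (mul_mem_idem (sinv_mul_mem_idem z) hi) (sinv_mul_mem_idem z),
    Spectrum.mul_mem_iff (sinv_mul_mem_idem z) hi]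
  exact ⟨fun h => h.1.2, fun h => ⟨⟨hz, h⟩, hz⟩⟩

theorem conjFilter_sinv_conjFilter {a : S.Carrier} {F : S.Spectrum} (h : sinv a * a ∈ F.carrier) :
    conjFilter (sinv a) (conjFilter a F.carrier) = F.carrier := by
  rw [← conjFilter_mul]
  ext g
  have hi := sinv_mul_mem_idem a
  simp only [conjFilter, Set.mem_ofPred_eq, sinv_of_idem (sinv_mul_idem a)]
  refine ⟨fun ⟨hg, hg'⟩ => ?_, fun hg =>
    ⟨Spectrum.idem_of_mem hg, Spectrum.mul_mem (Spectrum.mul_mem h hg) h⟩⟩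
  rw [Spectrum.mul_mem_iff (mul_mem_idem hi hg) hi, Spectrum.mul_mem_iff hi hg] at hg'
  exact hg'.1.2

theorem Spectrum.mem_of_natLE {F : S.Spectrum} {z a : S.Carrier} (h : NatLE z a)
    (hz : sinv z * z ∈ F.carrier) : sinv a * a ∈ F.carrier :=
  mem_of_mul_eq hz (sinv_mul_mem_idem a) h.sinv_mul_self_mul

theorem Spectrum.sinv_mul_mul_mem {F G : S.Spectrum} {a b : S.Carrier}
    (hG : G.carrier = conjFilter b F.carrier) (ha : sinv a * a ∈ G.carrier) :
    sinv (a * b) * (a * b) ∈ F.carrier := by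
  rw [hG] at ha
  rw [InvSemigroup.sinv_mul]
  simpa only [mul_assoc] using ha.2

/-! ### Germs -/

/-- The elements `a` and `b` have the same germ at `F`. -/
def GermEq (F : S.Spectrum) (a b : S.Carrier) : Prop :=
  ∃ z, S.sub z a ∧ S.sub z b ∧ sinv z * z ∈ F.carrier

namespace GermEq

variable {F G : S.Spectrum} {a a' b b' c : S.Carrier}

theorem refl (h : sinv a * a ∈ F.carrier) : GermEq F a a := ⟨a, S.sub_refl a, S.sub_refl a, h⟩

theorem of_sub (h : S.sub a b) (ha : sinv a * a ∈ F.carrier) : GermEq F a b :=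
  ⟨a, S.sub_refl a, h, ha⟩

theorem symm (h : GermEq F a b) : GermEq F b a := by
  obtain ⟨z, hza, hzb, hzF⟩ := h
  exact ⟨z, hzb, hza, hzF⟩

theorem trans (h : GermEq F a b) (k : GermEq F b c) : GermEq F a c := by
  obtain ⟨z, hza, hzb, hzF⟩ := h
  obtain ⟨w, hwb, hwc, hwF⟩ := k
  refine ⟨z * (sinv w * w), ?_, S.sub_trans _ _ _ (mul_sinv_mul_sub hzb hwb) hwc, ?_⟩
  · rw [mul_sinv_mul_comm hzb hwb]
    exact S.sub_trans _ _ _ (mul_sinv_mul_sub hwb hzb) hza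
  · rw [mul_idem_sinv_mul z (sinv_mul_idem w)]
    exact Spectrum.mul_mem hzF hwF

theorem left_mem (h : GermEq F a b) : sinv a * a ∈ F.carrier := by
  obtain ⟨z, hza, -, hzF⟩ := h
  exact Spectrum.mem_of_natLE (S.natLE_of_sub _ _ hza) hzF

theorem right_mem (h : GermEq F a b) : sinv b * b ∈ F.carrier := h.symm.left_mem

theorem conjFilter_eq (h : GermEq F a b) : conjFilter a F.carrier = conjFilter b F.carrier := by
  obtain ⟨z, hza, hzb, hzF⟩ := h
  rw [← conjFilter_of_natLE (S.natLE_of_sub _ _ hza) hzF,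
    ← conjFilter_of_natLE (S.natLE_of_sub _ _ hzb) hzF]

theorem mul (hG : G.carrier = conjFilter b F.carrier) (ha : GermEq G a a') (hb : GermEq F b b') :
    GermEq F (a * b) (a' * b') := by
  obtain ⟨z, hza, hza', hzG⟩ := ha
  obtain ⟨w, hwb, hwb', hwF⟩ := hb
  refine ⟨z * w, S.sub_trans _ _ _ (S.mul_right_sub _ _ w hza) (S.mul_left_sub _ _ a hwb),
    S.sub_trans _ _ _ (S.mul_right_sub _ _ w hza') (S.mul_left_sub _ _ a' hwb'),
    Spectrum.sinv_mul_mul_mem ?_ hzG⟩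
  rw [hG, conjFilter_of_natLE (S.natLE_of_sub _ _ hwb) hwF]

theorem exists_idem (h : GermEq F a (a * a)) : ∃ e, e * e = e ∧ GermEq F a e := by
  obtain ⟨z, hza, hzaa, hzF⟩ := h
  exact ⟨z, idem_of_natLE_sq (S.natLE_of_sub _ _ hza) (S.natLE_of_sub _ _ hzaa),
    (of_sub hza hzF).symm⟩

theorem mul_comm (ha : GermEq F a (a * a)) (hb : GermEq F b (b * b))
    (ha' : F.carrier = conjFilter a F.carrier) (hb' : F.carrier = conjFilter b F.carrier) :
    GermEq F (a * b) (b * a) := by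
  obtain ⟨e, he, hae⟩ := ha.exists_idem
  obtain ⟨f, hf, hbf⟩ := hb.exists_idem
  have hab : GermEq F (a * b) (e * f) := mul hb' hae hbf
  rw [idem_comm he hf] at hab
  exact hab.trans (mul ha' hbf hae).symm

end GermEq

theorem germRel_iff {p q : S.Semidirect} :
    S.germRel p q ↔ p.pt = q.pt ∧ GermEq p.pt p.elt q.elt := by
  constructor
  · rintro ⟨z, ⟨hp, hzp⟩, hq, hzq⟩
    exact ⟨hp.symm.trans hq, z.elt, hzp, hzq, hp ▸ z.mem⟩
  · rintro ⟨e, z, hzp, hzq, hz⟩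
    exact ⟨⟨z, p.pt, hz⟩, ⟨rfl, hzp⟩, e, hzq⟩

theorem equivalence_germRel (S : SigmaOrd.{u}) : Equivalence S.germRel where
  refl p := germRel_iff.2 ⟨rfl, GermEq.refl p.mem⟩
  symm h := by
    obtain ⟨e, h⟩ := germRel_iff.1 h
    exact germRel_iff.2 ⟨e.symm, e ▸ h.symm⟩
  trans h k := by
    obtain ⟨e, h⟩ := germRel_iff.1 h
    obtain ⟨e', k⟩ := germRel_iff.1 k
    exact germRel_iff.2 ⟨e.trans e', h.trans (e ▸ k)⟩

theorem germ_eq_iff {p q : S.Semidirect} :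
    p.germ = q.germ ↔ p.pt = q.pt ∧ GermEq p.pt p.elt q.elt :=
  (S.equivalence_germRel.quot_mk_eq_iff p q).trans germRel_iff

namespace Semidirect

theorem ext : ∀ {p q : S.Semidirect}, p.elt = q.elt → p.pt = q.pt → p = q
  | ⟨_, _, _⟩, ⟨_, _, _⟩, rfl, rfl => rfl

theorem germ_surjective : Function.Surjective (germ (S := S)) := Quot.exists_rep

/-- The range of the arrow `(a, F)` of the semidirect product. -/
def rng (p : S.Semidirect) : S.Spectrum := p.pt.act p.elt p.mem

/-- The product `(a, G) (b, F) = (a b, F)` in the semidirect product. -/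
def mul (p q : S.Semidirect) (h : p.pt = q.rng) : S.Semidirect :=
  ⟨p.elt * q.elt, q.pt, Spectrum.sinv_mul_mul_mem (congrArg Spectrum.carrier h) p.mem⟩

theorem rng_eq_of_germ_eq {p q : S.Semidirect} (h : p.germ = q.germ) : p.rng = q.rng := by
  obtain ⟨e, h⟩ := germ_eq_iff.1 h
  apply Spectrum.ext
  change conjFilter p.elt p.pt.carrier = conjFilter q.elt q.pt.carrier
  rw [h.conjFilter_eq, e]

theorem mul_germ_congr {p q p' q' : S.Semidirect} (hp : p.germ = p'.germ) (hq : q.germ = q'.germ)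
    (h : p.pt = q.rng) (h' : p'.pt = q'.rng) : (p.mul q h).germ = (p'.mul q' h').germ := by
  obtain ⟨-, hp⟩ := germ_eq_iff.1 hp
  obtain ⟨e, hq⟩ := germ_eq_iff.1 hq
  exact germ_eq_iff.2 ⟨e, GermEq.mul (congrArg Spectrum.carrier h) hp hq⟩

theorem rng_mul (p q : S.Semidirect) (h : p.pt = q.rng) : (p.mul q h).rng = p.rng := by
  apply Spectrum.ext
  change conjFilter (p.elt * q.elt) q.pt.carrier = conjFilter p.elt p.pt.carrier
  rw [h, conjFilter_mul]
  rfl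

/-- The inverse `(a*, a F)` of the arrow `(a, F)` of the semidirect product. -/
noncomputable def inv (p : S.Semidirect) : S.Semidirect :=
  ⟨sinv p.elt, p.rng, by rw [sinv_sinv]; exact mul_sinv_idem p.elt, by
    rw [sinv_sinv, sinv_mul_sinv']; exact p.mem⟩

theorem rng_inv (p : S.Semidirect) : p.inv.rng = p.pt :=
  Spectrum.ext (conjFilter_sinv_conjFilter p.mem)

end Semidirect

namespace Germ

/-- The source `F` of the germ `[a, F]`. -/
def src : S.Germ → S.Spectrum := Quot.lift Semidirect.pt fun _ _ h => (germRel_iff.1 h).1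

/-- The range of a germ. -/
def rng : S.Germ → S.Spectrum :=
  Quot.lift Semidirect.rng fun _ _ h => Semidirect.rng_eq_of_germ_eq (Quot.sound h)

theorem src_germ (p : S.Semidirect) : src p.germ = p.pt := rfl

theorem rng_germ (p : S.Semidirect) : rng p.germ = p.rng := rfl

/-- A chosen representative of a germ. -/
noncomputable def rep : S.Germ → S.Semidirect := Function.surjInv Semidirect.germ_surjective

theorem germ_rep (γ : S.Germ) : γ.rep.germ = γ := Function.surjInv_eq _ γ

theorem pt_rep_eq_rng_rep {α β : S.Germ} (h : src α = rng β) : α.rep.pt = β.rep.rng := by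
  rw [← src_germ, ← rng_germ, germ_rep, germ_rep, h]

/-- The product of two composable germs. -/
noncomputable def mul (α β : S.Germ) (h : src α = rng β) : S.Germ :=
  (α.rep.mul β.rep (pt_rep_eq_rng_rep h)).germ

theorem mul_germ (p q : S.Semidirect) (h : src p.germ = rng q.germ) :
    mul p.germ q.germ h = (p.mul q h).germ :=
  Semidirect.mul_germ_congr (germ_rep _) (germ_rep _) _ _

theorem src_mul (α β : S.Germ) (h : src α = rng β) : src (mul α β h) = src β := by
  conv_rhs => rw [← germ_rep β]
  rfl

/-- The set of all germs `[a, F]` of a fixed element `a`. -/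
def ofElt (a : S.Carrier) : Set S.Germ := {γ | ∃ p : S.Semidirect, p.elt = a ∧ p.germ = γ}

theorem germ_mem_ofElt_elt (p : S.Semidirect) : p.germ ∈ ofElt p.elt := ⟨p, rfl, rfl⟩

theorem germ_mem_ofElt {p : S.Semidirect} {a : S.Carrier} :
    p.germ ∈ ofElt a ↔ GermEq p.pt p.elt a := by
  constructor
  · rintro ⟨q, rfl, h⟩
    obtain ⟨e, h⟩ := germ_eq_iff.1 h
    exact e ▸ h.symm
  · intro h
    exact ⟨⟨a, p.pt, h.right_mem⟩, rfl, germ_eq_iff.2 ⟨rfl, h.symm⟩⟩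

theorem src_mem_basic {γ : S.Germ} {a : S.Carrier} (h : γ ∈ ofElt a) :
    src γ ∈ S.basic (sinv a * a) := by
  obtain ⟨p, rfl, rfl⟩ := h
  exact p.mem

theorem ofElt_mono {a b : S.Carrier} (h : S.sub a b) : ofElt a ⊆ ofElt b := by
  rintro _ ⟨p, rfl, rfl⟩
  exact germ_mem_ofElt.2 (GermEq.of_sub h p.mem)

theorem injOn_src_ofElt (a : S.Carrier) : Set.InjOn src (ofElt a) := by
  rintro _ ⟨⟨_, F, hF⟩, rfl, rfl⟩ _ ⟨⟨_, G, hG⟩, rfl, rfl⟩ e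
  obtain rfl : F = G := e
  rfl

theorem src_image_ofElt (a : S.Carrier) : src '' ofElt a = S.basic (sinv a * a) :=
  Set.Subset.antisymm (Set.image_subset_iff.2 fun _ => src_mem_basic)
    fun F hF => ⟨_, germ_mem_ofElt_elt ⟨a, F, hF⟩, rfl⟩

theorem mem_ofElt_iff_src_mem_basic {a z : S.Carrier} (hz : S.sub z a) {γ : S.Germ}
    (hγ : γ ∈ ofElt a) : γ ∈ ofElt z ↔ src γ ∈ S.basic (sinv z * z) := by
  refine ⟨src_mem_basic, fun h => ?_⟩
  obtain ⟨p, rfl, rfl⟩ := hγ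
  exact germ_mem_ofElt.2 (GermEq.of_sub hz h).symm

theorem exists_mem_ofElt_of_mem_of_mem {a b : S.Carrier} {γ : S.Germ} (ha : γ ∈ ofElt a)
    (hb : γ ∈ ofElt b) : ∃ z, S.sub z a ∧ S.sub z b ∧ γ ∈ ofElt z := by
  obtain ⟨p, rfl, rfl⟩ := ha
  obtain ⟨z, hza, hzb, hz⟩ := germ_mem_ofElt.1 hb
  exact ⟨z, hza, hzb, (mem_ofElt_iff_src_mem_basic hza (germ_mem_ofElt_elt p)).2 hz⟩

theorem mul_mem_ofElt {a b : S.Carrier} {α β : S.Germ} (hα : α ∈ ofElt a) (hβ : β ∈ ofElt b)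
    (h : src α = rng β) : mul α β h ∈ ofElt (a * b) := by
  obtain ⟨p, rfl, rfl⟩ := hα
  obtain ⟨q, rfl, rfl⟩ := hβ
  exact mul_germ p q h ▸ germ_mem_ofElt_elt (p.mul q h)

end Germ

/-! ### The topology of the space of germs -/

namespace Semidirect

theorem continuous_pt : Continuous (pt (S := S)) :=
  continuous_iff_le_induced.2 (inf_le_right (α := TopologicalSpace S.Semidirect))

/-- The inclusion `F ↦ (a, F)` of the domain of `a` into the semidirect product. -/
def slice (a : S.Carrier) (F : S.basic (sinv a * a)) : S.Semidirect := ⟨a, F.1, F.2⟩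

theorem continuous_slice (a : S.Carrier) : Continuous (slice a) :=
  (continuous_inf_rng (f := slice a)).2 ⟨continuous_induced_rng.2 (@continuous_const _ _ _ ⊥ a),
    continuous_induced_rng.2 continuous_subtype_val⟩

theorem isOpen_iff {V : Set S.Semidirect} : IsOpen V ↔ ∀ a, IsOpen (slice a ⁻¹' V) := by
  refine ⟨fun hV a => hV.preimage (continuous_slice a), fun hV => ?_⟩
  have hV_eq : V = ⋃ a, elt ⁻¹' {a} ∩ pt ⁻¹' (Subtype.val '' (slice a ⁻¹' V)) := by
    ext p
    simp only [Set.mem_iUnion]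
    constructor
    · exact fun hp => ⟨p.elt, rfl, ⟨p.pt, p.mem⟩, hp, rfl⟩
    · rintro ⟨_, rfl, F, hF, hFp⟩
      have hp : slice p.elt F = p := Semidirect.ext rfl hFp
      rwa [Set.mem_preimage, hp] at hF
  rw [hV_eq]
  refine isOpen_iUnion fun a => IsOpen.inter ?_ ?_
  · exact inf_le_left (α := TopologicalSpace S.Semidirect) _ ⟨{a}, trivial, rfl⟩
  · have hopen := (isOpen_basic (sinv_mul_mem_idem a)).isOpenMap_subtype_val _ (hV a)
    exact hopen.preimage continuous_pt

end Semidirect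

namespace Germ

theorem isOpen_iff {W : Set S.Germ} :
    IsOpen W ↔ ∀ a, IsOpen ((fun F => (Semidirect.slice a F).germ) ⁻¹' W) :=
  isOpen_coinduced.trans Semidirect.isOpen_iff

theorem isOpen_image_slice {W : Set S.Germ} (hW : IsOpen W) (a : S.Carrier) :
    IsOpen (Subtype.val '' ((fun F => (Semidirect.slice a F).germ) ⁻¹' W)) :=
  (isOpen_basic (sinv_mul_mem_idem a)).isOpenMap_subtype_val _ (isOpen_iff.1 hW a)

theorem continuous_src : Continuous (src (S := S)) :=
  continuous_coinduced_dom.2 Semidirect.continuous_pt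

theorem continuous_rng : Continuous (rng (S := S)) := by
  refine continuous_generateFrom_iff.2 ?_
  rintro _ ⟨g, hg, rfl⟩
  refine isOpen_iff.2 fun a => ?_
  have hpre : (fun F => (Semidirect.slice a F).germ) ⁻¹' (rng ⁻¹' {F | g ∈ F.carrier}) =
      Subtype.val ⁻¹' S.basic (sinv a * g * a) := Set.ext fun F => and_iff_right hg
  exact hpre ▸ (isOpen_basic (conj_idem a hg)).preimage continuous_subtype_val

theorem isOpen_setOf_germEq (a b : S.Carrier) : IsOpen {F : S.Spectrum | GermEq F a b} := by
  have hunion : {F : S.Spectrum | GermEq F a b} =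
      ⋃ z ∈ {z | S.sub z a ∧ S.sub z b}, S.basic (sinv z * z) := by
    ext F
    simp only [GermEq, basic, Set.mem_ofPred_eq, Set.mem_iUnion, exists_prop, and_assoc]
  exact hunion ▸ isOpen_biUnion fun z _ => isOpen_basic (sinv_mul_mem_idem z)

theorem isOpen_ofElt (a : S.Carrier) : IsOpen (ofElt a) := by
  refine isOpen_iff.2 fun b => ?_
  have hpre : (fun F => (Semidirect.slice b F).germ) ⁻¹' ofElt a =
      Subtype.val ⁻¹' {F | GermEq F b a} := Set.ext fun _ => germ_mem_ofElt
  exact hpre ▸ (isOpen_setOf_germEq b a).preimage continuous_subtype_val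

theorem isOpenMap_src : IsOpenMap (src (S := S)) := by
  intro W hW
  have himage : src '' W =
      ⋃ a, Subtype.val '' ((fun F => (Semidirect.slice a F).germ) ⁻¹' W) := by
    ext F
    simp only [Set.mem_iUnion]
    constructor
    · rintro ⟨γ, hγ, rfl⟩
      obtain ⟨p, rfl⟩ := Semidirect.germ_surjective γ
      exact ⟨p.elt, ⟨p.pt, p.mem⟩, hγ, rfl⟩
    · rintro ⟨a, F, hF, rfl⟩
      exact ⟨_, hF, rfl⟩
  exact himage ▸ isOpen_iUnion (isOpen_image_slice hW)

theorem isLocalHomeomorph_src : IsLocalHomeomorph (src (S := S)) := by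
  refine isLocalHomeomorph_iff_isOpenEmbedding_restrict.2 fun γ => ?_
  obtain ⟨p, rfl⟩ := Semidirect.germ_surjective γ
  exact ⟨ofElt p.elt, (isOpen_ofElt _).mem_nhds (germ_mem_ofElt_elt p),
    .of_continuous_injective_isOpenMap (continuous_src.comp continuous_subtype_val)
      (injOn_src_ofElt _).injective (isOpenMap_src.domRestrict (isOpen_ofElt _))⟩

theorem isTopologicalBasis_ofElt (S : SigmaOrd.{u}) :
    TopologicalSpace.IsTopologicalBasis (Set.range (ofElt (S := S))) := by
  refine TopologicalSpace.isTopologicalBasis_of_isOpen_of_nhds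
    (Set.forall_mem_range.2 isOpen_ofElt) fun γ W hγ hW => ?_
  obtain ⟨⟨a, F, hF⟩, rfl⟩ := Semidirect.germ_surjective γ
  obtain ⟨e, he, heW⟩ := exists_basic_subset (isOpen_image_slice hW a) ⟨⟨F, hF⟩, hγ, rfl⟩
  obtain ⟨z, hz, hza, -, hbasic⟩ :=
    exists_sub_basic_eq_inter (Spectrum.idem_of_mem he) (sinv_mul_mem_idem a)
  have hsub : S.sub (a * z) a := by
    simpa only [mul_sinv_mul'] using S.mul_left_sub _ _ a hza
  have hdom : sinv (a * z) * (a * z) = z := by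
    rw [mul_idem_sinv_mul a hz, (natLE_iff_of_idem hz).1 (S.natLE_of_sub _ _ hza)]
  refine ⟨ofElt (a * z), ⟨_, rfl⟩,
    (mem_ofElt_iff_src_mem_basic hsub (germ_mem_ofElt_elt ⟨a, F, hF⟩)).2 ?_, fun δ hδ => ?_⟩
  · rw [hdom, hbasic]
    exact ⟨hF, he⟩
  · have hδe := src_mem_basic hδ
    rw [hdom, hbasic] at hδe
    obtain ⟨G, hGW, hG⟩ := heW hδe.2
    rwa [injOn_src_ofElt a (ofElt_mono hsub hδ)
      (germ_mem_ofElt_elt (Semidirect.slice a G)) hG.symm]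

theorem continuous_mul : Continuous
    (fun p : {p : S.Germ × S.Germ // src p.1 = rng p.2} => mul p.1.1 p.1.2 p.2) := by
  refine (isTopologicalBasis_ofElt S).continuous_iff.2 (Set.forall_mem_range.2 fun c => ?_)
  refine isOpen_iff_forall_mem_open.2 ?_
  rintro ⟨⟨α, β⟩, h⟩ hc
  obtain ⟨p, rfl⟩ := Semidirect.germ_surjective α
  obtain ⟨q, rfl⟩ := Semidirect.germ_surjective β
  obtain ⟨z, hz, hzc, hzmem⟩ := exists_mem_ofElt_of_mem_of_mem
    (mul_mem_ofElt (germ_mem_ofElt_elt p) (germ_mem_ofElt_elt q) h) hc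
  have hsrc : ∀ {α' β' : S.Germ} (h' : src α' = rng β'), α' ∈ ofElt p.elt → β' ∈ ofElt q.elt →
      (mul α' β' h' ∈ ofElt z ↔ src β' ∈ S.basic (sinv z * z)) := fun h' hα' hβ' => by
    rw [mem_ofElt_iff_src_mem_basic hz (mul_mem_ofElt hα' hβ' h'), src_mul]
  refine ⟨{x | x.1.1 ∈ ofElt p.elt ∧ x.1.2 ∈ ofElt q.elt ∧ src x.1.2 ∈ S.basic (sinv z * z)},
    fun x hx => ofElt_mono hzc ((hsrc x.2 hx.1 hx.2.1).2 hx.2.2), ?_,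
    germ_mem_ofElt_elt p, germ_mem_ofElt_elt q,
    (hsrc h (germ_mem_ofElt_elt p) (germ_mem_ofElt_elt q)).1 hzmem⟩
  have hsnd := continuous_snd.comp
    (continuous_subtype_val (p := fun p : S.Germ × S.Germ => src p.1 = rng p.2))
  exact ((isOpen_ofElt _).preimage (continuous_fst.comp continuous_subtype_val)).inter
    (((isOpen_ofElt _).preimage hsnd).inter
      ((isOpen_basic (sinv_mul_mem_idem z)).preimage (continuous_src.comp hsnd)))

end Germ

end SigmaOrd

/-! ### The semigroupoid of germs -/

namespace SigmaOrd

variable {S : SigmaOrd.{u}}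

/-- The germs of the action on the spectrum, as a graphed semigroupoid. -/
noncomputable def germGraphed (S : SigmaOrd.{u}) : GraphedSemigroupoid.{u} where
  Vert := S.Spectrum
  Arr := S.Germ
  src := Germ.src
  rng := Germ.rng
  mul := Germ.mul
  src_mul := Germ.src_mul
  rng_mul α β h := by
    obtain ⟨p, rfl⟩ := Semidirect.germ_surjective α
    obtain ⟨q, rfl⟩ := Semidirect.germ_surjective β
    rw [Germ.mul_germ]
    exact Semidirect.rng_mul p q h
  mul_assoc α β γ h k := by
    obtain ⟨p, rfl⟩ := Semidirect.germ_surjective α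
    obtain ⟨q, rfl⟩ := Semidirect.germ_surjective β
    obtain ⟨r, rfl⟩ := Semidirect.germ_surjective γ
    simp only [Germ.mul_germ]
    exact congrArg Semidirect.germ (Semidirect.ext (mul_assoc p.elt q.elt r.elt) rfl)
  vert_eq F := by
    obtain ⟨e, he⟩ := F.isProperFilter.nonempty
    have heF : sinv e * e ∈ F.carrier := by rwa [sinv_mul_of_idem (Spectrum.idem_of_mem he)]
    exact Or.inl ⟨Semidirect.germ ⟨e, F, heF⟩, rfl⟩

theorem germGraphed_mul_germ (p q : S.Semidirect)
    (h : S.germGraphed.src p.germ = S.germGraphed.rng q.germ) :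
    S.germGraphed.mul p.germ q.germ h = (p.mul q h).germ :=
  Germ.mul_germ p q h

theorem isInverse_inv_germ (p : S.Semidirect) : S.germGraphed.IsInverse p.germ p.inv.germ := by
  have h : S.germGraphed.src p.germ = S.germGraphed.rng p.inv.germ := p.rng_inv.symm
  have k : S.germGraphed.src p.inv.germ = S.germGraphed.rng p.germ := rfl
  refine ⟨h, k, ?_, ?_⟩
  · simp only [germGraphed_mul_germ]
    exact congrArg Semidirect.germ (Semidirect.ext (mul_sinv_mul p.elt) rfl)
  · simp only [germGraphed_mul_germ]
    exact congrArg Semidirect.germ (Semidirect.ext (sinv_mul_sinv p.elt) rfl)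

theorem germEq_mul_self {p : S.Semidirect} (h : Germ.src p.germ = Germ.rng p.germ)
    (hp : Germ.mul p.germ p.germ h = p.germ) : GermEq p.pt p.elt (p.elt * p.elt) := by
  rw [Germ.mul_germ] at hp
  exact (germ_eq_iff.1 hp).2.symm

theorem germ_mul_comm {α β : S.Germ} (hα : ∃ h, Germ.mul α α h = α)
    (hβ : ∃ h, Germ.mul β β h = β) (h : Germ.src α = Germ.rng β) (k : Germ.src β = Germ.rng α) :
    Germ.mul α β h = Germ.mul β α k := by
  obtain ⟨p, rfl⟩ := Semidirect.germ_surjective α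
  obtain ⟨q, rfl⟩ := Semidirect.germ_surjective β
  obtain ⟨hp, hpp⟩ := hα
  obtain ⟨hq, hqq⟩ := hβ
  have hpq : q.pt = p.pt := Eq.trans k hp.symm
  have hpp' : GermEq q.pt p.elt (p.elt * p.elt) := hpq ▸ germEq_mul_self hp hpp
  have hp_rng : p.pt.carrier = conjFilter p.elt p.pt.carrier := congrArg Spectrum.carrier hp
  have hq_rng : q.pt.carrier = conjFilter q.elt q.pt.carrier := congrArg Spectrum.carrier hq
  rw [Germ.mul_germ, Germ.mul_germ]
  exact germ_eq_iff.2 ⟨hpq, hpp'.mul_comm (germEq_mul_self hq hqq) (hpq ▸ hp_rng) hq_rng⟩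

/-- The germs of the action on the spectrum, as an inverse semigroupoid. -/
noncomputable def germInverse (S : SigmaOrd.{u}) : InverseSemigroupoid.{u} where
  toGraphedSemigroupoid := S.germGraphed
  existsUnique_inverse := GraphedSemigroupoid.existsUnique_inverse_of_idem_comm
    (Semidirect.germ_surjective.forall.2 fun p => ⟨_, isInverse_inv_germ p⟩)
    fun _ _ => germ_mul_comm

theorem star_germ (p : S.Semidirect) : S.germInverse.star p.germ = p.inv.germ :=
  (InverseSemigroupoid.eq_star (S := S.germInverse) (isInverse_inv_germ p)).symm

theorem star_mem_ofElt {γ : S.Germ} {a : S.Carrier} (h : γ ∈ Germ.ofElt a) :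
    S.germInverse.star γ ∈ Germ.ofElt (sinv a) := by
  obtain ⟨p, rfl, rfl⟩ := h
  exact star_germ p ▸ Germ.germ_mem_ofElt_elt p.inv

theorem continuous_star_germ : Continuous (X := S.Germ) (Y := S.Germ) S.germInverse.star := by
  refine (Germ.isTopologicalBasis_ofElt S).continuous_iff.2 (Set.forall_mem_range.2 fun a => ?_)
  have hpre : S.germInverse.star ⁻¹' Germ.ofElt a = Germ.ofElt (sinv a) := by
    refine Set.Subset.antisymm (fun γ hγ => ?_) fun γ hγ => ?_
    · exact InverseSemigroupoid.star_star (S := S.germInverse) γ ▸ star_mem_ofElt hγ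
    · exact sinv_sinv a ▸ star_mem_ofElt hγ
  exact hpre ▸ Germ.isOpen_ofElt _

/-- The germs of the action on the spectrum, as a topological inverse semigroupoid. -/
noncomputable def germTop (S : SigmaOrd.{u}) : TopInverseSemigroupoid.{u} where
  toInverseSemigroupoid := S.germInverse
  topVert := instTopologicalSpaceSpectrum S
  topArr := instTopologicalSpaceGerm S
  continuous_src := Germ.continuous_src
  continuous_rng := Germ.continuous_rng
  continuous_mul := Germ.continuous_mul
  continuous_star := continuous_star_germ

/-- The ample inverse semigroupoid of germs. -/
noncomputable def germs (S : SigmaOrd.{u}) : AmpStar.{u} where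
  toTopInverseSemigroupoid := S.germTop
  etale := Germ.isLocalHomeomorph_src
  locallyCompact := inferInstanceAs (LocallyCompactSpace S.Spectrum)
  hausdorff := inferInstanceAs (T2Space S.Spectrum)
  zeroDimensional := S.isTopologicalBasis_isClopen_spectrum

end SigmaOrd

/-! ### Compact-open bisections of germs -/

namespace SigmaOrd

variable {S : SigmaOrd.{u}}

theorem isCompact_ofElt (a : S.Carrier) : IsCompact (Germ.ofElt a) := by
  have hcompact := isCompact_inter_preimage_of_injOn Germ.continuous_src Germ.isOpenMap_src
    (Germ.isOpen_ofElt a) (Germ.injOn_src_ofElt a) (isCompact_basic (sinv_mul_mem_idem a))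
    (Germ.src_image_ofElt a).ge
  have hsub : Germ.ofElt a ⊆ Germ.src ⁻¹' S.basic (sinv a * a) := fun _ => Germ.src_mem_basic
  rwa [Set.inter_eq_left.2 hsub] at hcompact

theorem injOn_rng_ofElt (a : S.Carrier) : Set.InjOn Germ.rng (Germ.ofElt a) := by
  rintro _ ⟨p, rfl, rfl⟩ _ ⟨q, hq, rfl⟩ e
  refine Germ.injOn_src_ofElt _ ⟨p, rfl, rfl⟩ ⟨q, hq, rfl⟩ (Spectrum.ext ?_)
  have hconj : conjFilter p.elt p.pt.carrier = conjFilter q.elt q.pt.carrier :=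
    congrArg Spectrum.carrier e
  rw [hq] at hconj
  rw [Germ.src_germ, Germ.src_germ, ← conjFilter_sinv_conjFilter p.mem, hconj,
    conjFilter_sinv_conjFilter (hq ▸ q.mem)]

theorem ofElt_mul (a b : S.Carrier) :
    Germ.ofElt (a * b) = S.germs.setMul (Germ.ofElt a) (Germ.ofElt b) := by
  refine Set.Subset.antisymm ?_ ?_
  · rintro _ ⟨p, hp, rfl⟩
    have hab : sinv b * (sinv a * a) * b ∈ p.pt.carrier := by
      have hmem := p.mem
      rw [hp, InvSemigroup.sinv_mul] at hmem
      simpa only [mul_assoc] using hmem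
    have hb : sinv b * b ∈ p.pt.carrier := by
      refine Spectrum.mem_of_mul_eq hab (sinv_mul_mem_idem b) ?_
      simp only [← mul_assoc, sinv_mul_sinv]
    let q : S.Semidirect := ⟨b, p.pt, hb⟩
    let r : S.Semidirect := ⟨a, q.rng, sinv_mul_mem_idem a, hab⟩
    exact ⟨r.germ, Germ.germ_mem_ofElt_elt r, q.germ, Germ.germ_mem_ofElt_elt q, rfl,
      (Germ.mul_germ r q rfl).trans (congrArg Semidirect.germ (Semidirect.ext hp.symm rfl))⟩
  · rintro _ ⟨α, hα, β, hβ, h, rfl⟩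
    exact Germ.mul_mem_ofElt hα hβ h

/-- The compact-open bisection of the germs of an element, as a homomorphism of semigroups. -/
def toKB (S : SigmaOrd.{u}) : S.Carrier →ₙ* S.germs.KB where
  toFun a := ⟨Germ.ofElt a, isCompact_ofElt a, Germ.isOpen_ofElt a, Germ.injOn_src_ofElt a,
    injOn_rng_ofElt a⟩
  map_mul' a b := AmpStar.KB.ext (ofElt_mul a b)

theorem ofElt_zero : Germ.ofElt (0 : S.Carrier) = ∅ := by
  rw [← Set.image_eq_empty, Germ.src_image_ofElt, mul_zero, basic_zero]

theorem eq_zero_of_ofElt_eq_empty {a : S.Carrier} (h : Germ.ofElt a = ∅) : a = 0 := by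
  refine sinv_mul_self_eq_zero.1 (eq_zero_of_basic_eq_empty (sinv_mul_mem_idem a) ?_)
  rw [← Germ.src_image_ofElt, h, Set.image_empty]

theorem ofElt_of_isSupOf {A : Set S.Carrier} (hA : A.Finite) {j : S.Carrier}
    (hj : IsSupOf S.sub A j) : Germ.ofElt j = ⋃ a ∈ A, Germ.ofElt a := by
  refine Set.Subset.antisymm (fun γ hγ => ?_)
    (Set.iUnion₂_subset fun a ha => Germ.ofElt_mono (hj.1 a ha))
  obtain ⟨a, ha, haγ⟩ := Spectrum.exists_mem_of_isSupOf hA hj (Germ.src_mem_basic hγ)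
  exact Set.mem_biUnion ha ((Germ.mem_ofElt_iff_src_mem_basic (hj.1 a ha) hγ).2 haγ)

theorem exists_ofElt_eq_inter {a b : S.Carrier} (h : IsCompact (Germ.ofElt a ∩ Germ.ofElt b)) :
    ∃ z, S.sub z a ∧ S.sub z b ∧ Germ.ofElt z = Germ.ofElt a ∩ Germ.ofElt b := by
  obtain ⟨t, ht, htf, hcover⟩ := h.elim_finite_subcover_image (b := {z | S.sub z a ∧ S.sub z b})
    (c := Germ.ofElt) (fun z _ => Germ.isOpen_ofElt z) fun γ hγ => by
      obtain ⟨z, hza, hzb, hz⟩ := Germ.exists_mem_ofElt_of_mem_of_mem hγ.1 hγ.2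
      exact Set.mem_biUnion (show z ∈ {z | S.sub z a ∧ S.sub z b} from ⟨hza, hzb⟩) hz
  obtain ⟨j, hj⟩ := exists_isSupOf_of_finite htf fun x hx => (ht hx).1
  have hja := hj.2 a fun x hx => (ht hx).1
  have hjb := hj.2 b fun x hx => (ht hx).2
  refine ⟨j, hja, hjb, Set.Subset.antisymm
    (Set.subset_inter (Germ.ofElt_mono hja) (Germ.ofElt_mono hjb)) ?_⟩
  rwa [ofElt_of_isSupOf htf hj]

theorem exists_disjoint_compl_of_sub {z b : S.Carrier} (h : S.sub z b) :
    ∃ c, IsSupOf S.sub {z, c} b ∧ Disjoint (Germ.ofElt z) (Germ.ofElt c) := by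
  obtain ⟨e, he, heb, hze, hs⟩ := exists_orthogonal_compl (sinv_mul_mem_idem z)
    (sinv_mul_mem_idem b) (sub_sinv_mul h)
  have hb := S.distrib b _ _ _ hs
  rw [mul_sinv_mul', (S.natLE_of_sub _ _ h).eq_right] at hb
  have hbe : sinv (b * e) * (b * e) = e := by
    rw [InvSemigroup.sinv_mul, sinv_of_idem he, mul_assoc e, ← mul_assoc (sinv b),
      (natLE_iff_of_idem he).1 (S.natLE_of_sub _ _ heb), he]
  refine ⟨b * e, hb, Set.disjoint_left.2 fun γ hz hc => Spectrum.zero_notMem (Germ.src γ) ?_⟩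
  have he_mem := Germ.src_mem_basic hc
  rw [hbe] at he_mem
  exact hze ▸ Spectrum.mul_mem (Germ.src_mem_basic hz) he_mem

theorem ofElt_subset_iff {a b : S.Carrier} : Germ.ofElt a ⊆ Germ.ofElt b ↔ S.sub a b := by
  refine ⟨fun h => ?_, Germ.ofElt_mono⟩
  have hab := Set.inter_eq_left.2 h
  obtain ⟨z, hza, hzb, hz⟩ := exists_ofElt_eq_inter (hab.symm ▸ isCompact_ofElt a)
  rw [hab] at hz
  obtain ⟨c, hs, hd⟩ := exists_disjoint_compl_of_sub hza
  obtain rfl : c = 0 := eq_zero_of_ofElt_eq_empty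
    (hd.eq_bot_of_ge (hz ▸ Germ.ofElt_mono (hs.1 c (by simp))))
  have haz : S.sub a z := hs.2 z (by simp [S.sub_refl, S.zero_sub])
  exact S.sub_trans _ _ _ haz hzb

theorem toKB_injective : Function.Injective S.toKB := fun a b h => by
  have hab : Germ.ofElt a = Germ.ofElt b := congrArg Subtype.val h
  exact S.sub_antisymm _ _ (ofElt_subset_iff.1 hab.le) (ofElt_subset_iff.1 hab.ge)

theorem toKB_zero : S.toKB 0 = 0 := AmpStar.KB.ext ofElt_zero

theorem exists_isSupOf_of_isBisection_union {a b : S.Carrier}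
    (h : S.germs.IsBisection (Germ.ofElt a ∪ Germ.ofElt b))
    (hd : Disjoint (Germ.ofElt a) (Germ.ofElt b)) : ∃ j, IsSupOf S.sub {a, b} j := by
  obtain ⟨hl, hr⟩ := AmpStar.KB.orthogonal_of_isBisection_union (A := S.toKB a) (B := S.toKB b) h hd
  rw [← map_sinv S.toKB, ← map_mul, ← toKB_zero] at hl hr
  exact S.orthJoin a b (toKB_injective hl) (toKB_injective hr)

/-- The join of `a` and `b` is that of `a` and the complement in `b` of their intersection. -/
theorem exists_ofElt_eq_union {a b : S.Carrier}
    (h : S.germs.IsBisection (Germ.ofElt a ∪ Germ.ofElt b)) :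
    ∃ j, Germ.ofElt j = Germ.ofElt a ∪ Germ.ofElt b := by
  obtain ⟨z, hza, hzb, hz⟩ := exists_ofElt_eq_inter
    (AmpStar.KB.isCompact_inter_of_isBisection_union (A := S.toKB a) (B := S.toKB b) h)
  obtain ⟨c, hs, hd⟩ := exists_disjoint_compl_of_sub hzb
  have hcb : Germ.ofElt c ⊆ Germ.ofElt b := Germ.ofElt_mono (hs.1 c (by simp))
  have hac : Disjoint (Germ.ofElt a) (Germ.ofElt c) :=
    Set.disjoint_left.2 fun γ ha hc => Set.disjoint_left.1 hd (hz ▸ ⟨ha, hcb hc⟩) hc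
  obtain ⟨j, hj⟩ := exists_isSupOf_of_isBisection_union
    (GraphedSemigroupoid.IsBisection.mono h (Set.union_subset_union_right _ hcb)) hac
  refine ⟨j, ?_⟩
  rw [ofElt_of_isSupOf (Set.toFinite _) hj, ofElt_of_isSupOf (Set.toFinite _) hs, Set.biUnion_pair,
    Set.biUnion_pair, ← Set.union_assoc, Set.union_eq_left.2 (Germ.ofElt_mono hza)]

theorem exists_toKB_eq_biUnion {F : Set S.germs.KB} (hF : F.Finite) (hF' : F ⊆ Set.range S.toKB)
    (h : S.germs.IsBisection (⋃ A ∈ F, A.1)) : ∃ j, (S.toKB j).1 = ⋃ A ∈ F, A.1 := by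
  induction F, hF using Set.Finite.induction_on with
  | empty => exact ⟨0, ofElt_zero.trans (Set.biUnion_empty _).symm⟩
  | @insert A F _ _ ih =>
    rw [Set.biUnion_insert] at h ⊢
    obtain ⟨⟨a, rfl⟩, hFr⟩ := Set.insert_subset_iff.1 hF'
    obtain ⟨j, hj⟩ := ih hFr (h.mono Set.subset_union_right)
    rw [← hj] at h ⊢
    exact exists_ofElt_eq_union h

theorem toKB_surjective : Function.Surjective S.toKB := fun A => by
  obtain ⟨F, hF, hA, hF'⟩ := A.exists_finite_eq_biUnion (p := (· ∈ Set.range S.toKB))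
    fun γ hγ => by
      obtain ⟨_, ⟨a, rfl⟩, ha, haA⟩ :=
        (Germ.isTopologicalBasis_ofElt S).exists_subset_of_mem_open hγ A.isOpen
      exact ⟨S.toKB a, ha, haA, a, rfl⟩
  obtain ⟨j, hj⟩ := exists_toKB_eq_biUnion hF hF' (hA ▸ A.isBisection)
  exact ⟨j, AmpStar.KB.ext (hj.trans hA.symm)⟩

end SigmaOrd

/-! ### Duality -/

section QuasiInverse

universe v₁ v₂ u₁ u₂

variable {C : Type u₁} [Category.{v₁} C] {D : Type u₂} [Category.{v₂} D] {F : C ⥤ D}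
  (hF : F.FullyFaithful) (obj : D → C) (i : ∀ Y, Y ≅ F.obj (obj Y))

/-- The quasi-inverse of a fully faithful functor with prescribed preimages `obj Y` of the
objects: unlike in `CategoryTheory.Functor.inv`, the objects of the inverse are not chosen. -/
def quasiInverse : D ⥤ C where
  obj := obj
  map {X Y} f := hF.preimage ((i X).inv ≫ f ≫ (i Y).hom)
  map_id X := hF.map_injective (by simp)
  map_comp f g := hF.map_injective (by simp)

theorem map_quasiInverse_map {X Y : D} (f : X ⟶ Y) :
    F.map ((quasiInverse hF obj i).map f) = (i X).inv ≫ f ≫ (i Y).hom :=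
  hF.map_preimage _

/-- The equivalence of categories given by a fully faithful functor and its quasi-inverse. -/
def equivalenceOfQuasiInverse : C ≌ D :=
  CategoryTheory.Equivalence.mk F (quasiInverse hF obj i)
    (NatIso.ofComponents (fun X => hF.preimageIso (i (F.obj X)))
      fun f => hF.map_injective (by simp [quasiInverse]))
    (NatIso.ofComponents (fun Y => (i Y).symm) fun f => by simp [quasiInverse])

end QuasiInverse

namespace SigmaOrd

variable {S T : SigmaOrd.{u}}

/-- A multiplicative order isomorphism, as a morphism of Σ-ordered inverse semigroups. -/
def Hom.ofMulEquiv (e : S.Carrier ≃* T.Carrier)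
    (he : ∀ a b, T.sub (e a) (e b) ↔ S.sub a b) : Hom S T where
  toFun := e
  map_mul := e.map_mul
  map_zero := _root_.map_zero e
  mono a b := (he a b).2
  map_join a b c h := by
    have hsup := (isSupOf_image_relIso (RelIso.mk e.toEquiv (he _ _))).2 h
    rwa [Set.image_pair] at hsup
  weakMeet a b t ha hb := by
    obtain ⟨c, rfl⟩ := e.surjective t
    exact ⟨c, (he _ _).1 ha, (he _ _).1 hb, T.sub_refl _⟩
  proper t := by
    obtain ⟨c, rfl⟩ := e.surjective t
    exact ⟨{e c}, Set.finite_singleton _, ⟨by simp [T.sub_refl], fun d hd => hd _ rfl⟩,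
      fun x hx => ⟨c, hx ▸ T.sub_refl _⟩⟩
  map_interpolator a b p _ h := by
    have hz : ∀ x y, e x * e y = 0 ↔ x * y = 0 := fun x y => by
      rw [← _root_.map_mul, ← _root_.map_zero e, e.apply_eq_iff_eq]
    refine isInterpolator_of_right (h.1.map (e : S.Carrier →ₙ* T.Carrier)) ((he _ _).2 h.2.1) ?_
    simpa only [e.surjective.forall, hz] using h.2.2.1

/-- A multiplicative order isomorphism, as an isomorphism of Σ-ordered inverse semigroups. -/
def isoOfMulEquiv (e : S.Carrier ≃* T.Carrier)
    (he : ∀ a b, T.sub (e a) (e b) ↔ S.sub a b) : S ≅ T where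
  hom := Hom.ofMulEquiv e he
  inv := Hom.ofMulEquiv e.symm fun a b => by rw [← he, e.apply_symm_apply, e.apply_symm_apply]
  hom_inv_id := Hom.ext (funext e.symm_apply_apply)
  inv_hom_id := Hom.ext (funext e.apply_symm_apply)

/-- `toKB`, as an isomorphism of Σ-ordered inverse semigroups. -/
noncomputable def isoBisectionsGerms (S : SigmaOrd.{u}) : S ≅ S.germs.bisections :=
  isoOfMulEquiv (T := S.germs.bisections)
    (MulEquiv.ofBijective S.toKB ⟨toKB_injective, toKB_surjective⟩) fun _ _ => ofElt_subset_iff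

/-- The functor of germs, defined on morphisms by duality; `isGermFunctor_germFunctor` describes
these in terms of germs. -/
noncomputable def germFunctor : SigmaOrd.{u} ⥤ AmpStar.{u}ᵒᵖ :=
  quasiInverse AmpStar.fullyFaithfulBisectionFunctor (fun S => op S.germs) isoBisectionsGerms

/-- The duality of ample inverse semigroupoids and Σ-ordered inverse semigroups. -/
noncomputable def stoneDuality : AmpStar.{u}ᵒᵖ ≌ SigmaOrd.{u} :=
  equivalenceOfQuasiInverse AmpStar.fullyFaithfulBisectionFunctor (fun S => op S.germs)
    isoBisectionsGerms

/-- The map of germs induced by a morphism. -/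
noncomputable def germMap (θ : S ⟶ T) : T.Germ → S.Germ := (germFunctor.map θ).unop.toFun

theorem germMap_preimage_ofElt (θ : S ⟶ T) (s : S.Carrier) :
    germMap θ ⁻¹' Germ.ofElt s = Germ.ofElt (Hom.toFun θ s) := by
  have h : S.isoBisectionsGerms.hom ≫ AmpStar.bisectionFunctor.map (germFunctor.map θ) =
      θ ≫ T.isoBisectionsGerms.hom :=
    (Iso.eq_inv_comp _).1 (map_quasiInverse_map ..)
  have hs : (germFunctor.map θ).unop.preimage (S.toKB s) = T.toKB (Hom.toFun θ s) :=
    congrFun (congrArg Hom.toFun h) s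
  exact congrArg Subtype.val hs

theorem mem_src_germMap_iff (θ : S ⟶ T) (γ : T.Germ) {f : S.Carrier} (hf : f ∈ S.idem) :
    f ∈ (Germ.src (germMap θ γ)).carrier ↔ Hom.toFun θ f ∈ (Germ.src γ).carrier := by
  have hθf : Hom.toFun θ f ∈ T.idem := (Hom.map_mul θ f f).symm.trans (congrArg _ hf)
  have h : Germ.src (germMap θ γ) ∈ Germ.src '' Germ.ofElt f ↔
      Germ.src γ ∈ Germ.src '' (germMap θ ⁻¹' Germ.ofElt f) :=
    (germFunctor.map θ).unop.src_mem_src_image_iff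
  rwa [germMap_preimage_ofElt, Germ.src_image_ofElt, Germ.src_image_ofElt, sinv_mul_of_idem hf,
    sinv_mul_of_idem hθf] at h

theorem src_germMap (θ : S ⟶ T) (γ : T.Germ) :
    (Germ.src (germMap θ γ)).carrier = specMap θ (Germ.src γ).carrier := by
  ext e
  constructor
  · intro he
    have he_idem := Spectrum.idem_of_mem he
    exact ⟨he_idem, fun f hf hfγ =>
      (Spectrum.mem_iff he_idem).1 he f ((mem_src_germMap_iff θ γ hf).2 hfγ)⟩
  · rintro ⟨he_idem, he⟩
    refine (Spectrum.mem_iff he_idem).2 fun f hf => ?_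
    have hf_idem := Spectrum.idem_of_mem hf
    exact he f hf_idem ((mem_src_germMap_iff θ γ hf_idem).1 hf)

theorem exists_represents (θ : S ⟶ T) (q : T.Semidirect) :
    ∃ p : S.Semidirect, Represents θ q p := by
  obtain ⟨p, hp⟩ := Semidirect.germ_surjective (germMap θ q.germ)
  have hpt := src_germMap θ q.germ
  have hq : q.germ ∈ germMap θ ⁻¹' Germ.ofElt p.elt := ⟨p, rfl, hp⟩
  rw [germMap_preimage_ofElt] at hq
  obtain ⟨q', hq', hqq'⟩ := hq
  exact ⟨p, (congrArg (Spectrum.carrier ∘ Germ.src) hp).trans hpt, q', hq',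
    (germ_eq_iff.1 hqq').1, hqq'⟩

theorem germMap_eq_of_represents {θ : S ⟶ T} {q : T.Semidirect} {p : S.Semidirect}
    (h : Represents θ q p) : germMap θ q.germ = p.germ := by
  obtain ⟨hpt, q', hq', -, hqq'⟩ := h
  have hmem : q.germ ∈ germMap θ ⁻¹' Germ.ofElt p.elt := by
    rw [germMap_preimage_ofElt]
    exact ⟨q', hq', hqq'⟩
  exact Germ.injOn_src_ofElt p.elt hmem (Germ.germ_mem_ofElt_elt p)
    (Spectrum.ext ((src_germMap θ q.germ).trans hpt.symm))

theorem isGermFunctor_germFunctor : IsGermFunctor germFunctor.{u}.leftOp :=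
  ⟨fun S => Homeomorph.refl S.Spectrum, fun S => Homeomorph.refl S.Germ,
    fun _ _ => rfl, fun _ p => (munnHat_eq p.elt p.pt).symm,
    fun _ p q h => ⟨p.mul q h, rfl, rfl, Germ.mul_germ p q h⟩,
    fun _ _ θ q => ⟨exists_represents θ q, fun _ h => germMap_eq_of_represents h⟩⟩

end SigmaOrd

theorem mainTheorem1 :
    ∃ D : AmpStar.{u}ᵒᵖ ≌ SigmaOrd.{u},
      IsBisectionFunctor D.functor ∧ IsGermFunctor D.inverse.leftOp :=
  ⟨SigmaOrd.stoneDuality, AmpStar.isBisectionFunctor_bisectionFunctor,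
    SigmaOrd.isGermFunctor_germFunctor⟩
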